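/- **Setting.** Let $G$ be a locally compact Hausdorff group with a (left) Haar measure $\mu$, and let $B$ be a $G$-$C^*$-algebra, i.e. a (not necessarily unital) complex $C^*$-algebra with an action of $G$ by $*$-automorphisms $b \mapsto g(b)$ such that $g \mapsto g(b)$ is norm continuous for every $b \in B$. Let $L^2(G,B)$ be the Hilbert $C^*$-module obtained by completing $C_c(G,B)$ for the norm $\|v\| = \|\langle v,v\rangle\|_B^{1/2}$, where $$\langle v,w\rangle = \int_G g^{-1}\big(v(g)^* w(g)\big)\, d\mu(g),$$ and let $\mathcal B(L^2(G,B))$ be the algebra of bounded linear operators on it. For $a \in C_c(G,B)$, let $\lambda(a) \in \mathcal B(L^2(G,B))$ be the operator that on $C_c(G,B)$ is given by $$(\lambda(a)v)(t) = \int_G a(s)\, s\big(v(s^{-1}t)\big)\, d\mu(s).$$ The reduced crossed product $C_r^*(G,B)$ is the norm closure of $\lambda(C_c(G,B))$ in $\mathcal B(L^2(G,B))$. Let $\ell : G \to \mathbb R_{\ge 0}$ be a Borel measurable length function, i.e. $\ell(1) = 0$, $\ell(gh) \le \ell(g) + \ell(h)$ and $\ell(g^{-1}) = \ell(g)$ for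 all $g,h \in G$. Put $\sigma = 1 + \ell$, and regard pointwise multiplication by $\sigma$ as a closed, densely defined operator on $L^2(G,B)$: the closure of $f \mapsto \sigma f$ on the functions $f : G \to B$ for which $f$ and $\sigma f$ are both square integrable. For $A \in \mathcal B(L^2(G,B))$ write $D(A) = [\sigma, A] : v \mapsto \sigma A(v) - A(\sigma v)$. This is said to be bounded if $A$ maps the domain of $\sigma$ into itself and $\sigma A - A \sigma$ extends from that domain to an element of $\mathcal B(L^2(G,B))$, which is then again denoted $D(A)$. Let $$V_\ell^\infty(G,B) = \{ A \in C_r^*(G,B) : D^n(A) \in \mathcal B(L^2(G,B)) \text{ for all } n \ge 0\},$$ with the topology given by the seminorms $A \mapsto \|D^n(A)\|$, $n \ge 0$. For a compact open subgroup $K \subset G$, let $e_K \in \mathcal B(L^2(G,B))$ be the projection given on $C_c(G,B)$ by $$(e_K v)(t) = \mu(K)^{-1} \int_K k\big(v(k^{-1}t)\big)\, d\mu(k).$$ For $S = V_\ell^\infty(G,B)$ or $S = C_r^*(G,B)$, let $e_K S e_K$ be the subalgebra of all $A \in S$ with $e_K A = A = A e_K$, with the topology of $S$. For a topological $\mathbb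 C$-algebra $A$ with unitization $A^+ = A \oplus \mathbb C$, let $K_0(A)$ be the kernel of $K_0(A^+) \to K_0(\mathbb C)$, where $K_0$ of a unital ring is the Grothendieck group of the monoid of equivalence classes of idempotent matrices over it, and let $K_1(A)$ be $GL_\infty(A^+) = \varinjlim_n GL_n(A^+)$ modulo homotopy, i.e. modulo the elements that can be connected to $1$ by a path in some $GL_n(A^+)$ that is continuous together with its inverse. **Statement.** 1. The inclusion $V_\ell^\infty(G,B) \to C_r^*(G,B)$ induces isomorphisms on $K_0$ and on $K_1$. 2. For every compact open subgroup $K \subset G$ such that $\ell$ is $K$-biinvariant (that is, $\ell(kg) = \ell(g) = \ell(gk)$ for all $k \in K$, $g \in G$), the inclusion $e_K V_\ell^\infty(G,B) e_K \to e_K C_r^*(G,B) e_K$ induces isomorphisms on $K_0$ and on $K_1$. -/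

import Mathlib

set_option linter.unusedSectionVars false

namespace KTheory

open scoped Matrix

section Ring
variable {R S T : Type*} [Ring R] [Ring S] [Ring T]

/-- Algebraic (Murray-von Neumann) equivalence of two square matrices. -/
def MvN {m n : Type*} [Fintype m] [Fintype n] (e : Matrix m m R) (f : Matrix n n R) : Prop :=
  ∃ (x : Matrix m n R) (y : Matrix n m R), x * y = e ∧ y * x = f

theorem MvN.symm {m n : Type*} [Fintype m] [Fintype n] {e : Matrix m m R} {f : Matrix n n R}
    (h : MvN e f) : MvN f e := by
  obtain ⟨x, y, h1, h2⟩ := h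
  exact ⟨y, x, h2, h1⟩

theorem MvN.trans {l m n : Type*} [Fintype l] [Fintype m] [Fintype n] {e : Matrix l l R}
    {f : Matrix m m R} {g : Matrix n n R} (he : e * e = e) (hg : g * g = g)
    (h : MvN e f) (h' : MvN f g) : MvN e g := by
  obtain ⟨x, y, rfl, rfl⟩ := h
  obtain ⟨z, w, h1, rfl⟩ := h'
  refine ⟨x * z, w * y, ?_, ?_⟩
  · calc x * z * (w * y) = x * (z * w) * y := by simp only [Matrix.mul_assoc]
      _ = (x * y) * (x * y) := by rw [h1]; simp only [Matrix.mul_assoc]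
      _ = x * y := he
  · calc w * y * (x * z) = w * (y * x) * z := by simp only [Matrix.mul_assoc]
      _ = (w * z) * (w * z) := by rw [← h1]; simp only [Matrix.mul_assoc]
      _ = w * z := hg

theorem MvN.of_submatrix {m n : Type*} [Fintype m] [Fintype n] {e : Matrix m m R}
    {f : Matrix n n R} (he : e * e = e) (σ : n ≃ m) (h : f = e.submatrix σ σ) : MvN e f := by
  refine ⟨e.submatrix id σ, e.submatrix σ id, ?_, ?_⟩
  · rw [Matrix.submatrix_mul_equiv, he, Matrix.submatrix_id_id]
  · rw [h, ← Matrix.submatrix_mul _ _ _ _ _ Function.bijective_id, he]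

theorem MvN.fromBlocks {m n m' n' : Type*} [Fintype m] [Fintype n] [Fintype m'] [Fintype n']
    {e : Matrix m m R} {f : Matrix n n R} {e' : Matrix m' m' R} {f' : Matrix n' n' R}
    (h : MvN e e') (h' : MvN f f') :
    MvN (Matrix.fromBlocks e 0 0 f) (Matrix.fromBlocks e' 0 0 f') := by
  obtain ⟨x, y, rfl, rfl⟩ := h
  obtain ⟨z, w, rfl, rfl⟩ := h'
  exact ⟨Matrix.fromBlocks x 0 0 z, Matrix.fromBlocks y 0 0 w,
    by simp [Matrix.fromBlocks_multiply], by simp [Matrix.fromBlocks_multiply]⟩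

variable (R) in
/-- Idempotent square matrices over `R`, of arbitrary finite size. -/
structure Idem where
  size : ℕ
  mat : Matrix (Fin size) (Fin size) R
  idem : mat * mat = mat

instance Idem.setoid : Setoid (Idem R) where
  r e f := MvN e.mat f.mat
  iseqv :=
    { refl := fun e => MvN.of_submatrix e.idem (Equiv.refl _) (by simp)
      symm := fun h => h.symm
      trans := fun {e f g} h h' => h.trans e.idem g.idem h' }

/-- Block sum `diag(e, f)` of idempotents. -/
def Idem.add (e f : Idem R) : Idem R where
  size := e.size + f.size
  mat := (Matrix.fromBlocks e.mat 0 0 f.mat).submatrix finSumFinEquiv.symm finSumFinEquiv.symm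
  idem := by
    rw [Matrix.submatrix_mul_equiv, Matrix.fromBlocks_multiply]
    simp [e.idem, f.idem]

theorem Idem.blocks_idem {m n : Type*} [Fintype m] [Fintype n] {e : Matrix m m R}
    {f : Matrix n n R} (he : e * e = e) (hf : f * f = f) :
    Matrix.fromBlocks e 0 0 f * Matrix.fromBlocks e 0 0 f = Matrix.fromBlocks e 0 0 f := by
  simp [Matrix.fromBlocks_multiply, he, hf]

theorem Idem.add_mvn (e f : Idem R) : MvN (Matrix.fromBlocks e.mat 0 0 f.mat) (e.add f).mat :=
  MvN.of_submatrix (Idem.blocks_idem e.idem f.idem) finSumFinEquiv.symm rfl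

variable (R) in
/-- Equivalence classes of idempotent matrices over `R`; this is the monoid of isomorphism
classes of finitely generated projective modules. -/
def ProjClass : Type _ := Quotient (Idem.setoid (R := R))

instance : Zero (ProjClass R) := ⟨Quotient.mk _ ⟨0, 0, by simp⟩⟩

instance : Add (ProjClass R) where
  add := Quotient.map₂ Idem.add (by
    intro e e' h f f' h'
    exact ((e.add_mvn f).symm.trans (e.add f).idem (Idem.blocks_idem e'.idem f'.idem)
      (MvN.fromBlocks h h')).trans (e.add f).idem (e'.add f').idem (e'.add_mvn f'))

instance : AddCommMonoid (ProjClass R) where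
  nsmul := nsmulRec
  add_assoc := by
    rintro ⟨e⟩ ⟨f⟩ ⟨g⟩
    refine Quotient.sound ?_
    have h1 : MvN (Matrix.fromBlocks (Matrix.fromBlocks e.mat 0 0 f.mat) 0 0 g.mat)
        ((e.add f).add g).mat :=
      (MvN.fromBlocks (e.add_mvn f) (MvN.of_submatrix g.idem (Equiv.refl _) (by simp))).trans
        (Idem.blocks_idem (Idem.blocks_idem e.idem f.idem) g.idem) ((e.add f).add g).idem
        ((e.add f).add_mvn g)
    have h2 : MvN (Matrix.fromBlocks e.mat 0 0 (Matrix.fromBlocks f.mat 0 0 g.mat))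
        (e.add (f.add g)).mat :=
      (MvN.fromBlocks (MvN.of_submatrix e.idem (Equiv.refl _) (by simp)) (f.add_mvn g)).trans
        (Idem.blocks_idem e.idem (Idem.blocks_idem f.idem g.idem)) (e.add (f.add g)).idem
        (e.add_mvn (f.add g))
    have h3 : MvN (Matrix.fromBlocks (Matrix.fromBlocks e.mat 0 0 f.mat) 0 0 g.mat)
        (Matrix.fromBlocks e.mat 0 0 (Matrix.fromBlocks f.mat 0 0 g.mat)) := by
      refine MvN.of_submatrix (Idem.blocks_idem (Idem.blocks_idem e.idem f.idem) g.idem)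
        (Equiv.sumAssoc _ _ _).symm ?_
      ext (i | i | i) (j | j | j) <;> rfl
    exact (h1.symm.trans ((e.add f).add g).idem
      (Idem.blocks_idem e.idem (Idem.blocks_idem f.idem g.idem)) h3).trans
      ((e.add f).add g).idem (e.add (f.add g)).idem h2
  zero_add := by
    rintro ⟨e⟩
    refine Quotient.sound ?_
    let z : Idem R := ⟨0, 0, by simp⟩
    have h : MvN (Matrix.fromBlocks z.mat 0 0 e.mat) e.mat := by
      refine MvN.of_submatrix (Idem.blocks_idem z.idem e.idem) (Equiv.emptySum (Fin 0) _).symm ?_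
      ext i j
      rfl
    exact (z.add_mvn e).symm.trans (z.add e).idem e.idem h
  add_zero := by
    rintro ⟨e⟩
    refine Quotient.sound ?_
    let z : Idem R := ⟨0, 0, by simp⟩
    have h : MvN (Matrix.fromBlocks e.mat 0 0 z.mat) e.mat := by
      refine MvN.of_submatrix (Idem.blocks_idem e.idem z.idem) (Equiv.sumEmpty _ (Fin 0)).symm ?_
      ext i j
      rfl
    exact (e.add_mvn z).symm.trans (e.add z).idem e.idem h
  add_comm := by
    rintro ⟨e⟩ ⟨f⟩
    refine Quotient.sound ?_
    have h : MvN (Matrix.fromBlocks e.mat 0 0 f.mat) (Matrix.fromBlocks f.mat 0 0 e.mat) := by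
      refine MvN.of_submatrix (Idem.blocks_idem e.idem f.idem) (Equiv.sumComm _ _) ?_
      ext (i | i) (j | j) <;> rfl
    exact ((e.add_mvn f).symm.trans (e.add f).idem (Idem.blocks_idem f.idem e.idem) h).trans
      (e.add f).idem (f.add e).idem (f.add_mvn e)

/-- Apply a ring homomorphism entrywise to an idempotent matrix. -/
def Idem.map (φ : R →+* S) (e : Idem R) : Idem S where
  size := e.size
  mat := e.mat.map φ
  idem := by rw [← Matrix.map_mul, e.idem]

/-- The homomorphism of monoids of classes of idempotents induced by a ring homomorphism. -/
def ProjClass.map (φ : R →+* S) : ProjClass R →+ ProjClass S where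
  toFun := Quotient.map (Idem.map φ) (by
    rintro e f ⟨x, y, h1, h2⟩
    exact ⟨x.map φ, y.map φ, (Matrix.map_mul (L := x) (M := y) (f := φ)).symm.trans
      (congrArg (fun M => M.map φ) h1), (Matrix.map_mul (L := y) (M := x) (f := φ)).symm.trans
      (congrArg (fun M => M.map φ) h2)⟩)
  map_zero' := Quotient.sound (MvN.of_submatrix (Idem.map φ ⟨0, 0, by simp⟩).idem (Equiv.refl _)
    (by ext i; exact i.elim0))
  map_add' := by
    rintro ⟨e⟩ ⟨f⟩
    refine Quotient.sound (MvN.of_submatrix (Idem.map φ (e.add f)).idem (Equiv.refl _) ?_)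
    have h : Matrix.fromBlocks (e.mat.map φ) 0 0 (f.mat.map φ) =
        (Matrix.fromBlocks e.mat 0 0 f.mat).map φ := by
      rw [Matrix.fromBlocks_map]
      simp
    exact congrArg (fun M => Matrix.submatrix M finSumFinEquiv.symm finSumFinEquiv.symm) h

variable (R) in
/-- `K₀` of a unital ring: the Grothendieck group of the monoid of classes of idempotents. -/
abbrev K0Ring : Type _ := Algebra.GrothendieckAddGroup (ProjClass R)

/-- Functoriality of `K₀` of unital rings. -/
noncomputable def K0Ring.map (φ : R →+* S) : K0Ring R →+ K0Ring S :=
  Algebra.GrothendieckAddGroup.lift (Algebra.GrothendieckAddGroup.of.comp (ProjClass.map φ))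

theorem ProjClass.map_comp (φ : R →+* S) (ψ : S →+* T) :
    (ProjClass.map ψ).comp (ProjClass.map φ) = ProjClass.map (ψ.comp φ) := by
  ext x
  obtain ⟨e⟩ := x
  rfl

theorem K0Ring.map_of (φ : R →+* S) (x : ProjClass R) :
    K0Ring.map φ (Algebra.GrothendieckAddGroup.of x) =
      Algebra.GrothendieckAddGroup.of (ProjClass.map φ x) := by
  have := Algebra.GrothendieckAddGroup.lift.symm_apply_apply
    (Algebra.GrothendieckAddGroup.of.comp (ProjClass.map φ))
  exact DFunLike.congr_fun this x

theorem K0Ring.map_map (φ : R →+* S) (ψ : S →+* T) (x : K0Ring R) :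
    K0Ring.map ψ (K0Ring.map φ x) = K0Ring.map (ψ.comp φ) x := by
  have : (K0Ring.map ψ).comp (K0Ring.map φ) = K0Ring.map (ψ.comp φ) := by
    apply Algebra.GrothendieckAddGroup.lift.symm.injective
    ext x
    simp only [Algebra.GrothendieckAddGroup.lift_symm_apply, AddMonoidHom.comp_apply]
    rw [K0Ring.map_of, K0Ring.map_of, K0Ring.map_of, ← ProjClass.map_comp]
    rfl
  exact DFunLike.congr_fun this x

/-- The `n × m` matrix with entries `1` on the diagonal and `0` elsewhere. -/
def incl (R : Type*) [Ring R] {m n : ℕ} (h : m ≤ n) : Matrix (Fin n) (Fin m) R :=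
  (1 : Matrix (Fin n) (Fin n) R).submatrix id (Fin.castLE h)

theorem incl_apply {m n : ℕ} (h : m ≤ n) (i : Fin n) (j : Fin m) :
    incl R h i j = if i = Fin.castLE h j then 1 else 0 := by
  simp [incl, Matrix.one_apply]

theorem incl_tr_mul {m n : ℕ} (h : m ≤ n) : (incl R h)ᵀ * incl R h = 1 := by
  ext i j
  simp [incl_apply, Matrix.mul_apply, Matrix.one_apply, eq_comm]

theorem incl_mul {l m n : ℕ} (h : l ≤ m) (h' : m ≤ n) :
    incl R h' * incl R h = incl R (h.trans h') := by
  ext i j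
  simp [incl_apply, Matrix.mul_apply]

theorem incl_tr_mul_tr {l m n : ℕ} (h : l ≤ m) (h' : m ≤ n) :
    (incl R h)ᵀ * (incl R h')ᵀ = (incl R (h.trans h'))ᵀ := by
  ext i j
  rw [Matrix.mul_apply, Finset.sum_eq_single (Fin.castLE h i)]
  · simp [incl_apply]
  · intro x _ hx
    simp [incl_apply, hx]
  · simp

theorem incl_self (n : ℕ) (h : n ≤ n) : incl R h = 1 := by
  ext i j
  simp [incl_apply, Matrix.one_apply]

/-- The embedding `M ↦ diag(M, 1)` of `m × m` matrices into `n × n` matrices, for `m ≤ n`. -/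
def stab (R : Type*) [Ring R] {m n : ℕ} (h : m ≤ n) :
    Matrix (Fin m) (Fin m) R →* Matrix (Fin n) (Fin n) R where
  toFun M := 1 + incl R h * (M - 1) * (incl R h)ᵀ
  map_one' := by simp
  map_mul' M N := by
    have key : incl R h * (M - 1) * (incl R h)ᵀ * (incl R h * (N - 1) * (incl R h)ᵀ) =
        incl R h * ((M - 1) * (N - 1)) * (incl R h)ᵀ := by
      calc _ = incl R h * (M - 1) * ((incl R h)ᵀ * incl R h) * (N - 1) * (incl R h)ᵀ := by
            simp only [Matrix.mul_assoc]
        _ = _ := by rw [incl_tr_mul]; simp only [Matrix.mul_assoc, Matrix.one_mul]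
    have h2 : M * N - 1 = (M - 1) + (N - 1) + (M - 1) * (N - 1) := by noncomm_ring
    rw [add_mul, mul_add, mul_add, key, h2, Matrix.mul_add, Matrix.mul_add, Matrix.add_mul,
      Matrix.add_mul]
    simp only [one_mul, mul_one]
    abel

variable (R) in
/-- The group `GL_n(R)` of invertible `n × n` matrices. -/
abbrev GLn (n : ℕ) : Type _ := (Matrix (Fin n) (Fin n) R)ˣ

variable (R) in
/-- The stabilization `u ↦ diag(u, 1)` from `GL_m(R)` to `GL_n(R)`, for `m ≤ n`. -/
abbrev GLn.stab (m n : ℕ) (h : m ≤ n) : GLn R m →* GLn R n := Units.map (KTheory.stab R h)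

instance : DirectedSystem (GLn R) (fun m n h => GLn.stab R m n h) where
  map_self m u := by
    ext1
    simp [KTheory.stab, incl_self]
  map_map k j i hij hjk u := by
    ext1
    simp only [GLn.stab, Units.coe_map, KTheory.stab, MonoidHom.coe_mk, OneHom.coe_mk,
      add_sub_cancel_left]
    rw [← incl_tr_mul_tr hij hjk, ← incl_mul hij hjk]
    simp only [Matrix.mul_assoc]

variable (R) in
/-- The stable general linear group `GL_∞(R)`, the union of the groups `GL_n(R)`. -/
abbrev GLInf : Type _ := DirectLimit (GLn R) (GLn.stab R)

theorem stab_map (φ : R →+* S) {m n : ℕ} (h : m ≤ n) (M : Matrix (Fin m) (Fin m) R) :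
    stab S h (M.map φ) = (stab R h M).map φ := by
  have hi : (incl R h).map φ = incl S h := by
    ext i j
    simp [incl_apply, apply_ite φ]
  have hi' : ((incl R h)ᵀ).map φ = (incl S h)ᵀ := by
    rw [Matrix.transpose_map, hi]
  have h1 : ∀ k : ℕ, (1 : Matrix (Fin k) (Fin k) R).map φ = 1 := fun k =>
    Matrix.map_one φ (map_zero φ) (map_one φ)
  change 1 + incl S h * (M.map φ - 1) * (incl S h)ᵀ =
    (1 + incl R h * (M - 1) * (incl R h)ᵀ).map φ
  rw [Matrix.map_add φ (map_add φ), Matrix.map_mul, Matrix.map_mul, Matrix.map_sub φ (map_sub φ),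
    h1, h1, hi, hi']

/-- The homomorphism `GL_n(R) → GL_n(S)` induced by a ring homomorphism. -/
abbrev GLn.map (φ : R →+* S) (n : ℕ) : GLn R n →* GLn S n :=
  Units.map (φ.mapMatrix : Matrix (Fin n) (Fin n) R →+* Matrix (Fin n) (Fin n) S).toMonoidHom

/-- The homomorphism `GL_∞(R) → GL_∞(S)` induced by a ring homomorphism. -/
noncomputable def GLInf.map (φ : R →+* S) : GLInf R →* GLInf S where
  toFun := DirectLimit.map (GLn.stab R) (GLn.stab S) (fun n => GLn.map φ n) (by
    intro i j h u
    ext1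
    exact stab_map φ h u.1)
  map_one' := by
    rw [DirectLimit.one_def 0, DirectLimit.map_def, map_one, ← DirectLimit.one_def]
  map_mul' x y := by
    induction x, y using DirectLimit.induction₂ with
    | ih n x y => simp only [DirectLimit.mul_def, DirectLimit.map_def, map_mul]

end Ring

section Topological

variable (A A' : Type*) [NonUnitalRing A] [Module ℂ A] [IsScalarTower ℂ A A]
  [SMulCommClass ℂ A A] [NonUnitalRing A'] [Module ℂ A'] [IsScalarTower ℂ A' A']
  [SMulCommClass ℂ A' A']

/-- `K₀` of a possibly non-unital complex algebra `A`: the kernel of `K₀(A⁺) → K₀(ℂ)`, where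
`A⁺ = ℂ ⊕ A` is the algebra with a unit adjoined. -/
noncomputable abbrev K0 : AddSubgroup (K0Ring (Unitization ℂ A)) :=
  (K0Ring.map (Unitization.fstHom ℂ A : Unitization ℂ A →+* ℂ)).ker

variable {A A'} in
/-- The unital homomorphism `A⁺ → A'⁺` extending a homomorphism `A → A'`. -/
def unitMap (f : A →ₙₐ[ℂ] A') : Unitization ℂ A →+* Unitization ℂ A' :=
  ((Unitization.inrNonUnitalAlgHom ℂ A').comp f).toAlgHom

variable {A A'} in
theorem unitMap_fst (f : A →ₙₐ[ℂ] A') (x : Unitization ℂ A) : (unitMap f x).fst = x.fst := by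
  change (algebraMap ℂ (Unitization ℂ A') x.fst + Unitization.inr (f x.snd)).fst = x.fst
  rw [Unitization.algebraMap_eq_inl]
  simp

variable {A A'} in
theorem unitMap_snd (f : A →ₙₐ[ℂ] A') (x : Unitization ℂ A) : (unitMap f x).snd = f x.snd := by
  change (algebraMap ℂ (Unitization ℂ A') x.fst + Unitization.inr (f x.snd)).snd = f x.snd
  rw [Unitization.algebraMap_eq_inl]
  simp

variable {A A'} in
/-- The homomorphism `K₀(A) → K₀(A')` induced by a homomorphism `A → A'`. -/
noncomputable def K0.map (f : A →ₙₐ[ℂ] A') : K0 A →+ K0 A' :=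
  ((K0Ring.map (unitMap f)).comp (K0 A).subtype).codRestrict (K0 A') (by
    rintro ⟨x, hx⟩
    have h : (Unitization.fstHom ℂ A' : Unitization ℂ A' →+* ℂ).comp (unitMap f) =
        (Unitization.fstHom ℂ A : Unitization ℂ A →+* ℂ) := by
      ext x
      exact unitMap_fst f x
    change K0Ring.map _ (K0Ring.map _ x) = 0
    rw [K0Ring.map_map, h]
    exact hx)

variable {A} [TopologicalSpace A] [TopologicalSpace A']

/-- Continuity of a map into the square matrices over `A⁺ = ℂ ⊕ A`, for the product topology. -/
def ContinuousMatrix {X : Type*} [TopologicalSpace X] {n : ℕ}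
    (γ : X → Matrix (Fin n) (Fin n) (Unitization ℂ A)) : Prop :=
  ∀ i j, Continuous (fun x => (γ x i j).fst) ∧ Continuous (fun x => (γ x i j).snd)

/-- `u` can be joined to `1` by a continuous path in the group `GL_n(A⁺)`: the path and its
inverse are continuous. -/
def GLn.IsHomotopicToOne {n : ℕ} (u : GLn (Unitization ℂ A) n) : Prop :=
  ∃ γ : unitInterval → GLn (Unitization ℂ A) n, γ 0 = 1 ∧ γ 1 = u ∧
    ContinuousMatrix (fun t => (γ t : Matrix (Fin n) (Fin n) (Unitization ℂ A))) ∧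
    ContinuousMatrix (fun t => ((γ t)⁻¹ : GLn (Unitization ℂ A) n).val)

variable (A) in
/-- The elements of `GL_∞(A⁺)` that are joined to `1` by a path in some `GL_n(A⁺)`. (For a
topological algebra these form a normal subgroup, so that taking the normal closure below adds
no elements.) -/
def GLInf.homotopicToOne : Set (GLInf (Unitization ℂ A)) :=
  {x | ∃ (n : ℕ) (u : GLn (Unitization ℂ A) n), u.IsHomotopicToOne ∧ x = ⟦⟨n, u⟩⟧}

variable (A) in
/-- `K₁` of a topological algebra `A`: the group of path components of `GL_∞(A⁺)`. -/
abbrev K1 : Type _ :=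
  GLInf (Unitization ℂ A) ⧸ Subgroup.normalClosure (GLInf.homotopicToOne A)

variable {A'} in
/-- The homomorphism `K₁(A) → K₁(A')` induced by a continuous homomorphism `A → A'`. -/
noncomputable def K1.map (f : A →ₙₐ[ℂ] A') (hf : Continuous f) : K1 A →* K1 A' :=
  QuotientGroup.map _ _ (GLInf.map (unitMap f)) (by
    refine Subgroup.normalClosure_le_normal ?_
    rintro _ ⟨n, u, ⟨γ, h0, h1, hc, hc'⟩, rfl⟩
    refine Subgroup.subset_normalClosure ⟨n, GLn.map (unitMap f) n u,
      ⟨fun t => GLn.map (unitMap f) n (γ t), (congrArg _ h0).trans (map_one _), congrArg _ h1,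
        ?_, ?_⟩, rfl⟩
    · intro i j
      exact ⟨(hc i j).1.congr fun t => (unitMap_fst f _).symm,
        (hf.comp (hc i j).2).congr fun t => (unitMap_snd f _).symm⟩
    · intro i j
      exact ⟨(hc' i j).1.congr fun t => (unitMap_fst f _).symm,
        (hf.comp (hc' i j).2).congr fun t => (unitMap_snd f _).symm⟩)

end Topological

end KTheory

/-- A strongly continuous action of a topological group `G` on a C*-algebra `B` by
`*`-automorphisms; this makes `B` a `G`-C*-algebra. -/
structure CStarAction (G B : Type*) [Group G] [TopologicalSpace G] [NonUnitalCStarAlgebra B] where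
  toHom : G →* (B ≃⋆ₐ[ℂ] B)
  continuous_apply : ∀ b : B, Continuous fun g => toHom g b

namespace CStarAction

open MeasureTheory
open scoped Pointwise ENNReal CompactlySupported

section Algebra

variable {G B : Type*} [Group G] [TopologicalSpace G] [NonUnitalCStarAlgebra B]
  (α : CStarAction G B)

instance : CoeFun (CStarAction G B) (fun _ => G → (B ≃⋆ₐ[ℂ] B)) := ⟨fun α => α.toHom⟩

theorem norm_apply (g : G) (b : B) : ‖α g b‖ = ‖b‖ := StarAlgEquiv.norm_map (α g) b

theorem mul_apply (g h : G) (b : B) : α (g * h) b = α g (α h b) := by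
  rw [map_mul]; rfl

theorem one_apply (b : B) : α 1 b = b := by
  rw [map_one]; rfl

theorem inv_apply_apply (g : G) (b : B) : α g⁻¹ (α g b) = b := by
  rw [← mul_apply, inv_mul_cancel, one_apply]

theorem continuous_uncurry : Continuous fun p : G × B => α p.1 p.2 := by
  rw [continuous_iff_continuousAt]
  rintro ⟨g, b⟩
  rw [ContinuousAt, tendsto_iff_norm_sub_tendsto_zero]
  have h1 : Filter.Tendsto (fun p : G × B => ‖p.2 - b‖ + ‖α p.1 b - α g b‖) (nhds (g, b))
      (nhds 0) := by
    have : Continuous fun p : G × B => ‖p.2 - b‖ + ‖α p.1 b - α g b‖ :=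
      (continuous_snd.sub continuous_const).norm.add
        ((((α.continuous_apply b).comp continuous_fst).sub continuous_const).norm)
    simpa using this.tendsto (g, b)
  refine squeeze_zero (fun _ => norm_nonneg _) (fun p => ?_) h1
  calc ‖α p.1 p.2 - α g b‖ = ‖α p.1 (p.2 - b) + (α p.1 b - α g b)‖ := by
        rw [map_sub]; congr 1; abel
    _ ≤ _ := (norm_add_le _ _).trans (by rw [norm_apply])

/-- The action of a group element as a continuous linear map. -/
def clm (g : G) : B →L[ℂ] B :=
  LinearMap.mkContinuous
    { toFun := α g, map_add' := map_add (α g), map_smul' := fun c b => map_smul (α g) c b } 1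
    (fun b => by simp [norm_apply])

theorem clm_apply (g : G) (b : B) : α.clm g b = α g b := rfl

end Algebra

section Module

variable {G B : Type*} [Group G] [TopologicalSpace G] [IsTopologicalGroup G]
  [MeasurableSpace G] [BorelSpace G] [NonUnitalCStarAlgebra B]

/-- The `B`-valued inner product `⟨v, w⟩ = ∫ g⁻¹(v(g)* w(g)) dμ(g)` on `C_c(G, B)`. -/
noncomputable def inner (α : CStarAction G B) (μ : Measure G) (v w : C_c(G, B)) : B :=
  ∫ g, α g⁻¹ (star (v g) * w g) ∂μ

/-- `C_c(G, B)`, equipped with the seminorm coming from the `B`-valued inner product. -/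
def PreL2 (_α : CStarAction G B) (_μ : Measure G) : Type _ := C_c(G, B)

variable (α : CStarAction G B) (μ : Measure G)

noncomputable instance : AddCommGroup (PreL2 α μ) := inferInstanceAs (AddCommGroup C_c(G, B))
noncomputable instance : Module ℂ (PreL2 α μ) := inferInstanceAs (Module ℂ C_c(G, B))
noncomputable instance : Norm (PreL2 α μ) := ⟨fun v => √‖inner α μ v v‖⟩

theorem norm_def (v : PreL2 α μ) : ‖v‖ = √‖inner α μ v v‖ := rfl

variable [IsFiniteMeasureOnCompacts μ]

theorem integrable_inner (v w : C_c(G, B)) :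
    Integrable (fun g => α g⁻¹ (star (v g) * w g)) μ := by
  apply Continuous.integrable_of_hasCompactSupport
  · exact α.continuous_uncurry.comp (continuous_inv.prodMk
      ((map_continuous v).star.mul (map_continuous w)))
  · refine w.hasCompactSupport.mono fun g hg => ?_
    rw [Function.mem_support] at hg ⊢
    intro h
    exact hg (by rw [h, mul_zero, map_zero])

theorem inner_add_right (u v w : C_c(G, B)) :
    inner α μ u (v + w) = inner α μ u v + inner α μ u w := by
  rw [inner, inner, inner, ← integral_add (integrable_inner α μ u v) (integrable_inner α μ u w)]
  congr 1; ext g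
  simp [mul_add]

theorem star_inner (v w : C_c(G, B)) : star (inner α μ v w) = inner α μ w v := by
  have := ((starL' ℝ : B ≃L[ℝ] B) : B →L[ℝ] B).integral_comp_comm (integrable_inner α μ v w)
  refine this.symm.trans ?_
  rw [inner]
  congr 1; ext g
  simp [map_star]

theorem inner_add_left (u v w : C_c(G, B)) :
    inner α μ (u + v) w = inner α μ u w + inner α μ v w := by
  rw [← star_inner, inner_add_right, star_add, star_inner, star_inner]

theorem inner_smul_right (c : ℂ) (v w : C_c(G, B)) :
    inner α μ v (c • w) = c • inner α μ v w := by
  rw [inner, inner, ← integral_smul]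
  congr 1; ext g
  simp [mul_smul_comm, map_smul]

theorem inner_smul_left (c : ℂ) (v w : C_c(G, B)) :
    inner α μ (c • v) w = star c • inner α μ v w := by
  rw [← star_inner, inner_smul_right, star_smul, star_inner]

attribute [local instance] CStarAlgebra.spectralOrder CStarAlgebra.spectralOrderedRing

/-- Cauchy-Schwarz inequality for the `B`-valued inner product. -/
theorem norm_inner_le (v w : C_c(G, B)) :
    ‖inner α μ v w‖ ^ 2 ≤ ‖inner α μ v v‖ * ‖inner α μ w w‖ := by
  set a := inner α μ v w with ha
  have key : ∀ t : ℝ, 0 < t → ‖inner α μ v v‖ ≤ t → ‖a‖ ^ 2 ≤ t * ‖inner α μ w w‖ := by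
    intro t ht hvt
    have e1 : ∀ g, α g⁻¹ (star (v g * α g a - (t : ℂ) • w g) * (v g * α g a - (t : ℂ) • w g)) =
        star a * α g⁻¹ (star (v g) * v g) * a - (t : ℂ) • (star a * α g⁻¹ (star (v g) * w g))
          - (t : ℂ) • (α g⁻¹ (star (w g) * v g) * a)
          + (t : ℂ) • (t : ℂ) • α g⁻¹ (star (w g) * w g) := by
      intro g
      simp only [map_mul, map_sub, map_star, map_smul, star_sub, star_mul, star_smul,
        inv_apply_apply, sub_mul, mul_sub, smul_mul_assoc, mul_smul_comm, mul_assoc, smul_sub]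
      simp
      abel
    have i1 := (((ContinuousLinearMap.mul ℂ B).flip a).comp
      (ContinuousLinearMap.mul ℂ B (star a))).integrable_comp (integrable_inner α μ v v)
    have i2 := ((t : ℂ) • (ContinuousLinearMap.mul ℂ B (star a))).integrable_comp
      (integrable_inner α μ v w)
    have i3 := ((t : ℂ) • ((ContinuousLinearMap.mul ℂ B).flip a)).integrable_comp
      (integrable_inner α μ w v)
    have i4 : Integrable (fun g => (t : ℂ) • (t : ℂ) • α g⁻¹ (star (w g) * w g)) μ :=
      ((integrable_inner α μ w w).smul (t : ℂ)).smul (t : ℂ)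
    have e2 : ∫ g, α g⁻¹ (star (v g * α g a - (t : ℂ) • w g) *
        (v g * α g a - (t : ℂ) • w g)) ∂μ = star a * inner α μ v v * a - (t : ℂ) • (star a * a)
          - (t : ℂ) • (star a * a) + (t : ℂ) • (t : ℂ) • inner α μ w w := by
      have j1 := (((ContinuousLinearMap.mul ℂ B).flip a).comp
        (ContinuousLinearMap.mul ℂ B (star a))).integral_comp_comm (integrable_inner α μ v v)
      have j2 := ((t : ℂ) • (ContinuousLinearMap.mul ℂ B (star a))).integral_comp_comm
        (integrable_inner α μ v w)
      have j3 := ((t : ℂ) • ((ContinuousLinearMap.mul ℂ B).flip a)).integral_comp_comm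
        (integrable_inner α μ w v)
      have j4 : ∫ g, (t : ℂ) • (t : ℂ) • α g⁻¹ (star (w g) * w g) ∂μ =
        (t : ℂ) • (t : ℂ) • inner α μ w w := by rw [integral_smul, integral_smul]; rfl
      simp only [e1]
      refine (integral_add ((i1.sub i2).sub i3) i4).trans ?_
      rw [j4]
      congr 1
      refine (integral_sub (i1.sub i2) i3).trans ?_
      refine congr_arg₂ _ ((integral_sub i1 i2).trans (congr_arg₂ _ j1 j2)) (j3.trans ?_)
      change (t : ℂ) • (inner α μ w v * a) = _
      rw [← star_inner]
    have e3 : (0 : B) ≤ star a * inner α μ v v * a - (t : ℂ) • (star a * a)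
          - (t : ℂ) • (star a * a) + (t : ℂ) • (t : ℂ) • inner α μ w w := by
      rw [← e2]
      refine integral_nonneg fun g => ?_
      simp only [map_mul, map_star]
      exact star_mul_self_nonneg _
    have e4 : star a * inner α μ v v * a ≤ t • (star a * a) := by
      refine (CStarAlgebra.star_left_conjugate_le_norm_smul (star_inner α μ v v)).trans ?_
      exact smul_le_smul_of_nonneg_right hvt (star_mul_self_nonneg _)
    have e5 : t • (star a * a) ≤ t • t • inner α μ w w := by
      have : (0 : B) ≤ t • (star a * a) - t • (star a * a) - t • (star a * a)
          + t • t • inner α μ w w := by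
        refine e3.trans ?_
        simp only [Complex.coe_smul]
        gcongr
      simpa using this
    have e6 : star a * a ≤ t • inner α μ w w := (smul_le_smul_iff_of_pos_left ht).mp e5
    have := CStarAlgebra.norm_le_norm_of_nonneg_of_le (star_mul_self_nonneg a) e6
    rwa [CStarRing.norm_star_mul_self, ← sq, norm_smul, Real.norm_of_nonneg ht.le] at this
  refine le_of_forall_pos_le_add fun ε hε => ?_
  set W := ‖inner α μ w w‖
  have h1 : 0 < ε / (W + 1) := by positivity
  have := key (‖inner α μ v v‖ + ε / (W + 1)) (by positivity) (by linarith)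
  refine this.trans ?_
  rw [add_mul]
  gcongr
  rw [div_mul_eq_mul_div, div_le_iff₀ (by positivity)]
  nlinarith [norm_nonneg (inner α μ w w)]

theorem norm_inner_le_mul_sqrt (x y : C_c(G, B)) :
    ‖inner α μ x y‖ ≤ √‖inner α μ x x‖ * √‖inner α μ y y‖ := by
  rw [← Real.sqrt_mul (norm_nonneg _)]
  exact Real.le_sqrt_of_sq_le (norm_inner_le α μ x y)

theorem sqrt_inner_smul (c : ℂ) (v : C_c(G, B)) :
    √‖inner α μ (c • v) (c • v)‖ = ‖c‖ * √‖inner α μ v v‖ := by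
  rw [inner_smul_right, inner_smul_left, smul_smul, norm_smul, norm_mul, norm_star,
    Real.sqrt_mul (by positivity), Real.sqrt_mul_self (norm_nonneg c)]

theorem sqrt_inner_add (v w : C_c(G, B)) :
    √‖inner α μ (v + w) (v + w)‖ ≤ √‖inner α μ v v‖ + √‖inner α μ w w‖ := by
  refine Real.sqrt_le_iff.mpr ⟨by positivity, ?_⟩
  rw [inner_add_right, inner_add_left, inner_add_left]
  have h2 := norm_inner_le_mul_sqrt α μ v w
  have h3 := norm_inner_le_mul_sqrt α μ w v
  have h4 := Real.sq_sqrt (norm_nonneg (inner α μ v v))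
  have h5 := Real.sq_sqrt (norm_nonneg (inner α μ w w))
  calc _ ≤ (‖inner α μ v v‖ + ‖inner α μ w v‖) + (‖inner α μ v w‖ + ‖inner α μ w w‖) :=
        (norm_add_le _ _).trans (add_le_add (norm_add_le _ _) (norm_add_le _ _))
    _ ≤ _ := by nlinarith

theorem seminormedSpaceCore : SeminormedSpace.Core ℂ (PreL2 α μ) where
  norm_nonneg _ := Real.sqrt_nonneg _
  norm_smul c v := sqrt_inner_smul α μ c v
  norm_triangle v w := sqrt_inner_add α μ v w

noncomputable instance : SeminormedAddCommGroup (PreL2 α μ) :=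
  SeminormedAddCommGroup.ofCore (𝕜 := ℂ) (seminormedSpaceCore α μ)

noncomputable instance : NormedSpace ℂ (PreL2 α μ) where
  norm_smul_le c v := ((seminormedSpaceCore α μ).norm_smul c v).le

/-- The Hilbert `B`-module `L²(G, B)`: the completion of `C_c(G, B)` for the norm
`‖v‖ = ‖⟨v, v⟩‖^{1/2}`. -/
def L2 : Type _ := UniformSpace.Completion (PreL2 α μ)

noncomputable instance : NormedAddCommGroup (L2 α μ) :=
  inferInstanceAs (NormedAddCommGroup (UniformSpace.Completion (PreL2 α μ)))
noncomputable instance : NormedSpace ℂ (L2 α μ) :=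
  inferInstanceAs (NormedSpace ℂ (UniformSpace.Completion (PreL2 α μ)))
instance : CompleteSpace (L2 α μ) :=
  inferInstanceAs (CompleteSpace (UniformSpace.Completion (PreL2 α μ)))

/-- The canonical map `C_c(G, B) → L²(G, B)`. -/
noncomputable def toL2 : C_c(G, B) →ₗ[ℂ] L2 α μ :=
  (UniformSpace.Completion.toComplL :
    PreL2 α μ →L[ℂ] UniformSpace.Completion (PreL2 α μ)).toLinearMap

theorem norm_toL2 (v : C_c(G, B)) : ‖toL2 α μ v‖ = √‖inner α μ v v‖ :=
  UniformSpace.Completion.norm_coe (E := PreL2 α μ) v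

theorem norm_toL2_sq (v : C_c(G, B)) : ‖toL2 α μ v‖ ^ 2 = ‖inner α μ v v‖ := by
  rw [norm_toL2, Real.sq_sqrt (norm_nonneg _)]

theorem denseRange_toL2 : DenseRange (toL2 α μ) :=
  UniformSpace.Completion.denseRange_coe (α := PreL2 α μ)


/-- A compactly supported continuous family `s ↦ m s` of operators on `B` that are bounded like
left multiplication operators; used to construct integrated operators on `L²(G, B)`. -/
structure Kernel (G B : Type*) [TopologicalSpace G] [NonUnitalCStarAlgebra B] where
  m : G → B →ₗ[ℂ] B
  continuous_m : Continuous fun p : G × B => m p.1 p.2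
  bound : C_c(G, ℝ)
  bound_le : ∀ s b, star (m s b) * m s b ≤ (bound s) ^ 2 • (star b * b)

theorem Kernel.m_eq_zero (k : Kernel G B) {s : G} (hs : s ∉ tsupport k.bound) (b : B) :
    k.m s b = 0 := by
  have h := k.bound_le s b
  rw [image_eq_zero_of_notMem_tsupport hs] at h
  have h2 : star (k.m s b) * k.m s b = 0 :=
    le_antisymm (by simpa using h) (star_mul_self_nonneg _)
  exact (CStarRing.star_mul_self_eq_zero_iff _).mp h2

variable {μ} in
theorem continuous_kernel (k : Kernel G B) (v : C_c(G, B)) :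
    Continuous (fun p : G × G => k.m p.1 (α p.1 (v (p.1⁻¹ * p.2)))) :=
  k.continuous_m.comp (continuous_fst.prodMk (α.continuous_uncurry.comp
    (continuous_fst.prodMk ((map_continuous v).comp
      ((continuous_fst.inv).mul continuous_snd)))))

theorem kernel_eq_zero (k : Kernel G B) (v : C_c(G, B)) (s t : G)
    (h : ¬ (s ∈ tsupport k.bound ∧ t ∈ tsupport k.bound * tsupport v)) :
    k.m s (α s (v (s⁻¹ * t))) = 0 := by
  by_cases hs : s ∈ tsupport k.bound
  · have : s⁻¹ * t ∉ tsupport v := fun hv => h ⟨hs, Set.mem_mul.mpr ⟨s, hs, _, hv, by group⟩⟩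
    rw [image_eq_zero_of_notMem_tsupport this, map_zero, map_zero]
  · exact k.m_eq_zero hs _

/-- The integral `t ↦ ∫ m_s (s (v (s⁻¹ t))) dμ(s)` as an element of `C_c(G, B)`. -/
noncomputable def integrate (k : Kernel G B) (v : C_c(G, B)) : C_c(G, B) where
  toFun t := ∫ s, k.m s (α s (v (s⁻¹ * t))) ∂μ
  continuous_toFun := by
    rw [← continuousOn_univ]
    refine continuousOn_integral_of_compact_support (k := tsupport k.bound)
      k.bound.hasCompactSupport ?_ ?_
    · exact ((continuous_kernel α k v).comp continuous_swap).continuousOn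
    · intro p x _ hx
      exact k.m_eq_zero hx _
  hasCompactSupport' := by
    refine HasCompactSupport.intro (K := tsupport k.bound * tsupport v)
      (k.bound.hasCompactSupport.isCompact.mul v.hasCompactSupport.isCompact) fun t ht => ?_
    simp only [kernel_eq_zero α k v _ t (fun h => ht h.2), integral_zero]

theorem integrable_kernel (k : Kernel G B) (v : C_c(G, B)) (t : G) :
    Integrable (fun s => k.m s (α s (v (s⁻¹ * t)))) μ := by
  apply Continuous.integrable_of_hasCompactSupport
  · exact (continuous_kernel α k v).comp (continuous_id.prodMk continuous_const)
  · exact HasCompactSupport.intro k.bound.hasCompactSupport fun s hs => k.m_eq_zero hs _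

/-- The slice `t ↦ m_s (s (v (s⁻¹ t)))`. -/
noncomputable def slice (k : Kernel G B) (v : C_c(G, B)) (s : G) : C_c(G, B) where
  toFun t := k.m s (α s (v (s⁻¹ * t)))
  continuous_toFun := (continuous_kernel α k v).comp (continuous_const.prodMk continuous_id)
  hasCompactSupport' := by
    refine HasCompactSupport.intro (K := tsupport k.bound * tsupport v)
      (k.bound.hasCompactSupport.isCompact.mul v.hasCompactSupport.isCompact) fun t ht => ?_
    exact kernel_eq_zero α k v _ t (fun h => ht h.2)

theorem norm_slice_le [μ.IsMulLeftInvariant] (k : Kernel G B) (v : C_c(G, B)) (s : G) :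
    √‖inner α μ (slice α k v s) (slice α k v s)‖ ≤ |k.bound s| * √‖inner α μ v v‖ := by
  have e : ∫ t, α (s⁻¹ * t)⁻¹ (star (v (s⁻¹ * t)) * v (s⁻¹ * t)) ∂μ = inner α μ v v :=
    integral_mul_left_eq_self (fun t => α t⁻¹ (star (v t) * v t)) s⁻¹
  have hi : Integrable (fun t => α (s⁻¹ * t)⁻¹ (star (v (s⁻¹ * t)) * v (s⁻¹ * t))) μ :=
    (integrable_inner α μ v v).comp_mul_left s⁻¹
  have h0 : (0 : B) ≤ inner α μ (slice α k v s) (slice α k v s) := by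
    refine integral_nonneg fun t => ?_
    simp only [map_mul, map_star]
    exact star_mul_self_nonneg _
  have h : inner α μ (slice α k v s) (slice α k v s) ≤ (k.bound s) ^ 2 • inner α μ v v := by
    rw [← e, ← integral_smul]
    refine integral_mono (integrable_inner α μ _ _) (hi.smul ((k.bound s) ^ 2)) fun t => ?_
    have h1 := k.bound_le s (α s (v (s⁻¹ * t)))
    have h2 : α t⁻¹ (star (k.m s (α s (v (s⁻¹ * t)))) * k.m s (α s (v (s⁻¹ * t)))) ≤
      α t⁻¹ ((k.bound s) ^ 2 • (star (α s (v (s⁻¹ * t))) * α s (v (s⁻¹ * t)))) :=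
      OrderHomClass.mono (α t⁻¹) h1
    refine h2.trans (le_of_eq ?_)
    have h3 : ∀ (r : ℝ) (b : B), α t⁻¹ (r • b) = r • α t⁻¹ b := fun r b => by
      rw [← Complex.coe_smul, map_smul, Complex.coe_smul]
    rw [h3, mul_inv_rev, inv_inv]
    change _ = (k.bound s) ^ 2 • _
    rw [mul_apply, map_mul (α s), map_star (α s)]
  have h2 := CStarAlgebra.norm_le_norm_of_nonneg_of_le h0 h
  rw [norm_smul, norm_pow, Real.norm_eq_abs] at h2
  calc _ ≤ √(|k.bound s| ^ 2 * ‖inner α μ v v‖) := Real.sqrt_le_sqrt h2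
    _ = _ := by rw [Real.sqrt_mul (by positivity), Real.sqrt_sq (abs_nonneg _)]

theorem norm_integrate_le [μ.IsMulLeftInvariant] (k : Kernel G B) (v : C_c(G, B)) :
    ‖toL2 α μ (integrate α μ k v)‖ ≤ (∫ s, |k.bound s| ∂μ) * ‖toL2 α μ v‖ := by
  set W := integrate α μ k v with hW
  have h1 : inner α μ W W = ∫ s, inner α μ W (slice α k v s) ∂μ := by
    have : inner α μ W W = ∫ t, ∫ s, α t⁻¹ (star (W t) * k.m s (α s (v (s⁻¹ * t)))) ∂μ ∂μ := by
      rw [inner]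
      congr 1
      ext t
      exact (((α.clm t⁻¹).comp (ContinuousLinearMap.mul ℂ B (star (W t)))).integral_comp_comm
        (integrable_kernel α μ k v t)).symm
    rw [this]
    refine (integral_integral_swap_of_hasCompactSupport ?_ ?_)
    · exact α.continuous_uncurry.comp (continuous_fst.inv.prodMk
        (((map_continuous W).comp continuous_fst).star.mul
          ((continuous_kernel α k v).comp continuous_swap)))
    · refine HasCompactSupport.intro (K := tsupport W ×ˢ tsupport k.bound)
        (W.hasCompactSupport.isCompact.prod k.bound.hasCompactSupport.isCompact) ?_
      rintro ⟨t, s⟩ h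
      by_cases ht : t ∈ tsupport W
      · have hs : s ∉ tsupport k.bound := fun hs => h ⟨ht, hs⟩
        simp [Function.uncurry, k.m_eq_zero hs]
      · simp [Function.uncurry, image_eq_zero_of_notMem_tsupport ht]
  have h2 : ‖inner α μ W W‖ ≤ ∫ s, ‖toL2 α μ W‖ * (|k.bound s| * ‖toL2 α μ v‖) ∂μ := by
    rw [h1]
    refine norm_integral_le_of_norm_le ?_ (Filter.Eventually.of_forall fun s => ?_)
    · refine ((Continuous.integrable_of_hasCompactSupport (map_continuous k.bound).abs
        ?_).mul_const _).const_mul _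
      exact k.bound.hasCompactSupport.comp_left abs_zero
    · rw [norm_toL2, norm_toL2]
      refine (norm_inner_le_mul_sqrt α μ _ _).trans ?_
      gcongr
      exact norm_slice_le α μ k v s
  rw [integral_const_mul, integral_mul_const, ← norm_toL2_sq, sq] at h2
  by_cases h3 : ‖toL2 α μ W‖ = 0
  · rw [h3]
    exact mul_nonneg (integral_nonneg fun _ => abs_nonneg _) (norm_nonneg _)
  · exact le_of_mul_le_mul_left h2 (lt_of_le_of_ne (norm_nonneg _) (Ne.symm h3))

/-- `integrate` as a linear map. -/
noncomputable def integrateₗ (k : Kernel G B) : C_c(G, B) →ₗ[ℂ] C_c(G, B) where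
  toFun := integrate α μ k
  map_add' v w := by
    ext t
    refine Eq.trans ?_ (integral_add (integrable_kernel α μ k v t) (integrable_kernel α μ k w t))
    change ∫ s, _ ∂μ = _
    simp
  map_smul' c v := by
    ext t
    refine Eq.trans ?_ (integral_smul c _)
    change ∫ s, _ ∂μ = _
    simp

/-- The bounded operator on `L²(G, B)` extending `integrate`. -/
noncomputable def integratedOp (k : Kernel G B) : L2 α μ →L[ℂ] L2 α μ :=
  ((toL2 α μ).comp (integrateₗ α μ k)).extendOfNorm (toL2 α μ)

theorem integratedOp_toL2 [μ.IsMulLeftInvariant] (k : Kernel G B) (v : C_c(G, B)) :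
    integratedOp α μ k (toL2 α μ v) = toL2 α μ (integrate α μ k v) :=
  LinearMap.extendOfNorm_eq (denseRange_toL2 α μ) ⟨_, norm_integrate_le α μ k⟩ v

/-- The kernel of left multiplication by `a ∈ C_c(G, B)`. -/
noncomputable def convKernel (a : C_c(G, B)) : Kernel G B where
  m s := LinearMap.mulLeft ℂ (a s)
  continuous_m := ((map_continuous a).comp continuous_fst).mul continuous_snd
  bound := ⟨⟨fun s => ‖a s‖, (map_continuous a).norm⟩, a.hasCompactSupport.norm⟩
  bound_le s b := by
    change star (a s * b) * (a s * b) ≤ ‖a s‖ ^ 2 • (star b * b)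
    have := CStarAlgebra.star_left_conjugate_le_norm_smul (a := b)
      (IsSelfAdjoint.star_mul_self (a s))
    rw [CStarRing.norm_star_mul_self, ← sq] at this
    simpa [mul_assoc] using this

/-- Twisted convolution `(a * v)(t) = ∫ a(s) s(v(s⁻¹ t)) dμ(s)` on `C_c(G, B)`. -/
noncomputable def conv (a v : C_c(G, B)) : C_c(G, B) := integrate α μ (convKernel a) v

theorem conv_apply (a v : C_c(G, B)) (t : G) :
    conv α μ a v t = ∫ s, a s * α s (v (s⁻¹ * t)) ∂μ := rfl

/-- The bounded operator `λ(a)` on `L²(G, B)` of left convolution by `a ∈ C_c(G, B)`. -/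
noncomputable def lam (a : C_c(G, B)) : L2 α μ →L[ℂ] L2 α μ := integratedOp α μ (convKernel a)

theorem lam_toL2 [μ.IsMulLeftInvariant] (a v : C_c(G, B)) :
    lam α μ a (toL2 α μ v) = toL2 α μ (conv α μ a v) := integratedOp_toL2 α μ _ v

/-- The kernel `μ(K)⁻¹ 1_K(s)` of averaging over a compact open subgroup `K`. -/
noncomputable def avgKernel (K : OpenSubgroup G) (hK : IsCompact (K : Set G)) : Kernel G B where
  m s := (((K : Set G).indicator (fun _ => (μ K).toReal⁻¹) s : ℝ) : ℂ) • LinearMap.id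
  continuous_m := by
    have h : Continuous ((K : Set G).indicator (fun _ => (μ K).toReal⁻¹)) :=
      IsClopen.continuous_indicator ⟨K.isClosed, K.isOpen⟩ continuous_const
    exact (Complex.continuous_ofReal.comp (h.comp continuous_fst)).smul continuous_snd
  bound := ⟨⟨(K : Set G).indicator (fun _ => (μ K).toReal⁻¹),
      IsClopen.continuous_indicator ⟨K.isClosed, K.isOpen⟩ continuous_const⟩,
    HasCompactSupport.intro hK fun s hs =>
      (Set.indicator_of_notMem hs _ : (K : Set G).indicator (fun _ => (μ K).toReal⁻¹) s = 0)⟩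
  bound_le s b := by
    change star ((((K : Set G).indicator (fun _ => (μ K).toReal⁻¹) s : ℝ) : ℂ) • b) *
      ((((K : Set G).indicator (fun _ => (μ K).toReal⁻¹) s : ℝ) : ℂ) • b) ≤
      ((K : Set G).indicator (fun _ => (μ K).toReal⁻¹) s) ^ 2 • (star b * b)
    generalize (K : Set G).indicator (fun _ => (μ K).toReal⁻¹) s = r
    rw [Complex.coe_smul, star_smul, star_trivial, smul_mul_smul_comm, ← sq]

/-- Averaging over `K`: `(e_K * v)(t) = μ(K)⁻¹ ∫_K k(v(k⁻¹ t)) dμ(k)` on `C_c(G, B)`. -/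
noncomputable def avg (K : OpenSubgroup G) (hK : IsCompact (K : Set G)) (v : C_c(G, B)) :
    C_c(G, B) := integrate α μ (avgKernel (B := B) μ K hK) v

theorem avg_apply (K : OpenSubgroup G) (hK : IsCompact (K : Set G)) (v : C_c(G, B)) (t : G) :
    avg α μ K hK v t = (μ K).toReal⁻¹ • ∫ k in (K : Set G), α k (v (k⁻¹ * t)) ∂μ := by
  rw [← integral_smul, ← integral_indicator K.isOpen.measurableSet]
  change ∫ s, _ ∂μ = _
  congr 1
  ext s
  change (((K : Set G).indicator (fun _ => (μ K).toReal⁻¹) s : ℝ) : ℂ) • α s (v (s⁻¹ * t)) = _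
  rw [Complex.coe_smul]
  by_cases hs : s ∈ (K : Set G) <;> simp [hs]

/-- The bounded operator `e_K` on `L²(G, B)`. -/
noncomputable def eK (K : OpenSubgroup G) (hK : IsCompact (K : Set G)) : L2 α μ →L[ℂ] L2 α μ :=
  integratedOp α μ (avgKernel (B := B) μ K hK)

theorem eK_toL2 [μ.IsMulLeftInvariant] (K : OpenSubgroup G) (hK : IsCompact (K : Set G))
    (v : C_c(G, B)) : eK α μ K hK (toL2 α μ v) = toL2 α μ (avg α μ K hK v) :=
  integratedOp_toL2 α μ _ v

/-- The reduced crossed product `C_r^*(G, B)`: the closure of `λ(C_c(G, B))` in the algebra of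
bounded operators on `L²(G, B)`. (The range of `λ` is already an algebra, so `adjoin` adds no
elements.) -/
noncomputable def reducedCrossedProduct : NonUnitalSubalgebra ℂ (L2 α μ →L[ℂ] L2 α μ) :=
  (NonUnitalAlgebra.adjoin ℂ (Set.range (lam α μ))).topologicalClosure

/-- `x ∈ L²(G, B)` is the class of the square integrable function `f : G → B`: both are limits of
the same elements of `C_c(G, B)`, for the norm `(∫ ‖f(g)‖² dμ(g))^{1/2}` (which dominates the norm
of `L²(G, B)`) and for the norm of `L²(G, B)` respectively. -/
def IsClass (f : G → B) (x : L2 α μ) : Prop :=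
  MemLp f 2 μ ∧ ∀ ε : ℝ, 0 < ε → ∃ w : C_c(G, B),
    eLpNorm (fun g => f g - w g) 2 μ < ENNReal.ofReal ε ∧ ‖x - toL2 α μ w‖ < ε

theorem IsClass.zero : IsClass α μ (0 : G → B) 0 :=
  ⟨MemLp.zero, fun ε hε => ⟨0, by simp [hε]⟩⟩

variable {α μ}

theorem memLp_cc (w : C_c(G, B)) : MemLp w 2 μ :=
  (map_continuous w).memLp_of_hasCompactSupport w.hasCompactSupport

theorem IsClass.add {f f' : G → B} {x x' : L2 α μ} (h : IsClass α μ f x) (h' : IsClass α μ f' x') :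
    IsClass α μ (f + f') (x + x') := by
  refine ⟨h.1.add h'.1, fun ε hε => ?_⟩
  obtain ⟨w, h1, h2⟩ := h.2 (ε / 2) (by positivity)
  obtain ⟨w', h1', h2'⟩ := h'.2 (ε / 2) (by positivity)
  refine ⟨w + w', ?_, ?_⟩
  · have e : (fun g => (f + f') g - (w + w') g) =
        (fun g => f g - w g) + (fun g => f' g - w' g) := by
      ext g
      simp only [Pi.add_apply, CompactlySupportedContinuousMap.add_apply]
      abel
    rw [e]
    refine (eLpNorm_add_le (h.1.sub (memLp_cc w)).1 (h'.1.sub (memLp_cc w')).1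
      one_le_two).trans_lt ?_
    refine (ENNReal.add_lt_add h1 h1').trans_eq ?_
    rw [← ENNReal.ofReal_add (by positivity) (by positivity), add_halves]
  · rw [map_add, add_sub_add_comm]
    refine (norm_add_le _ _).trans_lt ?_
    linarith

theorem IsClass.smul {f : G → B} {x : L2 α μ} (c : ℂ) (h : IsClass α μ f x) :
    IsClass α μ (c • f) (c • x) := by
  refine ⟨h.1.const_smul c, fun ε hε => ?_⟩
  obtain ⟨w, h1, h2⟩ := h.2 (ε / (‖c‖ + 1)) (by positivity)
  have h3 : ‖c‖ * (ε / (‖c‖ + 1)) < ε := by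
    rw [← mul_div_assoc, div_lt_iff₀ (by positivity)]
    nlinarith
  refine ⟨c • w, ?_, ?_⟩
  · have e : (fun g => (c • f) g - (c • w) g) = c • (fun g => f g - w g) := by
      ext g
      simp [smul_sub]
    rw [e, eLpNorm_const_smul]
    refine lt_of_le_of_lt ?_ ((ENNReal.ofReal_lt_ofReal_iff hε).mpr h3)
    rw [ENNReal.ofReal_mul (norm_nonneg c), ofReal_norm]
    gcongr
  · rw [map_smul, ← smul_sub, norm_smul]
    refine lt_of_le_of_lt ?_ h3
    gcongr

variable (α μ)

/-- The graph `{(v, σ v)}` of the closed, densely defined operator on `L²(G, B)` of pointwise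
multiplication by `σ = 1 + ℓ`: the closure of the set of pairs `(f, σ f)`, where `f : G → B` is
such that `f` and `σ f` are both square integrable. -/
noncomputable def sigmaGraph (ℓ : GroupSeminorm G) : Submodule ℂ (L2 α μ × L2 α μ) :=
  Submodule.topologicalClosure
    { carrier := {p | ∃ f : G → B, IsClass α μ f p.1 ∧
        IsClass α μ (fun g => (1 + ℓ g) • f g) p.2}
      add_mem' := by
        rintro p q ⟨f, h1, h2⟩ ⟨f', h1', h2'⟩
        refine ⟨f + f', h1.add h1', ?_⟩
        change IsClass α μ _ (p.2 + q.2)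
        convert h2.add h2' using 1
        ext g
        simp
      zero_mem' := ⟨0, IsClass.zero α μ, by simpa using! IsClass.zero α μ⟩
      smul_mem' := by
        rintro c p ⟨f, h1, h2⟩
        refine ⟨c • f, h1.smul c, ?_⟩
        change IsClass α μ _ (c • p.2)
        convert h2.smul c using 1
        ext g
        simp [smul_comm c] }

/-- `T = D(A) = [σ, A]` as bounded operators: for all `v` in the domain of `σ`, also `A v` is in
the domain of `σ`, and `σ A v - A σ v = T v`. -/
def IsCommutator (ℓ : GroupSeminorm G) (A T : L2 α μ →L[ℂ] L2 α μ) : Prop :=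
  ∀ v w : L2 α μ, (v, w) ∈ sigmaGraph α μ ℓ → (A v, A w + T v) ∈ sigmaGraph α μ ℓ

/-- The operators `D(A), …, D^n(A)` are (defined and) bounded. -/
def BoundedD (ℓ : GroupSeminorm G) : ℕ → (L2 α μ →L[ℂ] L2 α μ) → Prop
  | 0, _ => True
  | n + 1, A => ∃ T, IsCommutator α μ ℓ A T ∧ BoundedD ℓ n T

open Classical in
/-- The bounded operator `D(A) = [σ, A]` (it is unique, because `σ` is densely defined), or `0`
if `D(A)` is not bounded. -/
noncomputable def D (ℓ : GroupSeminorm G) (A : L2 α μ →L[ℂ] L2 α μ) : L2 α μ →L[ℂ] L2 α μ :=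
  if h : ∃ T, IsCommutator α μ ℓ A T then h.choose else 0

variable {α μ} {ℓ : GroupSeminorm G}

theorem IsCommutator.add {A T A' T' : L2 α μ →L[ℂ] L2 α μ} (h : IsCommutator α μ ℓ A T)
    (h' : IsCommutator α μ ℓ A' T') : IsCommutator α μ ℓ (A + A') (T + T') := by
  intro v w hv
  convert add_mem (h v w hv) (h' v w hv) using 1
  simp only [Prod.mk_add_mk, add_apply]
  rw [add_add_add_comm]

theorem IsCommutator.smul {A T : L2 α μ →L[ℂ] L2 α μ} (c : ℂ) (h : IsCommutator α μ ℓ A T) :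
    IsCommutator α μ ℓ (c • A) (c • T) := by
  intro v w hv
  convert Submodule.smul_mem _ c (h v w hv) using 1
  simp

theorem IsCommutator.mul {A T A' T' : L2 α μ →L[ℂ] L2 α μ} (h : IsCommutator α μ ℓ A T)
    (h' : IsCommutator α μ ℓ A' T') : IsCommutator α μ ℓ (A * A') (A * T' + T * A') := by
  intro v w hv
  convert h _ _ (h' v w hv) using 1
  simp [add_assoc]

theorem BoundedD.of_succ {n : ℕ} {A : L2 α μ →L[ℂ] L2 α μ} (h : BoundedD α μ ℓ (n + 1) A) :
    BoundedD α μ ℓ n A := by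
  induction n generalizing A with
  | zero => trivial
  | succ n ih =>
    obtain ⟨T, h1, h2⟩ := h
    exact ⟨T, h1, ih h2⟩

theorem BoundedD.add {n : ℕ} {A A' : L2 α μ →L[ℂ] L2 α μ} (h : BoundedD α μ ℓ n A)
    (h' : BoundedD α μ ℓ n A') : BoundedD α μ ℓ n (A + A') := by
  induction n generalizing A A' with
  | zero => trivial
  | succ n ih =>
    obtain ⟨T, h1, h2⟩ := h
    obtain ⟨T', h1', h2'⟩ := h'
    exact ⟨T + T', h1.add h1', ih h2 h2'⟩

theorem BoundedD.smul {n : ℕ} {A : L2 α μ →L[ℂ] L2 α μ} (c : ℂ) (h : BoundedD α μ ℓ n A) :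
    BoundedD α μ ℓ n (c • A) := by
  induction n generalizing A with
  | zero => trivial
  | succ n ih =>
    obtain ⟨T, h1, h2⟩ := h
    exact ⟨c • T, h1.smul c, ih h2⟩

theorem BoundedD.mul {n : ℕ} {A A' : L2 α μ →L[ℂ] L2 α μ} (h : BoundedD α μ ℓ n A)
    (h' : BoundedD α μ ℓ n A') : BoundedD α μ ℓ n (A * A') := by
  induction n generalizing A A' with
  | zero => trivial
  | succ n ih =>
    have k := h.of_succ
    have k' := h'.of_succ
    obtain ⟨T, h1, h2⟩ := h
    obtain ⟨T', h1', h2'⟩ := h'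
    exact ⟨_, h1.mul h1', (ih k h2').add (ih h2 k')⟩

theorem BoundedD.zero (n : ℕ) : BoundedD α μ ℓ n 0 := by
  induction n with
  | zero => trivial
  | succ n ih =>
    refine ⟨0, fun v w _ => ?_, ih⟩
    convert (sigmaGraph α μ ℓ).zero_mem using 1
    simp

variable (α μ ℓ)

/-- The algebra `V_ℓ^∞(G, B)`: all `a ∈ C_r^*(G, B)` such that `D^n(λ(a))` is bounded for all
`n ≥ 0`. -/
noncomputable def vInf : NonUnitalSubalgebra ℂ (L2 α μ →L[ℂ] L2 α μ) where
  carrier := {A | A ∈ reducedCrossedProduct α μ ∧ ∀ n, BoundedD α μ ℓ n A}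
  add_mem' h h' := ⟨add_mem h.1 h'.1, fun n => (h.2 n).add (h'.2 n)⟩
  zero_mem' := ⟨zero_mem _, BoundedD.zero⟩
  mul_mem' h h' := ⟨mul_mem h.1 h'.1, fun n => (h.2 n).mul (h'.2 n)⟩
  smul_mem' c _ h := ⟨SMulMemClass.smul_mem c h.1, fun n => (h.2 n).smul c⟩

theorem vInf_le : vInf α μ ℓ ≤ reducedCrossedProduct α μ := fun _ h => h.1

variable {α μ} in
/-- `e S e`, for a projection `e` and an algebra `S` of operators: the elements `A` of `S` with
`e A = A = A e`. -/
def corner (e : L2 α μ →L[ℂ] L2 α μ) (S : NonUnitalSubalgebra ℂ (L2 α μ →L[ℂ] L2 α μ)) :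
    NonUnitalSubalgebra ℂ (L2 α μ →L[ℂ] L2 α μ) where
  carrier := {A | A ∈ S ∧ e * A = A ∧ A * e = A}
  add_mem' h h' := ⟨add_mem h.1 h'.1, by rw [mul_add, h.2.1, h'.2.1],
    by rw [add_mul, h.2.2, h'.2.2]⟩
  zero_mem' := ⟨zero_mem _, mul_zero _, zero_mul _⟩
  mul_mem' h h' := ⟨mul_mem h.1 h'.1, by rw [← mul_assoc, h.2.1], by rw [mul_assoc, h'.2.2]⟩
  smul_mem' c _ h := ⟨SMulMemClass.smul_mem c h.1, by rw [mul_smul_comm, h.2.1],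
    by rw [smul_mul_assoc, h.2.2]⟩

variable {α μ} in
theorem corner_mono (e : L2 α μ →L[ℂ] L2 α μ)
    {S S' : NonUnitalSubalgebra ℂ (L2 α μ →L[ℂ] L2 α μ)} (h : S ≤ S') :
    corner e S ≤ corner e S' := fun _ hA => ⟨h hA.1, hA.2⟩

variable {α μ} in
/-- An algebra `S` of operators on which all `D^n` are bounded, to be equipped with the topology
given by the seminorms `A ↦ ‖D^n(A)‖`, `n ≥ 0`, instead of the norm topology. -/
def Smooth (_ℓ : GroupSeminorm G) (S : NonUnitalSubalgebra ℂ (L2 α μ →L[ℂ] L2 α μ)) : Type _ := S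

section Smooth

variable {α μ}
variable (S : NonUnitalSubalgebra ℂ (L2 α μ →L[ℂ] L2 α μ))

noncomputable instance : NonUnitalRing (Smooth ℓ S) := inferInstanceAs (NonUnitalRing S)
noncomputable instance : Module ℂ (Smooth ℓ S) := inferInstanceAs (Module ℂ S)
instance : IsScalarTower ℂ (Smooth ℓ S) (Smooth ℓ S) := inferInstanceAs (IsScalarTower ℂ S S)
instance : SMulCommClass ℂ (Smooth ℓ S) (Smooth ℓ S) := inferInstanceAs (SMulCommClass ℂ S S)

/-- The topology given by the seminorms `A ↦ ‖D^n(A)‖`, i.e. the coarsest one that makes all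
maps `A ↦ D^n(A)` continuous for the operator norm. -/
noncomputable instance : TopologicalSpace (Smooth ℓ S) :=
  TopologicalSpace.induced (fun (A : S) (n : ℕ) => (D α μ ℓ)^[n] (A : L2 α μ →L[ℂ] L2 α μ))
    Pi.topologicalSpace

end Smooth

/-- An algebra `S` of bounded operators on `L²(G, B)`, with the operator norm topology. -/
def OpAlg {α : CStarAction G B} {μ : Measure G} [IsFiniteMeasureOnCompacts μ]
    (S : NonUnitalSubalgebra ℂ (L2 α μ →L[ℂ] L2 α μ)) : Type _ := S

section OpAlg

variable {α μ}
variable (S : NonUnitalSubalgebra ℂ (L2 α μ →L[ℂ] L2 α μ))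

noncomputable instance : NonUnitalRing (OpAlg S) := inferInstanceAs (NonUnitalRing S)
noncomputable instance : Module ℂ (OpAlg S) := inferInstanceAs (Module ℂ S)
instance : IsScalarTower ℂ (OpAlg S) (OpAlg S) := inferInstanceAs (IsScalarTower ℂ S S)
instance : SMulCommClass ℂ (OpAlg S) (OpAlg S) := inferInstanceAs (SMulCommClass ℂ S S)
instance : TopologicalSpace (OpAlg S) := inferInstanceAs (TopologicalSpace S)

/-- The inclusion of `S`, with the topology of the seminorms `‖D^n(A)‖`, in a larger algebra `S'`
with the norm topology. -/
noncomputable def Smooth.incl {S S' : NonUnitalSubalgebra ℂ (L2 α μ →L[ℂ] L2 α μ)} (h : S ≤ S') :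
    Smooth ℓ S →ₙₐ[ℂ] OpAlg S' where
  toFun := fun A : S => (⟨A.1, h A.2⟩ : S')
  map_smul' _ _ := rfl
  map_zero' := rfl
  map_add' _ _ := rfl
  map_mul' _ _ := rfl

theorem Smooth.continuous_incl {S S' : NonUnitalSubalgebra ℂ (L2 α μ →L[ℂ] L2 α μ)}
    (h : S ≤ S') : Continuous (Smooth.incl ℓ h) := by
  have h0 : Continuous (fun (A : Smooth ℓ S) (n : ℕ) => (D α μ ℓ)^[n] (A : S).1) :=
    continuous_induced_dom
  exact ((_root_.continuous_apply (0 : ℕ)).comp h0).subtype_mk _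

variable (α μ)

/-- The inclusion `V_ℓ^∞(G, B) → C_r^*(G, B)`. -/
noncomputable def vInfIncl :
    Smooth ℓ (vInf α μ ℓ) →ₙₐ[ℂ] OpAlg (reducedCrossedProduct α μ) :=
  Smooth.incl ℓ (vInf_le α μ ℓ)

theorem continuous_vInfIncl : Continuous (vInfIncl α μ ℓ) := Smooth.continuous_incl ℓ _

/-- The inclusion `e_K V_ℓ^∞(G, B) e_K → e_K C_r^*(G, B) e_K`. -/
noncomputable def cornerIncl (K : OpenSubgroup G) (hK : IsCompact (K : Set G)) :
    Smooth ℓ (corner (eK α μ K hK) (vInf α μ ℓ)) →ₙₐ[ℂ]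
      OpAlg (corner (eK α μ K hK) (reducedCrossedProduct α μ)) :=
  Smooth.incl ℓ (corner_mono _ (vInf_le α μ ℓ))

theorem continuous_cornerIncl (K : OpenSubgroup G) (hK : IsCompact (K : Set G)) :
    Continuous (cornerIncl α μ ℓ K hK) := Smooth.continuous_incl ℓ _

end OpAlg

end Module
end CStarAction

/-! A smooth subalgebra has the same K-theory as the ambient algebra if it is dense and if Neumann
series and Newton iterations that converge in norm already converge in the subalgebra. By the
Leibniz rule for D, the norm Σ_k binom(n,k) t^k ‖D^k(A)‖ (`smoothNorm`) is submultiplicative, and it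
tends to ‖A‖ as t → 0. So if ‖A‖ < 1, then for each n some t makes this norm less than 1 as well,
and the Neumann series of A converges together with all its derivatives. Its sum is smooth because D
is a closed derivation. Almost idempotent elements are treated in the same way. These properties of
the norms are axiomatized in `IsSmoothAlg`; they pass to matrices over the unitization.

Consequently a matrix over the smooth algebra at norm distance less than 1 from 1 is invertible and
joined to 1 inside the smooth algebra (`IsSmoothAlg.exists_homotopic`), although only the operator
norm is controlled. On K₀, idempotents are approximated and corrected by Newton iteration
(`exists_mvn`), and Murray-von Neumann equivalences are approximated and corrected by a unit
(`mvn_of_map`). On K₁, surjectivity follows by approximating a unit. Injectivity follows because the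
component of 1 lies in the closure of the images of units that are trivial in K₁ of the smooth
algebra (`component_subset`).

The analytic input is as follows. The operator σ is unbounded, but its inverse S is multiplication
by the bounded Borel function (1 + ℓ)⁻¹, and [σ, A] = T is equivalent to A S = S (A + T S)
(`isCommutator_iff`). Hence T is unique and D is closed.

Density means that every λ(a) is smooth (`isSmooth_lam`). Formally D inserts the weight ℓ(t) -
ℓ(s⁻¹t) into the convolution integral, and this weight is bounded by ℓ(s), hence bounded on the
support of a, since a Borel length function is bounded on compact sets. As ℓ need not be continuous,
it is replaced by a continuous ψ at bounded distance (`exists_continuous_near`); the bounded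
difference contributes only commutators with a multiplication operator that commutes with σ.

In the second statement, e_K commutes with σ and multiplies C_r^*(G, B) into itself from both sides,
so compression by e_K carries the density over to the corners. -/

set_option linter.unusedSectionVars false
set_option linter.overlappingInstances false

/-! ### Submultiplicative seminorms, Neumann series and Newton iteration -/

namespace KTheory

open Filter Topology

/-- A submultiplicative seminorm on a ring, without a condition on the unit. -/
structure IsRingSeminorm {R : Type*} [NonUnitalRing R] (p : R → ℝ) : Prop where
  nonneg : ∀ x, 0 ≤ p x
  zero : p 0 = 0
  neg : ∀ x, p (-x) = p x
  add_le : ∀ x y, p (x + y) ≤ p x + p y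
  mul_le : ∀ x y, p (x * y) ≤ p x * p y

namespace IsRingSeminorm

variable {R : Type*}

theorem sub_le [NonUnitalRing R] {p : R → ℝ} (h : IsRingSeminorm p) (x y : R) :
    p (x - y) ≤ p x + p y := by
  rw [sub_eq_add_neg, ← h.neg y]
  exact h.add_le _ _

theorem sub_rev [NonUnitalRing R] {p : R → ℝ} (h : IsRingSeminorm p) (x y : R) :
    p (x - y) = p (y - x) := by
  rw [← h.neg, neg_sub]

theorem sub_le_sub [NonUnitalRing R] {p : R → ℝ} (h : IsRingSeminorm p) (x y : R) :
    p x - p y ≤ p (x - y) := by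
  have := h.add_le (x - y) y
  rw [sub_add_cancel] at this
  linarith

theorem sum_le [NonUnitalRing R] {p : R → ℝ} (h : IsRingSeminorm p) {ι : Type*} (s : Finset ι)
    (f : ι → R) : p (∑ i ∈ s, f i) ≤ ∑ i ∈ s, p (f i) := by
  classical
  induction s using Finset.induction_on with
  | empty => simp [h.zero]
  | insert a s ha ih =>
    rw [Finset.sum_insert ha, Finset.sum_insert ha]
    exact (h.add_le _ _).trans (by gcongr)

/-- Only positive exponents are admitted, because p(1) may exceed 1, as it does for the entry sum
norm of matrices. -/
theorem pow_succ_le [Ring R] {p : R → ℝ} (h : IsRingSeminorm p) (x : R) (k : ℕ) :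
    p (x ^ (k + 1)) ≤ p x ^ (k + 1) := by
  induction k with
  | zero => simp
  | succ k ih =>
    rw [pow_succ, pow_succ (p x)]
    exact (h.mul_le _ _).trans (mul_le_mul_of_nonneg_right ih (h.nonneg x))

/-- A bound for the inverse of `1 - x` that does not involve the seminorm of the inverse. -/
theorem le_of_inverse [Ring R] {p : R → ℝ} (h : IsRingSeminorm p) {x s : R} {r : ℝ}
    (hx : p x ≤ r) (hr : r < 1) (hs : (1 - x) * s = 1) : p s ≤ p 1 / (1 - r) := by
  have h1 : s = 1 + x * s := by rw [← hs]; noncomm_ring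
  have h2 : p s ≤ p 1 + r * p s := by
    calc p s = p (1 + x * s) := by rw [← h1]
      _ ≤ p 1 + p (x * s) := h.add_le _ _
      _ ≤ p 1 + r * p s := by
        gcongr
        exact (h.mul_le _ _).trans (mul_le_mul_of_nonneg_right hx (h.nonneg _))
  rw [le_div_iff₀ (by linarith)]
  linarith

end IsRingSeminorm

/-- A ring `T` with a norm `N` which is complete for a finer family of submultiplicative seminorms
that, on each single element, approximate `N` from above. -/
structure IsSmoothRing {T : Type*} [Ring T] (N : T → ℝ) (Q : ℕ → Set (T → ℝ)) : Prop where
  norm : IsRingSeminorm N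
  definite : ∀ x, N x = 0 → x = 0
  seminorm : ∀ n, ∀ q ∈ Q n, IsRingSeminorm q
  -- The seminorm may depend on x. It is this freedom that turns a strict bound on N into one on a
  -- seminorm of each degree n.
  near : ∀ n x r, N x < r → ∃ q ∈ Q n, q x < r
  -- Geometric convergence is required for one member of each degree. The limit is only asserted for
  -- N, which suffices to pass algebraic identities to the limit because N is definite.
  complete : ∀ a : ℕ → T, (∀ n, ∃ q ∈ Q n, ∃ C r : ℝ, 0 ≤ r ∧ r < 1 ∧
    ∀ k, q (a (k + 1) - a k) ≤ C * r ^ k) → ∃ b, Tendsto (fun k => N (a k - b)) atTop (𝓝 0)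

namespace IsSmoothRing

variable {T : Type*} [Ring T] {N : T → ℝ} {Q : ℕ → Set (T → ℝ)}

theorem eq_of_tendsto (h : IsSmoothRing N Q) {x y : T} {u : ℕ → ℝ}
    (hu : Tendsto u atTop (𝓝 0)) (hx : ∀ k, N (x - y) ≤ u k) : x = y := by
  have h1 : N (x - y) ≤ 0 := ge_of_tendsto' hu hx
  exact sub_eq_zero.mp (h.definite _ (le_antisymm h1 (h.norm.nonneg _)))

/-- The Neumann series. -/
theorem exists_inverse (h : IsSmoothRing N Q) {m : T} (hm : N m < 1) :
    ∃ s, (1 - m) * s = 1 ∧ s * (1 - m) = 1 := by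
  -- The sums start with the term 1 already included, so that all increments are positive powers of
  -- m.
  obtain ⟨s, hs⟩ := h.complete (fun k => ∑ i ∈ Finset.range (k + 1), m ^ i) (fun n => by
    obtain ⟨q, hq, hq1⟩ := h.near n m 1 hm
    refine ⟨q, hq, q m, q m, (h.seminorm n q hq).nonneg m, hq1, fun k => ?_⟩
    rw [Finset.sum_range_succ _ (k + 1), add_sub_cancel_left, ← pow_succ']
    exact (h.seminorm n q hq).pow_succ_le m k)
  have h0 : Tendsto (fun k => N m ^ (k + 1)) atTop (𝓝 0) :=
    (tendsto_pow_atTop_nhds_zero_of_lt_one (h.norm.nonneg m) hm).comp (tendsto_add_atTop_nat 1)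
  have h1 : Tendsto (fun k => N (1 - m) * N ((∑ i ∈ Finset.range (k + 1), m ^ i) - s) +
      N m ^ (k + 1)) atTop (𝓝 0) := by
    simpa using (hs.const_mul (N (1 - m))).add h0
  refine ⟨s, h.eq_of_tendsto h1 fun k => ?_, h.eq_of_tendsto h1 fun k => ?_⟩
  · have e : (1 - m) * s - 1 =
        -((1 - m) * ((∑ i ∈ Finset.range (k + 1), m ^ i) - s)) - m ^ (k + 1) := by
      rw [mul_sub, mul_neg_geom_sum]
      abel
    rw [e]
    refine (h.norm.sub_le _ _).trans (add_le_add ?_ (h.norm.pow_succ_le m k))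
    rw [h.norm.neg]
    exact h.norm.mul_le _ _
  · have e : s * (1 - m) - 1 =
        -(((∑ i ∈ Finset.range (k + 1), m ^ i) - s) * (1 - m)) - m ^ (k + 1) := by
      rw [sub_mul, geom_sum_mul_neg]
      abel
    rw [e]
    refine (h.norm.sub_le _ _).trans (add_le_add ?_ (h.norm.pow_succ_le m k))
    rw [h.norm.neg, mul_comm (N (1 - m))]
    exact h.norm.mul_le _ _

/-- The Newton iteration `x ↦ 3x² - 2x³` for idempotents. -/
def newton (x : T) : ℕ → T
  | 0 => x
  | k + 1 => 3 * newton x k ^ 2 - 2 * newton x k ^ 3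

/-- With y = z - z², one Newton step z' satisfies z' - z = -y + 2yz and z' - z'² = 3y² + 4y³. If
p(y) ≤ 1/8, then 3p(y) + 4p(y)² ≤ 1/2, so the defect is at least halved, while 1 + 2p(z) grows at
most by the factor 1 + 2/8 = 5/4. The increments therefore decay like (1/2 · 5/4)^k = (5/8)^k. -/
theorem newton_bound {p : T → ℝ} (hp : IsRingSeminorm p) {x : T} {a : ℝ}
    (ha : p (x - x * x) ≤ a) (ha' : a ≤ 1 / 8) (k : ℕ) :
    p (newton x k - newton x k * newton x k) ≤ a * (1 / 2) ^ k ∧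
      1 + 2 * p (newton x k) ≤ (1 + 2 * p x) * (5 / 4) ^ k ∧
      p (newton x (k + 1) - newton x k) ≤ a * (1 + 2 * p x) * (5 / 8) ^ k := by
  have increment : ∀ z : T, ∀ b : ℝ, p (z - z * z) ≤ b →
      p ((3 * z ^ 2 - 2 * z ^ 3) - z) ≤ b * (1 + 2 * p z) := by
    intro z b hb
    have e : (3 * z ^ 2 - 2 * z ^ 3) - z = -(z - z * z) + ((z - z * z) * z + (z - z * z) * z) := by
      noncomm_ring
    have h1 := hp.add_le (-(z - z * z)) ((z - z * z) * z + (z - z * z) * z)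
    have h2 := hp.add_le ((z - z * z) * z) ((z - z * z) * z)
    have h3 := hp.mul_le (z - z * z) z
    have h4 := mul_le_mul_of_nonneg_right hb (hp.nonneg z)
    rw [hp.neg] at h1
    rw [e]
    linarith
  have defect : ∀ z : T, ∀ b : ℝ, p (z - z * z) ≤ b → b ≤ 1 / 8 →
      p ((3 * z ^ 2 - 2 * z ^ 3) - (3 * z ^ 2 - 2 * z ^ 3) * (3 * z ^ 2 - 2 * z ^ 3)) ≤
        b * (1 / 2) := by
    intro z b hb hb'
    obtain ⟨y, hy⟩ : ∃ y, y = z - z * z := ⟨_, rfl⟩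
    have e : (3 * z ^ 2 - 2 * z ^ 3) - (3 * z ^ 2 - 2 * z ^ 3) * (3 * z ^ 2 - 2 * z ^ 3) =
        y * (y + y + y + (y + y + y + y) * y) := by
      rw [hy]
      noncomm_ring
    rw [← hy] at hb
    have hy0 := hp.nonneg y
    have h1 := hp.mul_le (y + y + y + (y + y + y + y) * y) y
    have h2 := hp.add_le (y + y + y) ((y + y + y + y) * y)
    have h3 := hp.mul_le (y + y + y + y) y
    have h4 := hp.add_le (y + y + y) y
    have h5 := hp.add_le (y + y) y
    have h6 := hp.add_le y y
    have h7 : p (y + y + y + (y + y + y + y) * y) ≤ 1 / 2 := by nlinarith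
    rw [e]
    refine (hp.mul_le _ _).trans ?_
    exact mul_le_mul hb h7 (hp.nonneg _) (hy0.trans hb)
  have ha0 : 0 ≤ a := (hp.nonneg _).trans ha
  induction k with
  | zero =>
    refine ⟨by simpa [newton] using ha, by simp [newton], ?_⟩
    simpa [newton] using increment x a ha
  | succ k ih =>
    obtain ⟨h1, h2, h3⟩ := ih
    have hk : a * (1 / 2) ^ k ≤ 1 / 8 := by
      refine (mul_le_of_le_one_right ha0 ?_).trans ha'
      exact pow_le_one₀ (by norm_num) (by norm_num)
    have g1 : p (newton x (k + 1) - newton x (k + 1) * newton x (k + 1)) ≤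
        a * (1 / 2) ^ (k + 1) := by
      rw [pow_succ, ← mul_assoc]
      exact defect _ _ h1 hk
    have g2 : 1 + 2 * p (newton x (k + 1)) ≤ (1 + 2 * p x) * (5 / 4) ^ (k + 1) := by
      have h4 := hp.add_le (newton x (k + 1) - newton x k) (newton x k)
      rw [sub_add_cancel] at h4
      have h5 : p (newton x (k + 1) - newton x k) ≤
          a * (1 / 2) ^ k * (1 + 2 * p (newton x k)) := increment _ _ h1
      have h6 := hp.nonneg (newton x k)
      rw [pow_succ, ← mul_assoc]
      nlinarith
    refine ⟨g1, g2, (increment _ _ g1).trans ?_⟩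
    calc a * (1 / 2) ^ (k + 1) * (1 + 2 * p (newton x (k + 1)))
        ≤ a * (1 / 2) ^ (k + 1) * ((1 + 2 * p x) * (5 / 4) ^ (k + 1)) := by gcongr
      _ = a * (1 + 2 * p x) * ((1 / 2) * (5 / 4)) ^ (k + 1) := by rw [mul_pow]; ring
      _ = _ := by norm_num

/-- Almost idempotent elements are close to idempotents. -/
theorem exists_idempotent (h : IsSmoothRing N Q) {x : T} (hx : N (x - x * x) < 1 / 8) :
    ∃ e, e * e = e ∧ N (e - x) ≤ 3 * (N (x - x * x) * (1 + 2 * N x)) := by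
  obtain ⟨e, he⟩ := h.complete (newton x) (fun n => by
    obtain ⟨q, hq, hq1⟩ := h.near n _ _ hx
    exact ⟨q, hq, _, 5 / 8, by norm_num, by norm_num,
      fun k => (newton_bound (h.seminorm n q hq) le_rfl hq1.le k).2.2⟩)
  have hb := newton_bound h.norm (le_refl (N (x - x * x))) hx.le
  set c := N (x - x * x) * (1 + 2 * N x)
  have hc : 0 ≤ c := mul_nonneg (h.norm.nonneg _) (by have := h.norm.nonneg x; linarith)
  -- The increments c (5/8)^k sum to 8c/3, which is rounded up to 3c; the factor 1 - (5/8)^k makes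
  -- the induction go through, since 3 · 3/8 ≥ 1.
  have h1 : ∀ k, N (newton x k - x) ≤ 3 * c * (1 - (5 / 8) ^ k) := by
    intro k
    induction k with
    | zero => simp [newton, h.norm.zero]
    | succ k ih =>
      have h2 := h.norm.add_le (newton x (k + 1) - newton x k) (newton x k - x)
      rw [sub_add_sub_cancel] at h2
      have h3 : (0 : ℝ) ≤ c * (5 / 8) ^ k := by positivity
      rw [pow_succ]
      linarith [(hb k).2.2]
  have h2 : ∀ k, N (newton x k - x) ≤ 3 * c := fun k => by
    refine (h1 k).trans (mul_le_of_le_one_right (by linarith) ?_)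
    have : (0 : ℝ) ≤ (5 / 8) ^ k := by positivity
    linarith
  refine ⟨e, ?_, ?_⟩
  -- This sequence dominates N(e - e²): the defect of the iterates tends to 0, and the products
  -- converge because the iterates stay bounded in N.
  · have ht : Tendsto (fun k => N (newton x k - e) + N (x - x * x) * (1 / 2) ^ k +
        (N (newton x k - e) * N e + N (newton x k) * N (newton x k - e))) atTop (𝓝 0) := by
      have hbd : Tendsto (fun k => (N x + 3 * c) * N (newton x k - e)) atTop (𝓝 0) := by
        simpa using he.const_mul (N x + 3 * c)
      have h3 : Tendsto (fun k => N (newton x k) * N (newton x k - e)) atTop (𝓝 0) := by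
        refine squeeze_zero (fun k => mul_nonneg (h.norm.nonneg _) (h.norm.nonneg _))
          (fun k => ?_) hbd
        refine mul_le_mul_of_nonneg_right ?_ (h.norm.nonneg _)
        have := h.norm.sub_le_sub (newton x k) x
        linarith [h2 k]
      have h4 : Tendsto (fun k : ℕ => N (x - x * x) * (1 / 2 : ℝ) ^ k) atTop (𝓝 0) := by
        simpa using (tendsto_pow_atTop_nhds_zero_of_lt_one (r := (1 / 2 : ℝ)) (by norm_num)
          (by norm_num)).const_mul (N (x - x * x))
      simpa using (he.add h4).add ((he.mul_const (N e)).add h3)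
    refine (h.eq_of_tendsto ht fun k => ?_).symm
    set z := newton x k
    have e1 : e - e * e = (e - z) + (z - z * z) + ((z - e) * e + z * (z - e)) := by noncomm_ring
    rw [e1]
    refine (h.norm.add_le _ _).trans (add_le_add ((h.norm.add_le _ _).trans
      (add_le_add (h.norm.sub_rev _ _).le (hb k).1)) ((h.norm.add_le _ _).trans
      (add_le_add (h.norm.mul_le _ _) (h.norm.mul_le _ _))))
  · have h3 : Tendsto (fun k => N (newton x k - e) + 3 * c) atTop (𝓝 (0 + 3 * c)) :=
      he.add_const _
    rw [zero_add] at h3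
    refine ge_of_tendsto' h3 fun k => ?_
    have e1 : e - x = (e - newton x k) + (newton x k - x) := by abel
    rw [e1]
    exact (h.norm.add_le _ _).trans (add_le_add (h.norm.sub_rev _ _).le (h2 k))

end IsSmoothRing
end KTheory

/-! ### Matrices over the unitization of a smooth algebra -/

namespace KTheory

open Filter Topology

section MatNorm

/-- The sum of the seminorms of the entries of a matrix. -/
noncomputable def matNorm {R : Type*} (p : R → ℝ) {m n : Type*} [Fintype m] [Fintype n]
    (M : Matrix m n R) : ℝ :=
  ∑ i, ∑ j, p (M i j)

variable {R : Type*} [Ring R] {p : R → ℝ} (hp : IsRingSeminorm p)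
  {l m n : Type*} [Fintype l] [Fintype m] [Fintype n]

include hp

theorem entry_le_matNorm (M : Matrix m n R) (i : m) (j : n) : p (M i j) ≤ matNorm p M :=
  (Finset.single_le_sum (f := fun j => p (M i j)) (fun _ _ => hp.nonneg _)
    (Finset.mem_univ j)).trans (Finset.single_le_sum (f := fun i => ∑ j, p (M i j))
      (fun _ _ => Finset.sum_nonneg fun _ _ => hp.nonneg _) (Finset.mem_univ i))

theorem matNorm_nonneg (M : Matrix m n R) : 0 ≤ matNorm p M :=
  Finset.sum_nonneg fun _ _ => Finset.sum_nonneg fun _ _ => hp.nonneg _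

theorem matNorm_add_le (M M' : Matrix m n R) : matNorm p (M + M') ≤ matNorm p M + matNorm p M' := by
  simp only [matNorm, ← Finset.sum_add_distrib]
  gcongr
  exact hp.add_le _ _

/-- Each row sum of M' is at most the sum over all entries, so no dimension constant enters, and the
estimate also covers rectangular matrices. -/
theorem matNorm_mul_le (M : Matrix l m R) (M' : Matrix m n R) :
    matNorm p (M * M') ≤ matNorm p M * matNorm p M' := by
  calc matNorm p (M * M') ≤ ∑ i, ∑ j, ∑ k, p (M i k) * p (M' k j) := by
        unfold matNorm
        gcongr
        rw [Matrix.mul_apply]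
        exact (hp.sum_le _ _).trans (Finset.sum_le_sum fun _ _ => hp.mul_le _ _)
    _ = ∑ i, ∑ k, p (M i k) * ∑ j, p (M' k j) := by
        refine Finset.sum_congr rfl fun i _ => ?_
        rw [Finset.sum_comm]
        simp only [Finset.mul_sum]
    _ ≤ ∑ i, ∑ k, p (M i k) * matNorm p M' := by
        gcongr with i _ k _
        · exact hp.nonneg _
        · exact Finset.single_le_sum (f := fun k => ∑ j, p (M' k j))
            (fun _ _ => Finset.sum_nonneg fun _ _ => hp.nonneg _) (Finset.mem_univ k)
    _ = _ := by simp only [matNorm, Finset.sum_mul]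

theorem isRingSeminorm_matNorm [DecidableEq n] :
    IsRingSeminorm (matNorm p : Matrix n n R → ℝ) where
  nonneg := matNorm_nonneg hp
  zero := by simp [matNorm, hp.zero]
  neg M := by simp [matNorm, hp.neg]
  add_le := matNorm_add_le hp
  mul_le := matNorm_mul_le hp

end MatNorm

section UNorm

variable {A : Type*} [NonUnitalRing A] [Module ℂ A] [IsScalarTower ℂ A A] [SMulCommClass ℂ A A]

/-- The seminorm `|c| + q(a)` of an element `(c, a)` of `A⁺ = ℂ ⊕ A`. -/
noncomputable def uNorm (q : A → ℝ) (x : Unitization ℂ A) : ℝ := ‖x.fst‖ + q x.snd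

/-- Since (c, a)(d, b) = (cd, cb + da + ab), the four terms match the expansion of (|c| + q(a))(|d|
+ q(b)). -/
theorem isRingSeminorm_uNorm {q : A → ℝ} (h : IsRingSeminorm q)
    (h' : ∀ (c : ℂ) a, q (c • a) ≤ ‖c‖ * q a) : IsRingSeminorm (uNorm q) where
  nonneg x := add_nonneg (norm_nonneg _) (h.nonneg _)
  zero := by simp [uNorm, h.zero]
  neg x := by simp [uNorm, h.neg]
  add_le x y := by
    have h1 := norm_add_le x.fst y.fst
    have h2 := h.add_le x.snd y.snd
    simp only [uNorm, Unitization.fst_add, Unitization.snd_add]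
    linarith
  mul_le x y := by
    have h1 := h.add_le (x.fst • y.snd + y.fst • x.snd) (x.snd * y.snd)
    have h2 := h.add_le (x.fst • y.snd) (y.fst • x.snd)
    have h3 := h' x.fst y.snd
    have h4 := h' y.fst x.snd
    have h5 := h.mul_le x.snd y.snd
    simp only [uNorm, Unitization.fst_mul, Unitization.snd_mul, norm_mul]
    linarith

end UNorm

/-- An algebra `A` with a norm `ν` that is complete for a finer family of submultiplicative
seminorms which, on each finite set, approximate `ν` from above. The last field says that the
topology of `A` is not finer than the one of the seminorms. -/
structure IsSmoothAlg {A : Type*} [NonUnitalRing A] [Module ℂ A] [TopologicalSpace A]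
    (ν : A → ℝ) (Q : ℕ → Set (A → ℝ)) : Prop where
  norm : IsRingSeminorm ν
  norm_smul : ∀ (c : ℂ) a, ν (c • a) ≤ ‖c‖ * ν a
  definite : ∀ a, ν a = 0 → a = 0
  seminorm : ∀ n, ∀ q ∈ Q n, IsRingSeminorm q
  seminorm_smul : ∀ n, ∀ q ∈ Q n, ∀ (c : ℂ) a, q (c • a) ≤ ‖c‖ * q a
  -- A finite set, because one seminorm has to serve all entries of a matrix at once.
  near : ∀ n (s : Finset A) (ε : ℝ), 0 < ε → ∃ q ∈ Q n, ∀ a ∈ s, q a < ν a + ε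
  complete : ∀ a : ℕ → A, (∀ n, ∃ q ∈ Q n, ∃ C r : ℝ, 0 ≤ r ∧ r < 1 ∧
    ∀ k, q (a (k + 1) - a k) ≤ C * r ^ k) → ∃ b, Tendsto (fun k => ν (a k - b)) atTop (𝓝 0)
  -- Lipschitz paths are enough: the only paths needed are segments 1 - tm and their inverses.
  continuous_of : ∀ γ : unitInterval → A, (∀ n, ∃ q ∈ Q n, ∃ C : ℝ, ∀ s t,
    q (γ s - γ t) ≤ C * |(s : ℝ) - t|) → Continuous γ

namespace IsSmoothAlg

variable {A : Type*} [NonUnitalRing A] [Module ℂ A] [IsScalarTower ℂ A A] [SMulCommClass ℂ A A]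
  [TopologicalSpace A] {ν : A → ℝ} {Q : ℕ → Set (A → ℝ)}

theorem isRingSeminorm_norm (h : IsSmoothAlg ν Q) : IsRingSeminorm (uNorm ν) :=
  isRingSeminorm_uNorm h.norm h.norm_smul

theorem isRingSeminorm (h : IsSmoothAlg ν Q) {n : ℕ} {q : A → ℝ} (hq : q ∈ Q n) :
    IsRingSeminorm (uNorm q) :=
  isRingSeminorm_uNorm (h.seminorm n q hq) (h.seminorm_smul n q hq)

theorem matNorm_definite (h : IsSmoothAlg ν Q) {m n : Type*} [Fintype m] [Fintype n]
    (M : Matrix m n (Unitization ℂ A)) (hM : matNorm (uNorm ν) M = 0) : M = 0 := by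
  ext1 i j
  have h1 := (entry_le_matNorm h.isRingSeminorm_norm M i j).trans hM.le
  have h2 := h.norm.nonneg (M i j).snd
  have h3 := norm_nonneg (M i j).fst
  unfold uNorm at h1
  ext
  · exact norm_eq_zero.mp (by linarith)
  · exact h.definite _ (by linarith)

theorem exists_matNorm_lt (h : IsSmoothAlg ν Q) {m n : Type*} [Fintype m] [Fintype n]
    (k : ℕ) (M : Matrix m n (Unitization ℂ A)) (r : ℝ) (hM : matNorm (uNorm ν) M < r) :
    ∃ q ∈ Q k, matNorm (uNorm q) M < r := by
  classical
  -- One more than the number of entries: d is then positive even for empty matrices, and the total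
  -- error (d - 1)ε stays strictly below the available gap dε.
  set d : ℝ := (Fintype.card m * Fintype.card n + 1) with hd
  have hd0 : 0 < d := by positivity
  set ε := (r - matNorm (uNorm ν) M) / d with hε
  have hε0 : 0 < ε := div_pos (by linarith) hd0
  obtain ⟨q, hq, hq'⟩ := h.near k (Finset.univ.image fun x : m × n => (M x.1 x.2).snd) ε hε0
  refine ⟨q, hq, ?_⟩
  have h1 : matNorm (uNorm q) M ≤ ∑ i : m, ∑ j : n, (uNorm ν (M i j) + ε) := by
    unfold matNorm
    gcongr with i _ j _
    have := hq' (M i j).snd (Finset.mem_image.mpr ⟨(i, j), Finset.mem_univ _, rfl⟩)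
    unfold uNorm
    linarith
  have h2 : ∑ i : m, ∑ j : n, (uNorm ν (M i j) + ε) = matNorm (uNorm ν) M + (d - 1) * ε := by
    simp only [Finset.sum_add_distrib, Finset.sum_const, Finset.card_univ, nsmul_eq_mul, matNorm,
      hd]
    ring
  have h3 : d * ε = r - matNorm (uNorm ν) M := by
    rw [hε]
    field_simp
  linarith

/-- Matrices over `A⁺`, with the seminorms of `A`, form a smooth ring. -/
theorem isSmoothRing (h : IsSmoothAlg ν Q) (d : ℕ) :
    IsSmoothRing (T := Matrix (Fin d) (Fin d) (Unitization ℂ A)) (matNorm (uNorm ν))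
      (fun n => (fun q => matNorm (uNorm q)) '' Q n) where
  norm := isRingSeminorm_matNorm h.isRingSeminorm_norm
  definite := h.matNorm_definite
  seminorm := by
    rintro n _ ⟨q, hq, rfl⟩
    exact isRingSeminorm_matNorm (h.isRingSeminorm hq)
  near := by
    intro n M r hM
    obtain ⟨q, hq, hq'⟩ := h.exists_matNorm_lt n M r hM
    exact ⟨_, ⟨q, hq, rfl⟩, hq'⟩
  complete := by
    intro a ha
    -- The scalar parts enter every seminorm with their absolute value, so degree 0 already makes
    -- them Cauchy.
    have h1 : ∀ i j, ∃ c, Tendsto (fun k => (a k i j).fst) atTop (𝓝 c) := by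
      intro i j
      obtain ⟨_, ⟨q, hq, rfl⟩, C, r, hr0, hr1, hC⟩ := ha 0
      refine cauchySeq_tendsto_of_complete (cauchySeq_of_le_geometric r C hr1 fun k => ?_)
      rw [dist_eq_norm, norm_sub_rev]
      refine le_trans ?_ (hC k)
      refine le_trans ?_ (entry_le_matNorm (h.isRingSeminorm hq) _ i j)
      exact le_add_of_nonneg_right ((h.seminorm 0 q hq).nonneg _)
    have h2 : ∀ i j, ∃ b, Tendsto (fun k => ν ((a k i j).snd - b)) atTop (𝓝 0) := by
      intro i j
      refine h.complete _ fun n => ?_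
      obtain ⟨_, ⟨q, hq, rfl⟩, C, r, hr0, hr1, hC⟩ := ha n
      refine ⟨q, hq, C, r, hr0, hr1, fun k => le_trans ?_ (hC k)⟩
      refine le_trans ?_ (entry_le_matNorm (h.isRingSeminorm hq) _ i j)
      exact le_add_of_nonneg_left (norm_nonneg _)
    choose c hc using h1
    choose b hb using h2
    refine ⟨fun i j => ⟨(c i j, b i j)⟩, ?_⟩
    have h3 : ∀ i j, Tendsto (fun k => ‖(a k i j).fst - c i j‖ + ν ((a k i j).snd - b i j))
        atTop (𝓝 0) := fun i j => by
      simpa using (tendsto_iff_norm_sub_tendsto_zero.mp (hc i j)).add (hb i j)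
    have h4 := tendsto_finsetSum (Finset.univ : Finset (Fin d)) fun i _ =>
      tendsto_finsetSum (Finset.univ : Finset (Fin d)) fun j _ => h3 i j
    simpa using! h4

theorem continuousMatrix_of_lipschitz (h : IsSmoothAlg ν Q) {d : ℕ}
    (γ : unitInterval → Matrix (Fin d) (Fin d) (Unitization ℂ A))
    (hγ : ∀ n, ∃ q ∈ Q n, ∃ C : ℝ, ∀ s t, matNorm (uNorm q) (γ s - γ t) ≤ C * |(s : ℝ) - t|) :
    ContinuousMatrix γ := by
  intro i j
  constructor
  · obtain ⟨q, hq, C, hC⟩ := hγ 0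
    have : LipschitzWith C.toNNReal (fun s => (γ s i j).fst) := by
      refine LipschitzWith.of_dist_le_mul fun s t => ?_
      rw [dist_eq_norm, Subtype.dist_eq, Real.dist_eq]
      refine le_trans ?_ ((hC s t).trans (mul_le_mul_of_nonneg_right (Real.le_coe_toNNReal C)
        (abs_nonneg _)))
      refine le_trans ?_ (entry_le_matNorm (h.isRingSeminorm hq) _ i j)
      exact le_add_of_nonneg_right ((h.seminorm 0 q hq).nonneg _)
    exact this.continuous
  · refine h.continuous_of _ fun n => ?_
    obtain ⟨q, hq, C, hC⟩ := hγ n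
    refine ⟨q, hq, C, fun s t => le_trans ?_ (hC s t)⟩
    refine le_trans ?_ (entry_le_matNorm (h.isRingSeminorm hq) _ i j)
    exact le_add_of_nonneg_left (norm_nonneg _)

theorem uNorm_smul_le {q : A → ℝ} (h' : ∀ (c : ℂ) a, q (c • a) ≤ ‖c‖ * q a) (c : ℂ)
    (x : Unitization ℂ A) : uNorm q (c • x) ≤ ‖c‖ * uNorm q x := by
  rw [uNorm, uNorm, Unitization.fst_smul, Unitization.snd_smul, smul_eq_mul, norm_mul, mul_add]
  gcongr
  exact h' c _

theorem matNorm_smul_le {q : A → ℝ} (h' : ∀ (c : ℂ) a, q (c • a) ≤ ‖c‖ * q a) (c : ℂ)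
    {m n : Type*} [Fintype m] [Fintype n]
    (x : Matrix m n (Unitization ℂ A)) : matNorm (uNorm q) (c • x) ≤ ‖c‖ * matNorm (uNorm q) x := by
  simp only [matNorm, Finset.mul_sum]
  gcongr
  exact uNorm_smul_le h' c _

/-- Matrices over `A⁺` that are close to `1` in norm are invertible, and can be joined to `1`. -/
theorem exists_homotopic (h : IsSmoothAlg ν Q) {d : ℕ}
    (x : Matrix (Fin d) (Fin d) (Unitization ℂ A)) (hx : matNorm (uNorm ν) (1 - x) < 1) :
    ∃ u : GLn (Unitization ℂ A) d, u.val = x ∧ u.IsHomotopicToOne := by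
  obtain ⟨m, rfl⟩ : ∃ m, x = 1 - m := ⟨1 - x, by abel⟩
  rw [sub_sub_cancel] at hx
  have hN := h.isSmoothRing d
  -- Because |t| ≤ 1, a seminorm with value less than 1 at m handles the whole segment 1 - tm
  -- uniformly.
  have hsm : ∀ t : unitInterval, ∀ q : A → ℝ, IsRingSeminorm q →
      (∀ (c : ℂ) a, q (c • a) ≤ ‖c‖ * q a) →
      matNorm (uNorm q) (((t : ℝ) : ℂ) • m) ≤ matNorm (uNorm q) m := by
    intro t q hq hq'
    refine (matNorm_smul_le hq' _ _).trans (mul_le_of_le_one_left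
      (matNorm_nonneg (isRingSeminorm_uNorm hq hq') _) ?_)
    rw [Complex.norm_real, Real.norm_of_nonneg t.2.1]
    exact t.2.2
  have key : ∀ t : unitInterval, ∃ u : GLn (Unitization ℂ A) d,
      u.val = 1 - ((t : ℝ) : ℂ) • m := by
    intro t
    obtain ⟨s, hs, hs'⟩ := hN.exists_inverse ((hsm t ν h.norm h.norm_smul).trans_lt hx)
    exact ⟨⟨_, s, hs, hs'⟩, rfl⟩
  choose γ hγ using key
  refine ⟨γ 1, by simp [hγ], γ, Units.ext (by simp [hγ]), rfl, ?_, ?_⟩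
  · refine h.continuousMatrix_of_lipschitz _ fun n => ?_
    obtain ⟨q, hq, -⟩ := h.exists_matNorm_lt n m 1 hx
    refine ⟨q, hq, matNorm (uNorm q) m, fun s t => ?_⟩
    have e : (γ s).val - (γ t).val = (((t : ℝ) - (s : ℝ) : ℝ) : ℂ) • m := by
      rw [hγ, hγ]
      push_cast
      rw [sub_smul]
      abel
    rw [e, mul_comm, abs_sub_comm, ← Real.norm_eq_abs, ← Complex.norm_real]
    exact matNorm_smul_le (h.seminorm_smul n q hq) _ _
  · refine h.continuousMatrix_of_lipschitz _ fun n => ?_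
    obtain ⟨q, hq, hq1⟩ := h.exists_matNorm_lt n m 1 hx
    have hR := isRingSeminorm_matNorm (n := Fin d) (h.isRingSeminorm hq)
    -- A bound for the inverses that does not depend on t. With the resolvent identity below it
    -- makes the inverse path Lipschitz.
    have hb : ∀ t, matNorm (uNorm q) (γ t)⁻¹.val ≤
        matNorm (uNorm q) (1 : Matrix (Fin d) (Fin d) (Unitization ℂ A)) /
          (1 - matNorm (uNorm q) m) := fun t => by
      refine hR.le_of_inverse (hsm t q (h.seminorm n q hq) (h.seminorm_smul n q hq)) hq1 ?_
      rw [← hγ]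
      exact (γ t).mul_inv
    set c := matNorm (uNorm q) (1 : Matrix (Fin d) (Fin d) (Unitization ℂ A)) /
          (1 - matNorm (uNorm q) m)
    refine ⟨q, hq, c * matNorm (uNorm q) m * c, fun s t => ?_⟩
    have e : (γ s)⁻¹.val - (γ t)⁻¹.val =
        (γ s)⁻¹.val * ((((s : ℝ) - (t : ℝ) : ℝ) : ℂ) • m) * (γ t)⁻¹.val := by
      have e1 : (((s : ℝ) - (t : ℝ) : ℝ) : ℂ) • m = (γ t).val - (γ s).val := by
        rw [hγ, hγ]
        push_cast
        rw [sub_smul]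
        abel
      rw [e1, mul_sub, sub_mul, mul_assoc, Units.mul_inv, Units.inv_mul]
      simp
    rw [e]
    have h1 := matNorm_smul_le (h.seminorm_smul n q hq) (((s : ℝ) - (t : ℝ) : ℝ) : ℂ) m
    rw [Complex.norm_real, Real.norm_eq_abs] at h1
    have hc : 0 ≤ c := (hR.nonneg _).trans (hb 0)
    have hm0 := hR.nonneg m
    calc _ ≤ matNorm (uNorm q) (γ s)⁻¹.val * matNorm (uNorm q)
          ((((s : ℝ) - (t : ℝ) : ℝ) : ℂ) • m) * matNorm (uNorm q) (γ t)⁻¹.val :=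
          (hR.mul_le _ _).trans (mul_le_mul_of_nonneg_right (hR.mul_le _ _) (hR.nonneg _))
      _ ≤ c * (|(s : ℝ) - t| * matNorm (uNorm q) m) * c := by
          gcongr
          · exact hR.nonneg _
          · exact hR.nonneg _
          · exact hb s
          · exact hb t
      _ = _ := by ring

end IsSmoothAlg
end KTheory

/-! ### Dense smooth subalgebras: closure under inversion and K₀ -/

namespace KTheory

open Filter Topology

section Functoriality

variable {R S : Type*} [Ring R] [Ring S]

/-- A homomorphism that induces a bijection on classes of idempotents is bijective on `K₀`. -/
theorem K0Ring.map_bijective {φ : R →+* S} (h : Function.Bijective (ProjClass.map φ)) :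
    Function.Bijective (K0Ring.map φ) := by
  let e : ProjClass R ≃+ ProjClass S := AddEquiv.ofBijective (ProjClass.map φ) h
  let ψ : K0Ring S →+ K0Ring R := Algebra.GrothendieckAddGroup.lift
    (Algebra.GrothendieckAddGroup.of.comp e.symm.toAddMonoidHom)
  have hψ : ∀ x, ψ (Algebra.GrothendieckAddGroup.of x) =
      Algebra.GrothendieckAddGroup.of (e.symm x) := fun x =>
    DFunLike.congr_fun (Algebra.GrothendieckAddGroup.lift.symm_apply_apply
      (Algebra.GrothendieckAddGroup.of.comp e.symm.toAddMonoidHom)) x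
  have h1 : ψ.comp (K0Ring.map φ) = AddMonoidHom.id _ := by
    apply Algebra.GrothendieckAddGroup.lift.symm.injective
    ext x
    simp only [Algebra.GrothendieckAddGroup.lift_symm_apply, AddMonoidHom.comp_apply]
    rw [K0Ring.map_of, hψ]
    exact congrArg _ (e.symm_apply_apply x)
  have h2 : (K0Ring.map φ).comp ψ = AddMonoidHom.id _ := by
    apply Algebra.GrothendieckAddGroup.lift.symm.injective
    ext x
    simp only [Algebra.GrothendieckAddGroup.lift_symm_apply, AddMonoidHom.comp_apply]
    rw [hψ, K0Ring.map_of]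
    exact congrArg _ (e.apply_symm_apply x)
  exact Function.bijective_iff_has_inverse.mpr
    ⟨ψ, fun x => DFunLike.congr_fun h1 x, fun x => DFunLike.congr_fun h2 x⟩

variable (R) in
/-- The canonical homomorphism `GL_n(R) → GL_∞(R)`. -/
noncomputable def GLInf.of (n : ℕ) : GLn R n →* GLInf R where
  toFun u := ⟦⟨n, u⟩⟧
  map_one' := (DirectLimit.one_def (f := GLn.stab R) n).symm
  map_mul' u v := (DirectLimit.mul_def (f := GLn.stab R) n u v).symm

theorem GLInf.exists_eq_of (x : GLInf R) : ∃ n u, x = GLInf.of R n u :=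
  DirectLimit.exists_eq_mk _ x

theorem GLInf.of_stab {m n : ℕ} (h : m ≤ n) (u : GLn R m) :
    GLInf.of R n (GLn.stab R m n h u) = GLInf.of R m u :=
  (DirectLimit.eq_of_le (⟨m, u⟩ : Σ n, GLn R n) n h).symm

theorem GLInf.of_eq_of {m n : ℕ} {u : GLn R m} {v : GLn R n} (h : GLInf.of R m u = GLInf.of R n v) :
    ∃ (k : ℕ) (h1 : m ≤ k) (h2 : n ≤ k), GLn.stab R m k h1 u = GLn.stab R n k h2 v :=
  Quotient.exact h

theorem GLn.map_stab (φ : R →+* S) {m n : ℕ} (h : m ≤ n) (u : GLn R m) :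
    GLn.map φ n (GLn.stab R m n h u) = GLn.stab S m n h (GLn.map φ m u) :=
  Units.ext (stab_map φ h u.1).symm

end Functoriality

section UnitizationTopology

variable {A : Type*} [NonUnitalRing A] [Module ℂ A] [IsScalarTower ℂ A A] [SMulCommClass ℂ A A]
  [TopologicalSpace A]

/-- The product topology on `A⁺ = ℂ ⊕ A`. -/
noncomputable instance : TopologicalSpace (Unitization ℂ A) :=
  TopologicalSpace.induced Unitization.toProd instTopologicalSpaceProd

theorem continuous_unitization_iff {X : Type*} [TopologicalSpace X] {γ : X → Unitization ℂ A} :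
    Continuous γ ↔ Continuous (fun x => (γ x).fst) ∧ Continuous (fun x => (γ x).snd) := by
  rw [continuous_induced_rng]
  exact continuous_prodMk

theorem continuous_unitization_fst : Continuous (fun x : Unitization ℂ A => x.fst) :=
  (continuous_unitization_iff.mp continuous_id).1

theorem continuous_unitization_snd : Continuous (fun x : Unitization ℂ A => x.snd) :=
  (continuous_unitization_iff.mp continuous_id).2

instance [IsTopologicalRing A] [ContinuousSMul ℂ A] : IsTopologicalRing (Unitization ℂ A) :=
  have h1 := continuous_unitization_fst (A := A)
  have h2 := continuous_unitization_snd (A := A)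
  have f1 := h1.comp (continuous_fst (X := Unitization ℂ A) (Y := Unitization ℂ A))
  have f2 := h1.comp (continuous_snd (X := Unitization ℂ A) (Y := Unitization ℂ A))
  have s1 := h2.comp (continuous_fst (X := Unitization ℂ A) (Y := Unitization ℂ A))
  have s2 := h2.comp (continuous_snd (X := Unitization ℂ A) (Y := Unitization ℂ A))
  { continuous_add := continuous_unitization_iff.mpr ⟨f1.add f2, s1.add s2⟩
    continuous_mul := continuous_unitization_iff.mpr
      ⟨f1.mul f2, ((f1.smul s2).add (f2.smul s1)).add (s1.mul s2)⟩
    continuous_neg := continuous_unitization_iff.mpr ⟨h1.neg, h2.neg⟩ }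

theorem continuousMatrix_iff {X : Type*} [TopologicalSpace X] {n : ℕ}
    {γ : X → Matrix (Fin n) (Fin n) (Unitization ℂ A)} : ContinuousMatrix γ ↔ Continuous γ := by
  refine ⟨fun h => continuous_matrix fun i j => continuous_unitization_iff.mpr (h i j),
    fun h i j => continuous_unitization_iff.mp (h.matrix_elem i j)⟩

theorem continuous_matNorm {ν : A → ℝ} (hν : Continuous ν) {m n : Type*} [Fintype m] [Fintype n] :
    Continuous (matNorm (uNorm ν) : Matrix m n (Unitization ℂ A) → ℝ) := by
  refine continuous_finsetSum _ fun i _ => continuous_finsetSum _ fun j _ => ?_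
  have h : Continuous (fun M : Matrix m n (Unitization ℂ A) => M i j) :=
    continuous_id.matrix_elem i j
  exact (continuous_unitization_fst.comp h).norm.add (hν.comp (continuous_unitization_snd.comp h))

variable {V : Type*} [NonUnitalRing V] [Module ℂ V] [IsScalarTower ℂ V V] [SMulCommClass ℂ V V]

theorem denseRange_matrix_map {f : V →ₙₐ[ℂ] A} (hf : DenseRange f) (m n : Type*) :
    DenseRange (fun M : Matrix m n (Unitization ℂ V) => M.map (unitMap f)) := by
  have h1 : DenseRange (unitMap f) := by
    have h2 : DenseRange (Prod.map (id : ℂ → ℂ) f) := Function.surjective_id.denseRange.prodMap hf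
    intro x
    rw [mem_closure_iff_nhds]
    intro U hU
    rw [nhds_induced] at hU
    obtain ⟨W, hW, hWU⟩ := hU
    obtain ⟨y, hy⟩ := h2.exists_mem_open isOpen_interior ⟨_, mem_interior_iff_mem_nhds.mpr hW⟩
    refine ⟨unitMap f ⟨y⟩, hWU ?_, ⟨_, rfl⟩⟩
    have e : (unitMap f ⟨y⟩).toProd = Prod.map id f y :=
      Prod.ext (unitMap_fst f ⟨y⟩) (unitMap_snd f ⟨y⟩)
    rw [Set.mem_preimage, e]
    exact interior_subset hy
  exact DenseRange.piMap fun i : m => DenseRange.piMap fun j : n => h1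

end UnitizationTopology

section DenseSmooth

variable {V A : Type*} [NonUnitalRing V] [Module ℂ V] [IsScalarTower ℂ V V] [SMulCommClass ℂ V V]
  [TopologicalSpace V]
  [NonUnitalRing A] [Module ℂ A] [IsScalarTower ℂ A A] [SMulCommClass ℂ A A]
  [TopologicalSpace A] [IsTopologicalRing A] [ContinuousSMul ℂ A]

/-- `f` is an isometric inclusion of a smooth algebra as a dense subalgebra of `A`, which is itself
complete for its norm. -/
structure IsDenseSmooth (f : V →ₙₐ[ℂ] A) (νV : V → ℝ) (QV : ℕ → Set (V → ℝ)) (νA : A → ℝ)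
    (QA : ℕ → Set (A → ℝ)) : Prop where
  smooth : IsSmoothAlg νV QV
  smooth' : IsSmoothAlg νA QA
  isometry : ∀ v, νA (f v) = νV v
  dense : DenseRange f
  continuous_norm : Continuous νA
  continuous : Continuous f

namespace IsDenseSmooth

variable {f : V →ₙₐ[ℂ] A} {νV : V → ℝ} {QV : ℕ → Set (V → ℝ)} {νA : A → ℝ} {QA : ℕ → Set (A → ℝ)}
  (h : IsDenseSmooth f νV QV νA QA)

include h

theorem matNorm_map {m n : Type*} [Fintype m] [Fintype n] (M : Matrix m n (Unitization ℂ V)) :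
    matNorm (uNorm νA) (M.map (unitMap f)) = matNorm (uNorm νV) M := by
  simp only [matNorm, uNorm, Matrix.map_apply, unitMap_fst, unitMap_snd, h.isometry]

theorem exists_map_mem {m n : Type*} {U : Set (Matrix m n (Unitization ℂ A))} (hU : IsOpen U)
    {x : Matrix m n (Unitization ℂ A)} (hx : x ∈ U) :
    ∃ M : Matrix m n (Unitization ℂ V), M.map (unitMap f) ∈ U :=
  (denseRange_matrix_map h.dense m n).exists_mem_open hU ⟨x, hx⟩

/-- Since f is isometric, the hypothesis bounds the norm of 1 - x over V itself, and the Neumann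
series can be summed there. -/
theorem isUnit_of_matNorm_lt {d : ℕ} {x : Matrix (Fin d) (Fin d) (Unitization ℂ V)}
    (hx : matNorm (uNorm νA) (1 - x.map (unitMap f)) < 1) : IsUnit x := by
  have e : 1 - x.map (unitMap f) = (1 - x).map (unitMap f) := by
    rw [Matrix.map_sub _ (map_sub _), Matrix.map_one _ (map_zero _) (map_one _)]
  rw [e, h.matNorm_map] at hx
  obtain ⟨u, hu, -⟩ := h.smooth.exists_homotopic x hx
  exact ⟨u, hu⟩

/-- A smooth dense subalgebra is closed under inversion. -/
theorem isUnit_of_map {d : ℕ} {x : Matrix (Fin d) (Fin d) (Unitization ℂ V)}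
    (hx : IsUnit (x.map (unitMap f))) : IsUnit x := by
  obtain ⟨u, hu⟩ := hx
  have hN := continuous_matNorm h.continuous_norm (m := Fin d) (n := Fin d)
  have h0 := (isRingSeminorm_matNorm (n := Fin d) h.smooth'.isRingSeminorm_norm).zero
  -- An approximation y over V to the inverse of the image of x. Then xy and yx are both close to 1,
  -- hence units over V, which gives x a right and a left inverse.
  obtain ⟨y, hy⟩ := h.exists_map_mem (U := {M | matNorm (uNorm νA) (1 - u.val * M) < 1} ∩
      {M | matNorm (uNorm νA) (1 - M * u.val) < 1})
    ((isOpen_Iio.preimage (hN.comp (by fun_prop : Continuous fun M => 1 - u.val * M))).inter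
      (isOpen_Iio.preimage (hN.comp (by fun_prop : Continuous fun M => 1 - M * u.val))))
    (x := (u⁻¹).val) (by simp [h0])
  rw [hu, Set.mem_inter_iff, Set.mem_ofPred_eq, Set.mem_ofPred_eq, ← Matrix.map_mul,
    ← Matrix.map_mul] at hy
  obtain ⟨v, hv⟩ := h.isUnit_of_matNorm_lt hy.1
  obtain ⟨w, hw⟩ := h.isUnit_of_matNorm_lt hy.2
  refine isUnit_iff_exists_and_exists.mpr ⟨⟨y * v⁻¹.val, ?_⟩, ⟨w⁻¹.val * y, ?_⟩⟩
  · rw [← mul_assoc, ← hv, Units.mul_inv]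
  · rw [mul_assoc, ← hw, Units.inv_mul]

/-- An equivalence over A is approximated by matrices u, v over V with u in the corner from g to e
and v in the opposite one. Then uv is close to e and vu is close to g, so uv + (1 - e) and vu + (1 -
g) are units z and w. Replacing v by v z⁻¹ makes the first product exactly e. The second product p
then satisfies vu(g - p) = 0, and the unit w forces p = g. -/
theorem mvn_of_map {m n : ℕ} {e : Matrix (Fin m) (Fin m) (Unitization ℂ V)}
    {g : Matrix (Fin n) (Fin n) (Unitization ℂ V)} (he : e * e = e) (hg : g * g = g)
    (heg : MvN (e.map (unitMap f)) (g.map (unitMap f))) : MvN e g := by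
  obtain ⟨x, y, hxy, hyx⟩ := heg
  set E := e.map (unitMap f) with hE
  set F := g.map (unitMap f) with hF
  have hEE : E * E = E := by rw [hE, ← Matrix.map_mul, he]
  have hFF : F * F = F := by rw [hF, ← Matrix.map_mul, hg]
  have h0 := fun d : ℕ => (isRingSeminorm_matNorm (n := Fin d) h.smooth'.isRingSeminorm_norm).zero
  -- The given pair need not lie in the corners. After compression by E and F it still implements
  -- the equivalence, so the open conditions used below hold at (x, y).
  have k1 : E - (E * x * F) * (F * y * E) = 0 := by
    have : (E * x * F) * (F * y * E) = E := by
      calc (E * x * F) * (F * y * E) = E * x * (F * F) * y * E := by simp only [Matrix.mul_assoc]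
        _ = E * x * (y * x) * y * E := by rw [hFF, hyx]
        _ = E * (x * y) * (x * y) * E := by simp only [Matrix.mul_assoc]
        _ = E := by rw [hxy, hEE, hEE, hEE]
    rw [this, sub_self]
  have k2 : F - (F * y * E) * (E * x * F) = 0 := by
    have : (F * y * E) * (E * x * F) = F := by
      calc (F * y * E) * (E * x * F) = F * y * (E * E) * x * F := by simp only [Matrix.mul_assoc]
        _ = F * y * (x * y) * x * F := by rw [hEE, hxy]
        _ = F * (y * x) * (y * x) * F := by simp only [Matrix.mul_assoc]
        _ = F := by rw [hyx, hFF, hFF, hFF]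
    rw [this, sub_self]
  have hd := (denseRange_matrix_map h.dense (Fin m) (Fin n)).prodMap
    (denseRange_matrix_map h.dense (Fin n) (Fin m))
  obtain ⟨⟨a, b⟩, hab⟩ := hd.exists_mem_open
    (s := {p : Matrix (Fin m) (Fin n) (Unitization ℂ A) × Matrix (Fin n) (Fin m) (Unitization ℂ A) |
        matNorm (uNorm νA) (E - (E * p.1 * F) * (F * p.2 * E)) < 1} ∩
      {p | matNorm (uNorm νA) (F - (F * p.2 * E) * (E * p.1 * F)) < 1})
    ((isOpen_Iio.preimage ((continuous_matNorm h.continuous_norm).comp (by fun_prop))).inter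
      (isOpen_Iio.preimage ((continuous_matNorm h.continuous_norm).comp (by fun_prop))))
    ⟨(x, y), by simp only [Set.mem_inter_iff, Set.mem_ofPred_eq, k1, k2, h0]; norm_num⟩
  set u := e * a * g with hu
  set v := g * b * e with hv
  have hUV : matNorm (uNorm νA) (1 - (u * v + (1 - e)).map (unitMap f)) < 1 := by
    convert (show matNorm (uNorm νA) (E - (E * a.map (unitMap f) * F) *
      (F * b.map (unitMap f) * E)) < 1 from hab.1) using 2
    rw [Matrix.map_add _ (map_add _), Matrix.map_sub _ (map_sub _),
      Matrix.map_one _ (map_zero _) (map_one _), Matrix.map_mul, hu, hv]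
    simp only [Matrix.map_mul, ← hE, ← hF]
    abel
  have hVU : matNorm (uNorm νA) (1 - (v * u + (1 - g)).map (unitMap f)) < 1 := by
    convert (show matNorm (uNorm νA) (F - (F * b.map (unitMap f) * E) *
      (E * a.map (unitMap f) * F)) < 1 from hab.2) using 2
    rw [Matrix.map_add _ (map_add _), Matrix.map_sub _ (map_sub _),
      Matrix.map_one _ (map_zero _) (map_one _), Matrix.map_mul, hu, hv]
    simp only [Matrix.map_mul, ← hE, ← hF]
    abel
  obtain ⟨z, hz⟩ := h.isUnit_of_matNorm_lt hUV
  obtain ⟨w, hw⟩ := h.isUnit_of_matNorm_lt hVU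
  have eu : e * u = u := by rw [hu, ← Matrix.mul_assoc, ← Matrix.mul_assoc, he]
  have ug : u * g = u := by rw [hu, Matrix.mul_assoc, hg]
  have ve : v * e = v := by rw [hv, Matrix.mul_assoc, he]
  have gv : g * v = v := by rw [hv, ← Matrix.mul_assoc, ← Matrix.mul_assoc, hg]
  clear_value u v
  have h1 : u * v * z⁻¹.val = e := by
    have h2 : e * (z.val * z⁻¹.val) = e := by rw [Units.mul_inv, mul_one]
    rw [hz, ← mul_assoc, mul_add, mul_sub, mul_one, he, sub_self, add_zero,
      ← Matrix.mul_assoc, eu] at h2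
    exact h2
  refine ⟨u, v * z⁻¹.val, by rw [← Matrix.mul_assoc, h1], ?_⟩
  set p := v * z⁻¹.val * u with hp
  have gp : g * p = p := by rw [hp, ← Matrix.mul_assoc, ← Matrix.mul_assoc, gv]
  have h3 : v * u * p = v * u := by
    calc v * u * p = v * (u * v * z⁻¹.val) * u := by rw [hp]; simp only [Matrix.mul_assoc]
      _ = v * u := by rw [h1, ve]
  -- The summand vu of w kills g - p by `h3`, and 1 - g kills it because g fixes both g and p from
  -- the left.
  have h4 : w.val * (g - p) = 0 := by
    rw [hw, add_mul, mul_sub, h3, sub_mul, one_mul, mul_sub, hg, gp, Matrix.mul_assoc, ug]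
    simp
  have h5 : g - p = 0 := by
    rw [← one_mul (g - p), ← Units.inv_mul w, mul_assoc, h4, mul_zero]
  exact (sub_eq_zero.mp h5).symm

/-- A matrix over V near e is almost idempotent, and Newton iteration over V moves it only slightly
to an idempotent. Idempotents F and e that are close enough are conjugate by z = Fe + (1 - F)(1 -
e), which is near 1 and satisfies Fz = Fe = ze. -/
theorem exists_mvn {d : ℕ} {e : Matrix (Fin d) (Fin d) (Unitization ℂ A)} (he : e * e = e) :
    ∃ g : Matrix (Fin d) (Fin d) (Unitization ℂ V), g * g = g ∧ MvN (g.map (unitMap f)) e := by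
  have hR := isRingSeminorm_matNorm (n := Fin d) h.smooth'.isRingSeminorm_norm
  have hN := continuous_matNorm h.continuous_norm (m := Fin d) (n := Fin d)
  set N := (matNorm (uNorm νA) : Matrix (Fin d) (Fin d) (Unitization ℂ A) → ℝ) with hN'
  -- Both left-hand sides vanish at e. The first condition starts the Newton iteration; the second
  -- bounds the distance of the resulting idempotent to e, times 1 + 2N(e), which is what `hz`
  -- needs.
  obtain ⟨x, hx⟩ := h.exists_map_mem (U := {M | N (M - M * M) < 1 / 8} ∩
      {M | (3 * (N (M - M * M) * (1 + 2 * N M)) + N (M - e)) * (1 + 2 * N e) < 1})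
    ((isOpen_Iio.preimage (by fun_prop : Continuous fun M => N (M - M * M))).inter
      (isOpen_Iio.preimage (by fun_prop : Continuous fun M =>
        (3 * (N (M - M * M) * (1 + 2 * N M)) + N (M - e)) * (1 + 2 * N e))))
    (x := e) (by simp [he, hR.zero])
  set X := x.map (unitMap f) with hX
  have e1 : N (X - X * X) = matNorm (uNorm νV) (x - x * x) := by
    rw [← h.matNorm_map, Matrix.map_sub _ (map_sub _), Matrix.map_mul]
  have e2 : N X = matNorm (uNorm νV) x := h.matNorm_map _
  have hx1 := hx.1
  have hx2 : (3 * (N (X - X * X) * (1 + 2 * N X)) + N (X - e)) * (1 + 2 * N e) < 1 := hx.2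
  rw [Set.mem_ofPred_eq, e1] at hx1
  obtain ⟨g, hg, hgx⟩ := (h.smooth.isSmoothRing d).exists_idempotent hx1
  rw [← e1, ← e2, ← h.matNorm_map, Matrix.map_sub _ (map_sub _)] at hgx
  set F := g.map (unitMap f) with hF
  have hFF : F * F = F := by rw [hF, ← Matrix.map_mul, hg]
  refine ⟨g, hg, ?_⟩
  have hFe : N (F - e) ≤ 3 * (N (X - X * X) * (1 + 2 * N X)) + N (X - e) := by
    have := hR.add_le (F - X) (X - e)
    rw [sub_add_sub_cancel] at this
    exact this.trans (add_le_add hgx le_rfl)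
  have hz : N (1 - (F * e + (1 - F) * (1 - e))) < 1 := by
    have e3 : 1 - (F * e + (1 - F) * (1 - e)) = (F - e) - ((F - e) * e + (F - e) * e) := by
      simp only [sub_mul, mul_sub, one_mul, mul_one, he]
      abel
    have h1 := hR.sub_le (F - e) ((F - e) * e + (F - e) * e)
    have h2 := hR.add_le ((F - e) * e) ((F - e) * e)
    have h3 := hR.mul_le (F - e) e
    have h4 := hR.nonneg e
    rw [e3]
    nlinarith
  obtain ⟨z, hz', -⟩ := h.smooth'.exists_homotopic _ hz
  have hc : F * z.val = z.val * e := by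
    rw [hz']
    simp only [mul_add, add_mul, sub_mul, mul_sub, one_mul, mul_one, ← mul_assoc, hFF]
    simp only [mul_assoc, he]
    abel
  refine MvN.symm ⟨z⁻¹.val * F, F * z.val, ?_, ?_⟩
  · calc z⁻¹.val * F * (F * z.val) = z⁻¹.val * (F * F * z.val) := by simp only [mul_assoc]
      _ = e := by rw [hFF, hc, ← mul_assoc, Units.inv_mul, one_mul]
  · calc F * z.val * (z⁻¹.val * F) = F * (z.val * z⁻¹.val) * F := by simp only [mul_assoc]
      _ = F := by rw [Units.mul_inv, mul_one, hFF]

theorem projClass_map_bijective : Function.Bijective (ProjClass.map (unitMap f)) := by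
  constructor
  · rintro ⟨e⟩ ⟨g⟩ heg
    exact Quotient.sound (h.mvn_of_map e.idem g.idem (Quotient.exact heg))
  · rintro ⟨e⟩
    obtain ⟨g, hg, hge⟩ := h.exists_mvn e.idem
    exact ⟨Quotient.mk _ ⟨e.size, g, hg⟩, Quotient.sound hge⟩

/-- The inclusion of a dense smooth subalgebra induces an isomorphism on `K₀`. -/
theorem K0_map_bijective : Function.Bijective (K0.map f) := by
  have hb := K0Ring.map_bijective h.projClass_map_bijective
  constructor
  · intro x y hxy
    exact Subtype.ext (hb.1 (congrArg Subtype.val hxy))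
  · rintro ⟨y, hy⟩
    obtain ⟨x, rfl⟩ := hb.2 y
    refine ⟨⟨x, ?_⟩, rfl⟩
    have hc : (Unitization.fstHom ℂ A : Unitization ℂ A →+* ℂ).comp (unitMap f) =
        (Unitization.fstHom ℂ V : Unitization ℂ V →+* ℂ) := by
      ext x
      exact unitMap_fst f x
    have hy' : K0Ring.map _ (K0Ring.map _ x) = 0 := hy
    rw [K0Ring.map_map, hc] at hy'
    exact hy'

end IsDenseSmooth
end DenseSmooth
end KTheory

/-! ### Dense smooth subalgebras: components of the general linear groups and K₁ -/

namespace KTheory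

open Filter Topology
open scoped Matrix

section StableComponent

variable {A : Type*} [NonUnitalRing A] [Module ℂ A] [IsScalarTower ℂ A A] [SMulCommClass ℂ A A]
  [TopologicalSpace A] [IsTopologicalRing A] [ContinuousSMul ℂ A]

theorem GLn.continuous_stab {m n : ℕ} (h : m ≤ n) :
    Continuous (GLn.stab (Unitization ℂ A) m n h) := by
  refine Continuous.units_map _ ?_
  change Continuous fun M : Matrix (Fin m) (Fin m) (Unitization ℂ A) =>
    1 + incl (Unitization ℂ A) h * (M - 1) * (incl (Unitization ℂ A) h)ᵀ
  fun_prop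

theorem GLn.stab_mem_component {m n : ℕ} (h : m ≤ n) {u : GLn (Unitization ℂ A) m}
    (hu : u ∈ connectedComponent (1 : GLn (Unitization ℂ A) m)) :
    GLn.stab (Unitization ℂ A) m n h u ∈ connectedComponent (1 : GLn (Unitization ℂ A) n) := by
  have h1 := (GLn.continuous_stab (A := A) h).image_connectedComponent_subset 1
  rw [map_one] at h1
  exact h1 ⟨u, hu, rfl⟩

variable (A) in
/-- The union of the images in `GL_∞(A⁺)` of the components of `1` in the groups `GL_n(A⁺)`. -/
noncomputable def GLInf.component : Subgroup (GLInf (Unitization ℂ A)) where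
  carrier := {x | ∃ (n : ℕ) (u : GLn (Unitization ℂ A) n),
    u ∈ Subgroup.connectedComponentOfOne (GLn (Unitization ℂ A) n) ∧
      x = GLInf.of (Unitization ℂ A) n u}
  one_mem' := ⟨0, 1, one_mem _, (map_one _).symm⟩
  mul_mem' := by
    rintro _ _ ⟨m, u, hu, rfl⟩ ⟨n, v, hv, rfl⟩
    refine ⟨max m n, _, mul_mem (GLn.stab_mem_component (le_max_left m n) hu)
      (GLn.stab_mem_component (le_max_right m n) hv), ?_⟩
    rw [map_mul, GLInf.of_stab, GLInf.of_stab]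
  inv_mem' := by
    rintro _ ⟨m, u, hu, rfl⟩
    exact ⟨m, u⁻¹, inv_mem hu, (map_inv _ _).symm⟩

instance : (GLInf.component A).Normal where
  conj_mem := by
    rintro _ ⟨m, u, hu, rfl⟩ g
    obtain ⟨n, v, rfl⟩ := GLInf.exists_eq_of g
    set k := max m n
    refine ⟨k, GLn.stab _ n k (le_max_right m n) v * GLn.stab _ m k (le_max_left m n) u *
      (GLn.stab _ n k (le_max_right m n) v)⁻¹, ?_, ?_⟩
    · have h1 := (IsTopologicalGroup.continuous_conj
        (GLn.stab (Unitization ℂ A) n k (le_max_right m n) v)).image_connectedComponent_subset 1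
      rw [mul_one, mul_inv_cancel] at h1
      exact h1 ⟨_, GLn.stab_mem_component (le_max_left m n) hu, rfl⟩
    · rw [map_mul, map_mul, map_inv, GLInf.of_stab, GLInf.of_stab]

/-- A path is a connected set, so its endpoint lies in the connected component of 1. The union of
these components is a normal subgroup. Connected components are easier to handle than paths here,
and this one inclusion is enough for injectivity on K₁. -/
theorem GLInf.normalClosure_le_component :
    Subgroup.normalClosure (GLInf.homotopicToOne A) ≤ GLInf.component A := by
  refine Subgroup.normalClosure_le_normal ?_
  rintro _ ⟨n, u, ⟨γ, h0, h1, hc, hc'⟩, rfl⟩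
  refine ⟨n, u, ?_, rfl⟩
  have hγ : Continuous γ :=
    Units.continuous_iff.mpr ⟨continuousMatrix_iff.mp hc, continuousMatrix_iff.mp hc'⟩
  have h2 : IsPreconnected (Set.range γ) := isPreconnected_range hγ
  exact h2.subset_connectedComponent ⟨0, h0⟩ ⟨1, h1⟩

end StableComponent

section DenseSmooth

variable {V A : Type*} [NonUnitalRing V] [Module ℂ V] [IsScalarTower ℂ V V] [SMulCommClass ℂ V V]
  [TopologicalSpace V]
  [NonUnitalRing A] [Module ℂ A] [IsScalarTower ℂ A A] [SMulCommClass ℂ A A]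
  [TopologicalSpace A] [IsTopologicalRing A] [ContinuousSMul ℂ A]

variable (V) in
/-- The canonical homomorphism `GL_n(V⁺) → K₁(V)`. -/
noncomputable def K1.of (n : ℕ) : GLn (Unitization ℂ V) n →* K1 V :=
  (QuotientGroup.mk' _).comp (GLInf.of (Unitization ℂ V) n)

theorem K1.of_eq_one {n : ℕ} {u : GLn (Unitization ℂ V) n} (hu : u.IsHomotopicToOne) :
    K1.of V n u = 1 :=
  (QuotientGroup.eq_one_iff _).mpr (Subgroup.subset_normalClosure ⟨n, u, hu, rfl⟩)

namespace IsDenseSmooth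

variable {f : V →ₙₐ[ℂ] A} {νV : V → ℝ} {QV : ℕ → Set (V → ℝ)} {νA : A → ℝ} {QA : ℕ → Set (A → ℝ)}
  (h : IsDenseSmooth f νV QV νA QA)

include h

theorem isOpen_matNorm_lt {d : ℕ} (u : Matrix (Fin d) (Fin d) (Unitization ℂ A)) :
    IsOpen {M | matNorm (uNorm νA) (1 - u * M) < 1} :=
  isOpen_Iio.preimage ((continuous_matNorm h.continuous_norm).comp
    (by fun_prop : Continuous fun M => 1 - u * M))

theorem matNorm_one_sub_self {d : ℕ} (u : GLn (Unitization ℂ A) d) :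
    matNorm (uNorm νA) (1 - u⁻¹.val * u.val) < 1 := by
  rw [Units.inv_mul, sub_self]
  simp [matNorm, h.smooth'.isRingSeminorm_norm.zero]

/-- Elements of `GL_n(V⁺)` that are trivial in `K₁(V)` are dense in the component of `1`. -/
theorem component_subset (d : ℕ) {w : GLn (Unitization ℂ A) d}
    (hw : w ∈ connectedComponent (1 : GLn (Unitization ℂ A) d)) :
    w.val ∈ closure {M | ∃ u : GLn (Unitization ℂ V) d, K1.of V d u = 1 ∧
      M = u.val.map (unitMap f)} := by
  -- The units of A⁺ in the closure of this monoid form a clopen set. The set is open because the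
  -- closure is a monoid that contains the unit ball around 1, so with v it contains all v(v⁻¹v')
  -- for v' near v. A clopen set that contains 1 contains its component.
  let S : Submonoid (Matrix (Fin d) (Fin d) (Unitization ℂ A)) :=
    { carrier := {M | ∃ u : GLn (Unitization ℂ V) d, K1.of V d u = 1 ∧ M = u.val.map (unitMap f)}
      one_mem' := ⟨1, map_one _, (Matrix.map_one _ (map_zero _) (map_one _)).symm⟩
      mul_mem' := by
        rintro _ _ ⟨u, hu, rfl⟩ ⟨v, hv, rfl⟩
        exact ⟨u * v, by rw [map_mul, hu, hv, one_mul], Matrix.map_mul.symm⟩ }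
  -- Approximants over V that stay in the open ball are homotopic to 1 over V, hence trivial in
  -- K₁(V).
  have hW : ∀ M, matNorm (uNorm νA) (1 - M) < 1 → M ∈ S.topologicalClosure := by
    intro M hM
    change M ∈ closure (S : Set _)
    rw [mem_closure_iff]
    intro U hU hMU
    have hO := h.isOpen_matNorm_lt (d := d) 1
    simp only [one_mul] at hO
    obtain ⟨x, hxU, hx⟩ := h.exists_map_mem (hU.inter hO) (x := M) ⟨hMU, hM⟩
    have e : 1 - x.map (unitMap f) = (1 - x).map (unitMap f) := by
      rw [Matrix.map_sub _ (map_sub _), Matrix.map_one _ (map_zero _) (map_one _)]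
    rw [Set.mem_ofPred_eq, e, h.matNorm_map] at hx
    obtain ⟨u, hu, hu'⟩ := h.smooth.exists_homotopic x hx
    exact ⟨_, hxU, u, K1.of_eq_one hu', by rw [hu]⟩
  have hclosed : IsClosed {v : GLn (Unitization ℂ A) d | v.val ∈ S.topologicalClosure} :=
    S.isClosed_topologicalClosure.preimage Units.continuous_val
  have hopen : IsOpen {v : GLn (Unitization ℂ A) d | v.val ∈ S.topologicalClosure} := by
    rw [isOpen_iff_mem_nhds]
    intro v hv
    have h1 := ((h.isOpen_matNorm_lt v⁻¹.val).preimage Units.continuous_val).mem_nhds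
      (h.matNorm_one_sub_self v)
    filter_upwards [h1] with v' hv'
    have e : v'.val = v.val * (v⁻¹.val * v'.val) := by
      rw [← mul_assoc, Units.mul_inv, one_mul]
    rw [e]
    exact mul_mem hv (hW _ hv')
  have hsub := isPreconnected_connectedComponent.subset_isClopen ⟨hclosed, hopen⟩
    ⟨1, mem_connectedComponent, one_mem S.topologicalClosure⟩
  exact hsub hw

/-- The inclusion of a dense smooth subalgebra induces an isomorphism on `K₁`. -/
theorem K1_map_bijective : Function.Bijective (K1.map f h.continuous) := by
  constructor
  · rw [injective_iff_map_eq_one]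
    intro x hx
    obtain ⟨x, rfl⟩ := QuotientGroup.mk_surjective x
    obtain ⟨m, u, rfl⟩ := GLInf.exists_eq_of x
    have hx' : GLInf.of _ m (GLn.map (unitMap f) m u) ∈ GLInf.component A :=
      GLInf.normalClosure_le_component ((QuotientGroup.eq_one_iff _).mp hx)
    obtain ⟨n, w, hw, huw⟩ := hx'
    obtain ⟨k, hm, hn, huw⟩ := GLInf.of_eq_of huw
    have hwk := GLn.stab_mem_component hn hw
    rw [← huw, ← GLn.map_stab] at hwk
    rw [← GLInf.of_stab hm]
    set v := GLn.stab _ m k hm u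
    have hv := h.component_subset k hwk
    set v' := GLn.map (unitMap f) k v
    -- Some y that is trivial in K₁(V) is so close to v that v⁻¹y is homotopic to 1 over V. Hence v
    -- is trivial too.
    obtain ⟨_, hM, y, hy, rfl⟩ := mem_closure_iff.mp hv _ (h.isOpen_matNorm_lt v'⁻¹.val)
      (h.matNorm_one_sub_self v')
    have e : 1 - v'⁻¹.val * y.val.map (unitMap f) = (1 - v⁻¹.val * y.val).map (unitMap f) := by
      rw [Matrix.map_sub _ (map_sub _), Matrix.map_one _ (map_zero _) (map_one _), Matrix.map_mul]
      rfl
    rw [Set.mem_ofPred_eq, e, h.matNorm_map] at hM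
    obtain ⟨z, hz, hz'⟩ := h.smooth.exists_homotopic _ hM
    have ez : z = v⁻¹ * y := Units.ext hz
    have h1 := K1.of_eq_one hz'
    rw [ez, map_mul, hy, mul_one, map_inv, inv_eq_one] at h1
    exact h1
  · intro x
    obtain ⟨x, rfl⟩ := QuotientGroup.mk_surjective x
    obtain ⟨m, u, rfl⟩ := GLInf.exists_eq_of x
    -- The approximant y has image uw with w near 1, so it is a unit over V and has the same class
    -- as u.
    obtain ⟨y, hy⟩ := h.exists_map_mem (h.isOpen_matNorm_lt u⁻¹.val) (h.matNorm_one_sub_self u)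
    obtain ⟨w, hw, hw'⟩ := h.smooth'.exists_homotopic _ hy
    have hyu : y.map (unitMap f) = (u * w).val := by
      rw [Units.val_mul, hw, ← mul_assoc, Units.mul_inv, one_mul]
    obtain ⟨v, hv⟩ := h.isUnit_of_map ⟨u * w, hyu.symm⟩
    refine ⟨K1.of V m v, ?_⟩
    have e : GLn.map (unitMap f) m v = u * w :=
      Units.ext ((congrArg (fun M => M.map (unitMap f)) hv).trans hyu)
    calc K1.map f h.continuous (K1.of V m v) = K1.of A m (GLn.map (unitMap f) m v) := rfl
      _ = K1.of A m u := by rw [e, map_mul, K1.of_eq_one hw', mul_one]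

end IsDenseSmooth
end DenseSmooth
end KTheory

/-! ### Square integrable functions and multiplication operators on L²(G, B) -/

namespace CStarAction

open MeasureTheory
open scoped Pointwise ENNReal CompactlySupported

section Classes

variable {G B : Type*} [Group G] [TopologicalSpace G] [IsTopologicalGroup G]
  [MeasurableSpace G] [BorelSpace G] [NonUnitalCStarAlgebra B]
  {α : CStarAction G B} {μ : Measure G} [IsFiniteMeasureOnCompacts μ]

/-- Two bounded operators that agree on `C_c(G, B)` are equal. -/
theorem ext_toL2 {X Y : L2 α μ →L[ℂ] L2 α μ} (h : ∀ w, X (toL2 α μ w) = Y (toL2 α μ w)) :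
    X = Y :=
  ContinuousLinearMap.ext fun x =>
    congrFun ((denseRange_toL2 α μ).equalizer X.continuous Y.continuous (funext h)) x

/-- The action is isometric, so the integrand of ⟨w, w⟩ at g has norm ‖w(g)‖²; the integral of the
norms dominates the norm of the integral. -/
theorem norm_toL2_le_eLpNorm (w : C_c(G, B)) : ENNReal.ofReal ‖toL2 α μ w‖ ≤ eLpNorm w 2 μ := by
  rw [(memLp_cc w).eLpNorm_eq_integral_rpow_norm two_ne_zero ENNReal.ofNat_ne_top]
  refine ENNReal.ofReal_le_ofReal ?_
  rw [norm_toL2, ENNReal.toReal_ofNat, Real.sqrt_eq_rpow, one_div]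
  refine Real.rpow_le_rpow (norm_nonneg _) ?_ (by norm_num)
  refine (norm_integral_le_integral_norm _).trans (le_of_eq ?_)
  congr 1
  ext g
  rw [norm_apply, CStarRing.norm_star_mul_self, ← sq]
  norm_cast

theorem IsClass.neg {f : G → B} {x : L2 α μ} (h : IsClass α μ f x) : IsClass α μ (-f) (-x) := by
  simpa using h.smul (-1 : ℂ)

theorem IsClass.sub {f f' : G → B} {x x' : L2 α μ} (h : IsClass α μ f x) (h' : IsClass α μ f' x') :
    IsClass α μ (f - f') (x - x') := by
  simpa [sub_eq_add_neg] using h.add h'.neg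

theorem IsClass.norm_le {f : G → B} {x : L2 α μ} (h : IsClass α μ f x) :
    ENNReal.ofReal ‖x‖ ≤ eLpNorm f 2 μ := by
  refine ENNReal.le_of_forall_pos_le_add fun ε hε _ => ?_
  obtain ⟨w, h1, h2⟩ := h.2 (ε / 2 : ℝ) (by positivity)
  have h3 : ‖x‖ ≤ ‖toL2 α μ w‖ + (ε / 2 : ℝ) := by
    have := norm_add_le (x - toL2 α μ w) (toL2 α μ w)
    rw [sub_add_cancel] at this
    linarith
  have h4 : eLpNorm w 2 μ ≤ eLpNorm f 2 μ + eLpNorm (fun g => f g - w g) 2 μ := by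
    have e : (w : G → B) = f - (fun g => f g - w g) := by
      ext g
      simp
    conv_lhs => rw [e]
    exact eLpNorm_sub_le h.1.1 (h.1.sub (memLp_cc w)).1 one_le_two
  calc ENNReal.ofReal ‖x‖ ≤ ENNReal.ofReal ‖toL2 α μ w‖ + ENNReal.ofReal (ε / 2 : ℝ) := by
        rw [← ENNReal.ofReal_add (norm_nonneg _) (by positivity)]
        exact ENNReal.ofReal_le_ofReal h3
    _ ≤ eLpNorm f 2 μ + ENNReal.ofReal (ε / 2 : ℝ) + ENNReal.ofReal (ε / 2 : ℝ) := by
        gcongr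
        exact (norm_toL2_le_eLpNorm w).trans (h4.trans (by gcongr))
    _ = eLpNorm f 2 μ + ε := by
        rw [add_assoc, ← ENNReal.ofReal_add (by positivity) (by positivity), add_halves,
          ENNReal.ofReal_coe_nnreal]

theorem IsClass.unique {f : G → B} {x y : L2 α μ} (h : IsClass α μ f x) (h' : IsClass α μ f y) :
    x = y := by
  have h1 := (h.sub h').norm_le
  rw [sub_self, eLpNorm_zero, nonpos_iff_eq_zero, ENNReal.ofReal_eq_zero] at h1
  exact sub_eq_zero.mp (norm_eq_zero.mp (le_antisymm h1 (norm_nonneg _)))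

variable (α μ) in
theorem isClass_toL2 (w : C_c(G, B)) : IsClass α μ w (toL2 α μ w) :=
  ⟨memLp_cc w, fun ε hε => ⟨w, by simp [hε], by simpa using hε⟩⟩

/-- The classes of square integrable functions form a closed relation. -/
theorem IsClass.of_forall_approx {f : G → B} {x : L2 α μ} (hf : MemLp f 2 μ)
    (h : ∀ ε : ℝ, 0 < ε → ∃ f' x', IsClass α μ f' x' ∧
      eLpNorm (f - f') 2 μ < ENNReal.ofReal ε ∧ ‖x - x'‖ < ε) : IsClass α μ f x := by
  refine ⟨hf, fun ε hε => ?_⟩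
  obtain ⟨f', x', h1, h2, h3⟩ := h (ε / 2) (by positivity)
  obtain ⟨w, h4, h5⟩ := h1.2 (ε / 2) (by positivity)
  refine ⟨w, ?_, ?_⟩
  · have e : (fun g => f g - w g) = (f - f') + (fun g => f' g - w g) := by
      ext g
      simp
    rw [e]
    refine (eLpNorm_add_le (hf.sub h1.1).1 (h1.1.sub (memLp_cc w)).1 one_le_two).trans_lt ?_
    refine (ENNReal.add_lt_add h2 h4).trans_eq ?_
    rw [← ENNReal.ofReal_add (by positivity) (by positivity), add_halves]
  · have := norm_add_le (x - x') (x' - toL2 α μ w)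
    rw [sub_add_sub_cancel] at this
    linarith

variable [LocallyCompactSpace G] [μ.Regular]

omit [IsTopologicalGroup G] [Group G] [IsFiniteMeasureOnCompacts μ] in
/-- In a locally compact space that need not be normal, square integrable functions are
approximated by continuous functions with compact support. -/
theorem exists_cc_eLpNorm_sub_lt [R1Space G] {E : Type*} [NormedAddCommGroup E] [NormedSpace ℝ E]
    {f : G → E} (hf : MemLp f 2 μ) {ε : ℝ} (hε : 0 < ε) :
    ∃ w : C_c(G, E), eLpNorm (fun g => f g - w g) 2 μ < ENNReal.ofReal ε := by
  have key : ∃ g : G → E, eLpNorm (f - g) 2 μ ≤ ENNReal.ofReal (ε / 2) ∧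
      (Continuous g ∧ MemLp g 2 μ ∧ HasCompactSupport g) := by
    refine hf.induction_dense ENNReal.ofNat_ne_top _ ?_ ?_ ?_ (by simpa using hε)
    · intro c t ht htμ δ hδ
      obtain ⟨η, η0, hη⟩ := exists_eLpNorm_indicator_le (μ := μ) (p := 2) ENNReal.ofNat_ne_top c hδ
      have η0' : ((η / 2 : NNReal) : ℝ≥0∞) ≠ 0 := by simpa using η0.ne'
      -- The indicator of t is approximated through a compact s inside t and an open V around s, not
      -- around t. A bump function that is 1 on s and 0 off V differs from the indicator only on V \
      -- s ∪ t \ s.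
      obtain ⟨s, st, sc, scl, hs⟩ := ht.exists_isCompact_isClosed_sdiff_lt htμ.ne η0'
      obtain ⟨V, sV, hV, -, hVs⟩ := scl.measurableSet.exists_isOpen_sdiff_lt
        ((measure_mono st).trans_lt htμ).ne η0'
      obtain ⟨φ, h1, h0, hc, h01⟩ := exists_continuous_one_zero_of_isCompact sc
        hV.isClosed_compl (Set.disjoint_compl_right_iff_subset.mpr sV)
      have hcs : HasCompactSupport (fun x => φ x • c) := hc.smul_right
      have hcont : Continuous (fun x => φ x • c) := φ.continuous.smul continuous_const
      refine ⟨fun x => φ x • c, ?_, hcont, hcont.memLp_of_hasCompactSupport hcs, hcs⟩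
      refine (eLpNorm_mono fun x => ?_).trans (hη (V \ s ∪ t \ s) ?_)
      · by_cases hxs : x ∈ s
        · simp [h1 hxs, st hxs]
        · have hb : ‖φ x • c - t.indicator (fun _ => c) x‖ ≤ ‖c‖ := by
            obtain ⟨ha, hb⟩ := h01 x
            by_cases hxt : x ∈ t
            · rw [Set.indicator_of_mem hxt, show φ x • c - c = (φ x - 1) • c by
                rw [sub_smul, one_smul], norm_smul, Real.norm_eq_abs,
                abs_of_nonpos (by linarith)]
              exact mul_le_of_le_one_left (norm_nonneg _) (by linarith)
            · rw [Set.indicator_of_notMem hxt, sub_zero, norm_smul, Real.norm_of_nonneg ha]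
              exact mul_le_of_le_one_left (norm_nonneg _) hb
          by_cases hx : x ∈ V \ s ∪ t \ s
          · rwa [Set.indicator_of_mem hx]
          · have hxV : x ∉ V := fun h => hx (Or.inl ⟨h, hxs⟩)
            have hxt : x ∉ t := fun h => hx (Or.inr ⟨h, hxs⟩)
            simp [hxt, h0 hxV]
      · refine (measure_union_le _ _).trans ((add_le_add hVs.le hs.le).trans_eq ?_)
        rw [← ENNReal.coe_add, add_halves]
    · rintro g g' ⟨h1, h2, h3⟩ ⟨h1', h2', h3'⟩
      exact ⟨h1.add h1', h2.add h2', h3.add h3'⟩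
    · rintro g ⟨-, h, -⟩
      exact h.1
  obtain ⟨w, h2, h3, -, h1⟩ := key
  exact ⟨⟨⟨w, h3⟩, h1⟩, h2.trans_lt ((ENNReal.ofReal_lt_ofReal_iff hε).mpr (by linarith))⟩

variable (α) in
/-- Each square integrable function has a class in `L²(G, B)`. -/
theorem exists_isClass {f : G → B} (hf : MemLp f 2 μ) : ∃ x, IsClass α μ f x := by
  have h1 : ∀ n : ℕ, ∃ w : C_c(G, B),
      eLpNorm (fun g => f g - w g) 2 μ < ENNReal.ofReal ((1 / 2) ^ n) :=
    fun n => exists_cc_eLpNorm_sub_lt hf (by positivity)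
  choose w hw using h1
  -- The square integral norm dominates the module norm, so the approximants of f are Cauchy in
  -- L²(G, B).
  have h2 : ∀ m n, m ≤ n → ‖toL2 α μ (w m) - toL2 α μ (w n)‖ ≤ 2 * (1 / 2) ^ m := by
    intro m n hmn
    have h3 := ((isClass_toL2 α μ (w m)).sub (isClass_toL2 α μ (w n))).norm_le
    have e : ((w m : G → B) - w n) = (fun g => f g - w n g) - (fun g => f g - w m g) := by
      ext g
      simp
    rw [e] at h3
    have h4 := h3.trans (eLpNorm_sub_le (hf.sub (memLp_cc (w n))).1 (hf.sub (memLp_cc (w m))).1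
      one_le_two)
    have h5 := h4.trans (add_le_add (hw n).le (hw m).le)
    rw [← ENNReal.ofReal_add (by positivity) (by positivity),
      ENNReal.ofReal_le_ofReal_iff (by positivity)] at h5
    have h6 : ((1 : ℝ) / 2) ^ n ≤ (1 / 2) ^ m :=
      pow_le_pow_of_le_one (by norm_num) (by norm_num) hmn
    linarith
  have ht : Filter.Tendsto (fun m : ℕ => 2 * ((1 : ℝ) / 2) ^ m) Filter.atTop (nhds 0) := by
    simpa using (tendsto_pow_atTop_nhds_zero_of_lt_one (r := ((1 : ℝ) / 2)) (by norm_num)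
      (by norm_num)).const_mul 2
  have hc : CauchySeq (fun n => toL2 α μ (w n)) := by
    refine cauchySeq_of_le_tendsto_0 _ (fun m n N hm hn => ?_)
      (by simpa using ht.add ht : Filter.Tendsto
        (fun N : ℕ => 2 * ((1 : ℝ) / 2) ^ N + 2 * (1 / 2) ^ N) Filter.atTop (nhds 0))
    refine (dist_triangle_left _ _ (toL2 α μ (w N))).trans ?_
    rw [dist_eq_norm, dist_eq_norm]
    exact add_le_add (h2 N m hm) (h2 N n hn)
  obtain ⟨x, hx⟩ := cauchySeq_tendsto_of_complete hc
  refine ⟨x, IsClass.of_forall_approx hf fun ε hε => ?_⟩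
  have h7 := (tendsto_pow_atTop_nhds_zero_of_lt_one (r := ((1 : ℝ) / 2)) (by norm_num)
      (by norm_num)).eventually_lt_const hε
  have h8 := (tendsto_iff_norm_sub_tendsto_zero.mp hx).eventually_lt_const hε
  obtain ⟨n, h9, h10⟩ := (h7.and h8).exists
  refine ⟨w n, _, isClass_toL2 α μ (w n), (hw n).trans ((ENNReal.ofReal_lt_ofReal_iff hε).mpr h9),
    ?_⟩
  rwa [norm_sub_rev]

end Classes

section Multiplication

variable {G B : Type*} [Group G] [TopologicalSpace G] [IsTopologicalGroup G]
  [MeasurableSpace G] [BorelSpace G] [NonUnitalCStarAlgebra B]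
  {α : CStarAction G B} {μ : Measure G} [IsFiniteMeasureOnCompacts μ]

attribute [local instance] CStarAlgebra.spectralOrder CStarAlgebra.spectralOrderedRing

/-- The pointwise product of a continuous function and an element of `C_c(G, B)`. -/
noncomputable def ccMul (ψ : C(G, ℝ)) (w : C_c(G, B)) : C_c(G, B) where
  toFun g := ψ g • w g
  continuous_toFun := ψ.continuous.smul (map_continuous w)
  hasCompactSupport' := w.hasCompactSupport.smul_left

theorem ccMul_apply (ψ : C(G, ℝ)) (w : C_c(G, B)) (g : G) : ccMul ψ w g = ψ g • w g := rfl

theorem map_real_smul (g : G) (r : ℝ) (b : B) : α g (r • b) = r • α g b := by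
  rw [← Complex.coe_smul, map_smul, Complex.coe_smul]

/-- The module norm is not an integral of pointwise norms, so the bound comes from the order of B:
⟨ψw, ψw⟩ ≤ C²⟨w, w⟩ because the integrands are positive. -/
theorem norm_toL2_ccMul_le {ψ : C(G, ℝ)} {C : ℝ} (hC : ∀ g, |ψ g| ≤ C) (w : C_c(G, B)) :
    ‖toL2 α μ (ccMul ψ w)‖ ≤ C * ‖toL2 α μ w‖ := by
  have hC0 : 0 ≤ C := (abs_nonneg _).trans (hC 1)
  have h0 : (0 : B) ≤ inner α μ (ccMul ψ w) (ccMul ψ w) := by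
    refine integral_nonneg fun t => ?_
    simp only [map_mul, map_star]
    exact star_mul_self_nonneg _
  have h : inner α μ (ccMul ψ w) (ccMul ψ w) ≤ C ^ 2 • inner α μ w w := by
    rw [inner, inner, ← integral_smul]
    refine integral_mono (integrable_inner α μ _ _) ((integrable_inner α μ w w).smul (C ^ 2))
      fun t => ?_
    have e : α t⁻¹ (star (ccMul ψ w t) * ccMul ψ w t) =
        (ψ t) ^ 2 • α t⁻¹ (star (w t) * w t) := by
      rw [ccMul_apply, star_smul, star_trivial, smul_mul_smul_comm, ← sq, map_real_smul]
    change α t⁻¹ (star (ccMul ψ w t) * ccMul ψ w t) ≤ C ^ 2 • α t⁻¹ (star (w t) * w t)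
    rw [e]
    refine smul_le_smul_of_nonneg_right (sq_le_sq' (abs_le.mp (hC t)).1 (abs_le.mp (hC t)).2) ?_
    simp only [map_mul, map_star]
    exact star_mul_self_nonneg _
  have h2 := CStarAlgebra.norm_le_norm_of_nonneg_of_le h0 h
  rw [norm_smul, norm_pow, Real.norm_of_nonneg hC0] at h2
  rw [norm_toL2, norm_toL2]
  calc _ ≤ √(C ^ 2 * ‖inner α μ w w‖) := Real.sqrt_le_sqrt h2
    _ = _ := by rw [Real.sqrt_mul (by positivity), Real.sqrt_sq hC0]

/-- Bounded Borel functions. -/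
def BoundedBorel (φ : G → ℝ) : Prop := Measurable φ ∧ ∃ C, ∀ g, |φ g| ≤ C

theorem BoundedBorel.mul {φ ψ : G → ℝ} (hφ : BoundedBorel φ) (hψ : BoundedBorel ψ) :
    BoundedBorel (fun g => φ g * ψ g) := by
  obtain ⟨h1, C, hC⟩ := hφ
  obtain ⟨h2, D, hD⟩ := hψ
  refine ⟨h1.mul h2, C * D, fun g => ?_⟩
  rw [abs_mul]
  exact mul_le_mul (hC g) (hD g) (abs_nonneg _) ((abs_nonneg _).trans (hC g))

theorem BoundedBorel.memLp {E : Type*} [NormedAddCommGroup E] [NormedSpace ℝ E] {φ : G → ℝ}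
    (hφ : BoundedBorel φ) {f : G → E} (hf : MemLp f 2 μ) : MemLp (fun g => φ g • f g) 2 μ := by
  obtain ⟨h1, C, hC⟩ := hφ
  refine hf.of_le_mul (c := C) (h1.aestronglyMeasurable.smul hf.1) (.of_forall fun g => ?_)
  rw [norm_smul]
  exact mul_le_mul_of_nonneg_right (hC g) (norm_nonneg _)

variable [LocallyCompactSpace G] [μ.Regular]

/-- The square integral norm only bounds the module norm from above, so it cannot give an estimate
by ‖w‖ directly. Instead φ is approximated on the support of w by a continuous ψ with the same bound
C, for which the estimate is known. -/
theorem norm_le_of_isClass_mul {φ : G → ℝ} (hφ : Measurable φ) {C : ℝ} (hC : ∀ g, |φ g| ≤ C)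
    {w : C_c(G, B)} {y : L2 α μ} (hy : IsClass α μ (fun g => φ g • w g) y) :
    ‖y‖ ≤ C * ‖toL2 α μ w‖ := by
  obtain ⟨M, hM⟩ := (map_continuous w).norm.bounded_above_of_compact_support
    w.hasCompactSupport.norm
  have hM : ∀ g, ‖w g‖ ≤ M := fun g => by simpa using hM g
  have hM0 : 0 ≤ M := (norm_nonneg _).trans (hM 1)
  have hC0 : 0 ≤ C := (abs_nonneg _).trans (hC 1)
  have hK : MeasurableSet (tsupport w) := (isClosed_tsupport _).measurableSet
  have hφK : MemLp ((tsupport w).indicator φ) 2 μ := by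
    have h1 : MemLp ((tsupport w).indicator fun _ => (1 : ℝ)) 2 μ :=
      memLp_indicator_const 2 hK 1 (Or.inr w.hasCompactSupport.isCompact.measure_lt_top.ne)
    have h2 := BoundedBorel.memLp ⟨hφ, C, hC⟩ h1
    refine (memLp_congr_ae (.of_forall fun g => ?_)).mp h2
    by_cases hg : g ∈ tsupport w <;> simp [hg]
  refine le_of_forall_pos_le_add fun ε hε => ?_
  obtain ⟨ψ₀, hψ₀⟩ := exists_cc_eLpNorm_sub_lt hφK (ε := ε / (M + 1)) (by positivity)
  -- Clamping to [-C, C] gives the uniform bound and, by `hcl`, does not increase the distance to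
  -- values that already lie in this interval.
  let ψ : C(G, ℝ) := ⟨fun g => max (-C) (min C (ψ₀ g)),
    continuous_const.max (continuous_const.min (map_continuous ψ₀))⟩
  have hψC : ∀ g, |ψ g| ≤ C := fun g => abs_le.mpr
    ⟨le_max_left _ _, max_le (by linarith) (min_le_left _ _)⟩
  have hcl : ∀ a b : ℝ, |a| ≤ C → |a - max (-C) (min C b)| ≤ |a - b| := by
    intro a b ha
    obtain ⟨h1, h2⟩ := abs_le.mp ha
    rcases le_total C b with h3 | h3
    · rw [min_eq_left h3, max_eq_right (by linarith), abs_sub_comm, abs_of_nonneg (by linarith),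
        abs_sub_comm, abs_of_nonneg (by linarith)]
      linarith
    · rw [min_eq_right h3]
      rcases le_total (-C) b with h4 | h4
      · rw [max_eq_right h4]
      · rw [max_eq_left h4, abs_of_nonneg (by linarith), abs_of_nonneg (by linarith)]
        linarith
  have h1 : ENNReal.ofReal ‖y - toL2 α μ (ccMul ψ w)‖ ≤ ENNReal.ofReal ε := by
    refine (hy.sub (isClass_toL2 α μ _)).norm_le.trans ?_
    have h2 := eLpNorm_le_mul_eLpNorm_of_ae_le_mul (μ := μ) (c := M)
      (f := (fun g => φ g • w g) - (ccMul ψ w : G → B))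
      (g := fun g => (tsupport w).indicator φ g - ψ₀ g)
      (.of_forall fun g => ?_) 2
    · refine h2.trans ((mul_le_mul_right hψ₀.le _).trans ?_)
      rw [← ENNReal.ofReal_mul hM0]
      refine ENNReal.ofReal_le_ofReal ?_
      rw [← mul_div_assoc, div_le_iff₀ (by positivity)]
      nlinarith
    · rw [Pi.sub_apply, ccMul_apply, ← sub_smul, norm_smul]
      by_cases hg : g ∈ tsupport w
      · rw [Set.indicator_of_mem hg, mul_comm]
        exact mul_le_mul (hM g) (hcl _ _ (hC g)) (norm_nonneg _) hM0
      · rw [image_eq_zero_of_notMem_tsupport hg, norm_zero, mul_zero]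
        positivity
  rw [ENNReal.ofReal_le_ofReal_iff hε.le] at h1
  have h2 := norm_add_le (y - toL2 α μ (ccMul ψ w)) (toL2 α μ (ccMul ψ w))
  rw [sub_add_cancel] at h2
  have h3 := norm_toL2_ccMul_le (α := α) (μ := μ) hψC w
  linarith

variable (α μ) in
/-- Pointwise multiplication by a bounded Borel function, on `C_c(G, B)`. -/
noncomputable def mulLin {φ : G → ℝ} (hφ : BoundedBorel φ) : C_c(G, B) →ₗ[ℂ] L2 α μ where
  toFun w := (exists_isClass α (hφ.memLp (memLp_cc (μ := μ) w))).choose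
  map_add' w w' := by
    refine (exists_isClass α (hφ.memLp (memLp_cc (μ := μ) (w + w')))).choose_spec.unique ?_
    convert (exists_isClass α (hφ.memLp (memLp_cc (μ := μ) w))).choose_spec.add
      (exists_isClass α (hφ.memLp (memLp_cc (μ := μ) w'))).choose_spec using 1
    ext g
    simp
  map_smul' c w := by
    refine (exists_isClass α (hφ.memLp (memLp_cc (μ := μ) (c • w)))).choose_spec.unique ?_
    convert (exists_isClass α (hφ.memLp (memLp_cc (μ := μ) w))).choose_spec.smul c using 1
    ext g
    · simp [smul_comm c]
    · rfl

theorem isClass_mulLin {φ : G → ℝ} (hφ : BoundedBorel φ) (w : C_c(G, B)) :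
    IsClass α μ (fun g => φ g • w g) (mulLin α μ hφ w) :=
  (exists_isClass α (hφ.memLp (memLp_cc (μ := μ) w))).choose_spec

variable (α μ) in
/-- Pointwise multiplication by a bounded Borel function, on `L²(G, B)`. -/
noncomputable def mulOp {φ : G → ℝ} (hφ : BoundedBorel φ) : L2 α μ →L[ℂ] L2 α μ :=
  (mulLin α μ hφ).extendOfNorm (toL2 α μ)

theorem mulOp_toL2 {φ : G → ℝ} (hφ : BoundedBorel φ) (w : C_c(G, B)) :
    mulOp α μ hφ (toL2 α μ w) = mulLin α μ hφ w := by
  obtain ⟨h1, C, hC⟩ := hφ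
  exact LinearMap.extendOfNorm_eq (denseRange_toL2 α μ)
    ⟨C, fun w => norm_le_of_isClass_mul h1 hC (isClass_mulLin _ w)⟩ w

theorem norm_mulOp_le {φ : G → ℝ} (hφ : BoundedBorel φ) {C : ℝ} (hC : ∀ g, |φ g| ≤ C)
    (x : L2 α μ) : ‖mulOp α μ hφ x‖ ≤ C * ‖x‖ :=
  LinearMap.norm_extendOfNorm_apply_le (denseRange_toL2 α μ) C
    (fun w => norm_le_of_isClass_mul hφ.1 hC (isClass_mulLin _ w)) x

theorem IsClass.mulOp {φ : G → ℝ} (hφ : BoundedBorel φ) {f : G → B} {x : L2 α μ}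
    (h : IsClass α μ f x) : IsClass α μ (fun g => φ g • f g) (mulOp α μ hφ x) := by
  obtain ⟨C, hC⟩ := hφ.2
  have hC0 : 0 ≤ C := (abs_nonneg _).trans (hC 1)
  refine IsClass.of_forall_approx (hφ.memLp h.1) fun ε hε => ?_
  have hlt : C * (ε / (C + 1)) < ε := by
    rw [← mul_div_assoc, div_lt_iff₀ (by positivity)]
    nlinarith
  obtain ⟨w, h1, h2⟩ := h.2 (ε / (C + 1)) (by positivity)
  refine ⟨_, _, isClass_mulLin hφ w, ?_, ?_⟩
  · have h3 := eLpNorm_le_mul_eLpNorm_of_ae_le_mul (μ := μ) (c := C)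
      (f := (fun g => φ g • f g) - (fun g => φ g • w g)) (g := fun g => f g - w g)
      (.of_forall fun g => ?_) 2
    · refine h3.trans_lt ((mul_le_mul_right h1.le _).trans_lt ?_)
      rw [← ENNReal.ofReal_mul hC0]
      exact (ENNReal.ofReal_lt_ofReal_iff hε).mpr hlt
    · rw [Pi.sub_apply, ← smul_sub, norm_smul]
      exact mul_le_mul_of_nonneg_right (hC g) (norm_nonneg _)
  · rw [← mulOp_toL2, ← map_sub]
    exact (norm_mulOp_le hφ hC _).trans_lt ((mul_le_mul_of_nonneg_left h2.le hC0).trans_lt hlt)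

theorem mulOp_mulOp {φ ψ χ : G → ℝ} (hφ : BoundedBorel φ) (hψ : BoundedBorel ψ)
    (hχ : BoundedBorel χ) (h : ∀ g, φ g * ψ g = χ g) :
    mulOp α μ hφ * mulOp α μ hψ = mulOp α μ hχ := by
  refine ext_toL2 fun w => ?_
  have h1 := ((isClass_toL2 α μ w).mulOp hψ).mulOp hφ
  simp only [smul_smul, h] at h1
  exact h1.unique ((isClass_toL2 α μ w).mulOp hχ)

theorem mulOp_comm {φ ψ : G → ℝ} (hφ : BoundedBorel φ) (hψ : BoundedBorel ψ) :
    mulOp α μ hφ * mulOp α μ hψ = mulOp α μ hψ * mulOp α μ hφ := by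
  rw [mulOp_mulOp hφ hψ (hφ.mul hψ) fun _ => rfl,
    mulOp_mulOp hψ hφ (hφ.mul hψ) fun _ => mul_comm _ _]

theorem mulOp_toL2_of_continuous {φ : G → ℝ} (hφ : BoundedBorel φ) (hc : Continuous φ)
    (w : C_c(G, B)) : mulOp α μ hφ (toL2 α μ w) = toL2 α μ (ccMul ⟨φ, hc⟩ w) :=
  ((isClass_toL2 α μ w).mulOp hφ).unique (isClass_toL2 α μ (ccMul ⟨φ, hc⟩ w))

end Multiplication
end CStarAction

/-! ### Local boundedness of length functions and the graph of σ -/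

namespace CStarAction

open MeasureTheory Filter Topology
open scoped Pointwise ENNReal CompactlySupported

section LengthFunction

variable {G : Type*} [Group G] [TopologicalSpace G] [IsTopologicalGroup G]
  [MeasurableSpace G] [BorelSpace G] [LocallyCompactSpace G]

/-- A Borel measurable length function is bounded near the unit. -/
theorem exists_nhds_one_bound (μ : Measure G) [μ.IsHaarMeasure] [μ.Regular] (ℓ : GroupSeminorm G)
    (hℓ : Measurable ℓ) : ∃ U ∈ 𝓝 (1 : G), ∃ C, ∀ g ∈ U, ℓ g ≤ C := by
  obtain ⟨K₀, hK₀, hK₀1⟩ := exists_compact_mem_nhds (1 : G)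
  obtain ⟨K, hK, hKc, hK1⟩ : ∃ K : Set G, IsCompact K ∧ IsClosed K ∧ K ∈ 𝓝 1 :=
    ⟨closure K₀, hK₀.closure, isClosed_closure, mem_of_superset hK₀1 subset_closure⟩
  have hm : ∀ n : ℕ, MeasurableSet (K ∩ {g | ℓ g ≤ n}) := fun n =>
    hKc.measurableSet.inter (measurableSet_le hℓ measurable_const)
  -- Steinhaus' argument: the sublevel sets exhaust K, so one of them meets K in a set E of positive
  -- finite measure. Then E/E is a neighbourhood of 1 on which ℓ ≤ 2n.
  have hpos : ∃ n : ℕ, 0 < μ (K ∩ {g | ℓ g ≤ n}) := by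
    by_contra! h
    have h1 : μ (⋃ n : ℕ, K ∩ {g | ℓ g ≤ n}) = 0 :=
      measure_iUnion_null fun n => nonpos_iff_eq_zero.mp (h n)
    have h2 : K ⊆ ⋃ n : ℕ, K ∩ {g | ℓ g ≤ n} := fun g hg => by
      obtain ⟨n, hn⟩ := exists_nat_ge (ℓ g)
      exact Set.mem_iUnion.mpr ⟨n, hg, hn⟩
    exact (μ.measure_pos_of_mem_nhds hK1).ne' (measure_mono_null h2 h1)
  obtain ⟨n, hn⟩ := hpos
  refine ⟨_, Measure.div_mem_nhds_one_of_haar_pos_ne_top μ _ (hm n) hn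
    ((measure_mono Set.inter_subset_left).trans_lt hK.measure_lt_top).ne, n + n, ?_⟩
  rintro _ ⟨a, ha, b, hb, rfl⟩
  have h1 := map_div_le_add ℓ a b
  have h2 : ℓ a ≤ n := ha.2
  have h3 : ℓ b ≤ n := hb.2
  linarith

/-- A Borel measurable length function is bounded on compact sets. -/
theorem exists_bound_of_isCompact (μ : Measure G) [μ.IsHaarMeasure] [μ.Regular]
    (ℓ : GroupSeminorm G) (hℓ : Measurable ℓ) {K : Set G} (hK : IsCompact K) :
    ∃ C, ∀ g ∈ K, ℓ g ≤ C := by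
  obtain ⟨U, hU, C, hC⟩ := exists_nhds_one_bound μ ℓ hℓ
  refine hK.induction_on (p := fun s => ∃ C, ∀ g ∈ s, ℓ g ≤ C) ⟨0, by simp⟩ ?_ ?_ ?_
  · rintro s t hst ⟨C, hC⟩
    exact ⟨C, fun g hg => hC g (hst hg)⟩
  · rintro s t ⟨C, hC⟩ ⟨D, hD⟩
    refine ⟨max C D, fun g hg => ?_⟩
    rcases hg with hg | hg
    · exact (hC g hg).trans (le_max_left _ _)
    · exact (hD g hg).trans (le_max_right _ _)
  · intro x _
    refine ⟨(x * ·) '' U, mem_nhdsWithin_of_mem_nhds ?_, ℓ x + C, ?_⟩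
    · have := (Homeomorph.mulLeft x).isOpenMap.image_mem_nhds hU
      simpa using this
    · rintro _ ⟨g, hg, rfl⟩
      exact (map_mul_le_add ℓ x g).trans (by gcongr; exact hC g hg)

end LengthFunction

section Graph

variable {G B : Type*} [Group G] [TopologicalSpace G] [IsTopologicalGroup G]
  [MeasurableSpace G] [BorelSpace G] [NonUnitalCStarAlgebra B] [LocallyCompactSpace G]
  {α : CStarAction G B} {μ : Measure G} [IsFiniteMeasureOnCompacts μ] [μ.Regular]
  {ℓ : GroupSeminorm G}

theorem boundedBorel_inv (hℓ : Measurable ℓ) : BoundedBorel (fun g => (1 + ℓ g)⁻¹) := by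
  refine ⟨(measurable_const.add hℓ).inv, 1, fun g => ?_⟩
  have h := apply_nonneg ℓ g
  rw [abs_of_nonneg (by positivity)]
  exact inv_le_one_of_one_le₀ (by linarith)

theorem one_add_pos (ℓ : GroupSeminorm G) (g : G) : 0 < 1 + ℓ g := by
  have := apply_nonneg ℓ g
  linarith

/-- The closed operator σ has a bounded, everywhere defined inverse S, multiplication by (1 + ℓ)⁻¹.
The set of pairs (Sw, w) is closed and contains the generators of the graph; conversely the pairs
with w in C_c(G, B) are generators and are dense in it. Thus statements about σ become identities of
bounded operators. -/
theorem mem_sigmaGraph_iff (hℓ : Measurable ℓ) {v w : L2 α μ} :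
    (v, w) ∈ sigmaGraph α μ ℓ ↔ v = mulOp α μ (boundedBorel_inv hℓ) w := by
  constructor
  · intro h
    refine closure_minimal (t := {p : L2 α μ × L2 α μ |
      p.1 = mulOp α μ (boundedBorel_inv hℓ) p.2}) ?_ ?_ h
    · rintro ⟨x, y⟩ ⟨f, h1, h2⟩
      have h3 := h2.mulOp (boundedBorel_inv hℓ)
      simp only [smul_smul, inv_mul_cancel₀ (one_add_pos ℓ _).ne', one_smul] at h3
      exact h1.unique h3
    · exact isClosed_eq continuous_fst
        ((mulOp α μ (boundedBorel_inv hℓ)).continuous.comp continuous_snd)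
  · rintro rfl
    have hc : Continuous fun u : L2 α μ => (mulOp α μ (boundedBorel_inv hℓ) u, u) :=
      (mulOp α μ (boundedBorel_inv hℓ)).continuous.prodMk continuous_id
    have hcl : IsClosed ((fun u : L2 α μ => (mulOp α μ (boundedBorel_inv hℓ) u, u)) ⁻¹'
        (sigmaGraph α μ ℓ : Set (L2 α μ × L2 α μ))) :=
      (Submodule.isClosed_topologicalClosure _).preimage hc
    have hsub : Set.range (toL2 α μ) ⊆
        (fun u : L2 α μ => (mulOp α μ (boundedBorel_inv hℓ) u, u)) ⁻¹'
        (sigmaGraph α μ ℓ : Set (L2 α μ × L2 α μ)) := by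
      rintro _ ⟨w, rfl⟩
      refine Submodule.le_topologicalClosure _ ⟨fun g => (1 + ℓ g)⁻¹ • w g,
        (isClass_toL2 α μ w).mulOp (boundedBorel_inv hℓ), ?_⟩
      simp only [smul_smul, mul_inv_cancel₀ (one_add_pos ℓ _).ne', one_smul]
      exact isClass_toL2 α μ w
    exact closure_minimal hsub hcl (denseRange_toL2 α μ w)

/-- The domain of σ consists of the vectors v = Sw. For these, the condition that (Av, Aw + Tv) lies
in the graph reads ASw = S(Aw + TSw). -/
theorem isCommutator_iff (hℓ : Measurable ℓ) {A T : L2 α μ →L[ℂ] L2 α μ} :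
    IsCommutator α μ ℓ A T ↔ A * mulOp α μ (boundedBorel_inv hℓ) =
      mulOp α μ (boundedBorel_inv hℓ) * (A + T * mulOp α μ (boundedBorel_inv hℓ)) := by
  constructor
  · intro h
    ext w
    exact (mem_sigmaGraph_iff hℓ).mp (h _ _ ((mem_sigmaGraph_iff hℓ).mpr rfl))
  · intro h v w hvw
    rw [mem_sigmaGraph_iff hℓ] at hvw ⊢
    rw [hvw]
    exact DFunLike.congr_fun h w

/-- D is a closed derivation because σ has a closed graph. Completeness of the smooth algebra rests
on this. -/
theorem IsCommutator.of_tendsto {A T : ℕ → L2 α μ →L[ℂ] L2 α μ} {A₀ T₀ : L2 α μ →L[ℂ] L2 α μ}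
    (h : ∀ k, IsCommutator α μ ℓ (A k) (T k)) (hA : Tendsto A atTop (𝓝 A₀))
    (hT : Tendsto T atTop (𝓝 T₀)) : IsCommutator α μ ℓ A₀ T₀ := by
  intro v w hvw
  have hA' : ∀ x, Tendsto (fun k => A k x) atTop (𝓝 (A₀ x)) := fun x =>
    ((ContinuousLinearMap.apply ℂ (L2 α μ) x).continuous.tendsto A₀).comp hA
  have hT' : ∀ x, Tendsto (fun k => T k x) atTop (𝓝 (T₀ x)) := fun x =>
    ((ContinuousLinearMap.apply ℂ (L2 α μ) x).continuous.tendsto T₀).comp hT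
  exact (Submodule.isClosed_topologicalClosure _).mem_of_tendsto
    ((hA' v).prodMk_nhds ((hA' w).add (hT' v))) (.of_forall fun k => h k v w hvw)

variable [μ.IsHaarMeasure]

theorem boundedBorel_indicator {s : Set G} (hs : MeasurableSet s) {φ : G → ℝ} (hφ : Measurable φ)
    {C : ℝ} (hC : ∀ g ∈ s, |φ g| ≤ C) : BoundedBorel (s.indicator φ) := by
  refine ⟨hφ.indicator hs, max C 0, fun g => ?_⟩
  by_cases hg : g ∈ s
  · rw [Set.indicator_of_mem hg]
    exact (hC g hg).trans (le_max_left _ _)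
  · rw [Set.indicator_of_notMem hg, abs_zero]
    exact le_max_right _ _

/-- The domain of σ contains C_c(G, B): on the support of w the function ℓ is bounded, so w = S(σw)
with σw square integrable. -/
theorem denseRange_mulOp_inv (hℓ : Measurable ℓ) :
    DenseRange (mulOp α μ (boundedBorel_inv hℓ)) := by
  refine (denseRange_toL2 α μ).mono ?_
  rintro _ ⟨w, rfl⟩
  obtain ⟨C, hC⟩ := exists_bound_of_isCompact μ ℓ hℓ w.hasCompactSupport.isCompact
  have hb : BoundedBorel ((tsupport w).indicator fun g => 1 + ℓ g) :=
    boundedBorel_indicator (isClosed_tsupport _).measurableSet (measurable_const.add hℓ)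
      (C := 1 + C) fun g hg => by
        rw [abs_of_pos (one_add_pos ℓ g)]
        linarith [hC g hg]
  refine ⟨mulOp α μ hb (toL2 α μ w), ?_⟩
  have h1 := ((isClass_toL2 α μ w).mulOp hb).mulOp (boundedBorel_inv hℓ)
  refine h1.unique ?_
  convert isClass_toL2 α μ w using 1
  ext g
  by_cases hg : g ∈ tsupport w
  · rw [Set.indicator_of_mem hg, smul_smul, inv_mul_cancel₀ (one_add_pos ℓ g).ne', one_smul]
  · rw [image_eq_zero_of_notMem_tsupport hg, smul_zero, smul_zero]

/-- Multiplication by the indicator of {ℓ ≤ n} is a bounded operator times S, so it kills the kernel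
of S. It also fixes any given element of C_c(G, B) once n is large, and it is contractive, so a
vector in the kernel has arbitrarily small norm. -/
theorem mulOp_inv_injective (hℓ : Measurable ℓ) :
    Function.Injective (mulOp α μ (boundedBorel_inv hℓ)) := by
  rw [injective_iff_map_eq_zero]
  intro u hu
  have hm : ∀ n : ℕ, MeasurableSet {g | ℓ g ≤ n} := fun n => measurableSet_le hℓ measurable_const
  have hχ : ∀ n : ℕ, BoundedBorel ({g | ℓ g ≤ n}.indicator fun _ => (1 : ℝ)) := fun n =>
    boundedBorel_indicator (hm n) measurable_const (C := 1) fun g _ => by simp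
  have hσ : ∀ n : ℕ, BoundedBorel ({g | ℓ g ≤ n}.indicator fun g => 1 + ℓ g) := fun n =>
    boundedBorel_indicator (hm n) (measurable_const.add hℓ) (C := 1 + n) fun g hg => by
      rw [abs_of_pos (one_add_pos ℓ g)]
      have : ℓ g ≤ n := hg
      linarith
  have h0 : ∀ n, mulOp α μ (hχ n) u = 0 := by
    intro n
    have h1 := mulOp_mulOp (α := α) (μ := μ) (hσ n) (boundedBorel_inv hℓ) (hχ n) (fun g => by
      by_cases hg : g ∈ {g | ℓ g ≤ n}
      · rw [Set.indicator_of_mem hg, Set.indicator_of_mem hg,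
          mul_inv_cancel₀ (one_add_pos ℓ g).ne']
      · rw [Set.indicator_of_notMem hg, Set.indicator_of_notMem hg, zero_mul])
    rw [← h1, mul_apply_eq_comp, hu, map_zero]
  refine norm_eq_zero.mp (le_antisymm (le_of_forall_pos_le_add fun ε hε => ?_) (norm_nonneg _))
  obtain ⟨w, hw⟩ := (denseRange_toL2 α μ).exists_dist_lt u (half_pos hε)
  rw [dist_eq_norm] at hw
  obtain ⟨C, hC⟩ := exists_bound_of_isCompact μ ℓ hℓ w.hasCompactSupport.isCompact
  obtain ⟨n, hn⟩ := exists_nat_ge C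
  have h1 : mulOp α μ (hχ n) (toL2 α μ w) = toL2 α μ w := by
    refine ((isClass_toL2 α μ w).mulOp (hχ n)).unique ?_
    convert isClass_toL2 α μ w using 1
    ext g
    by_cases hg : g ∈ tsupport w
    · have hg' : g ∈ {g | ℓ g ≤ n} := (hC g hg).trans hn
      rw [Set.indicator_of_mem hg', one_smul]
    · rw [image_eq_zero_of_notMem_tsupport hg, smul_zero]
  have h2 := norm_mulOp_le (α := α) (μ := μ) (hχ n) (C := 1) (fun g => by
    by_cases hg : g ∈ {g | ℓ g ≤ n}
    · rw [Set.indicator_of_mem hg, abs_one]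
    · rw [Set.indicator_of_notMem hg, abs_zero]
      exact zero_le_one) (u - toL2 α μ w)
  rw [map_sub, h0, h1, zero_sub, norm_neg, one_mul] at h2
  have h3 := norm_add_le (u - toL2 α μ w) (toL2 α μ w)
  rw [sub_add_cancel] at h3
  linarith

/-- Injectivity of S cancels the outer factor in S(A + TS) = S(A + T'S), and the dense range of S
cancels the inner one. -/
theorem IsCommutator.unique (hℓ : Measurable ℓ) {A T T' : L2 α μ →L[ℂ] L2 α μ}
    (h : IsCommutator α μ ℓ A T) (h' : IsCommutator α μ ℓ A T') : T = T' := by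
  have h1 := (isCommutator_iff hℓ).mp h
  rw [(isCommutator_iff hℓ).mp h'] at h1
  refine ContinuousLinearMap.ext fun x => ?_
  refine congrFun ((denseRange_mulOp_inv (α := α) (μ := μ) hℓ).equalizer T.continuous
    T'.continuous (funext fun u => ?_)) x
  have h2 := mulOp_inv_injective hℓ (DFunLike.congr_fun h1 u)
  exact (add_left_cancel h2).symm

theorem D_eq (hℓ : Measurable ℓ) {A T : L2 α μ →L[ℂ] L2 α μ} (h : IsCommutator α μ ℓ A T) :
    D α μ ℓ A = T := by
  have h1 : ∃ T, IsCommutator α μ ℓ A T := ⟨T, h⟩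
  rw [D, dif_pos h1]
  exact h1.choose_spec.unique hℓ h

end Graph
end CStarAction

/-! ### The derivation D and its submultiplicative norms -/

namespace CStarAction

open MeasureTheory Filter Topology KTheory

section Derivation

variable {G B : Type*} [Group G] [TopologicalSpace G] [IsTopologicalGroup G]
  [MeasurableSpace G] [BorelSpace G] [NonUnitalCStarAlgebra B] [LocallyCompactSpace G]
  {α : CStarAction G B} {μ : Measure G} [IsFiniteMeasureOnCompacts μ] [μ.Regular]
  {ℓ : GroupSeminorm G} [μ.IsHaarMeasure]

variable (α μ ℓ) in
/-- All `D^n(A)` are bounded. -/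
def IsSmooth (A : L2 α μ →L[ℂ] L2 α μ) : Prop := ∀ n, BoundedD α μ ℓ n A

theorem IsSmooth.isCommutator {A : L2 α μ →L[ℂ] L2 α μ} (h : IsSmooth α μ ℓ A)
    (hℓ : Measurable ℓ) : IsCommutator α μ ℓ A (D α μ ℓ A) := by
  obtain ⟨T, hT, -⟩ := h 1
  rwa [D_eq hℓ hT]

theorem IsSmooth.D {A : L2 α μ →L[ℂ] L2 α μ} (h : IsSmooth α μ ℓ A)
    (hℓ : Measurable ℓ) : IsSmooth α μ ℓ (D α μ ℓ A) := fun n => by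
  obtain ⟨T, hT, hT'⟩ := h (n + 1)
  rwa [D_eq hℓ hT]

theorem IsSmooth.D_iterate {A : L2 α μ →L[ℂ] L2 α μ} (h : IsSmooth α μ ℓ A)
    (hℓ : Measurable ℓ) (n : ℕ) : IsSmooth α μ ℓ ((CStarAction.D α μ ℓ)^[n] A) := by
  induction n with
  | zero => exact h
  | succ n ih =>
    rw [Function.iterate_succ_apply']
    exact ih.D hℓ

theorem IsSmooth.mul {A A' : L2 α μ →L[ℂ] L2 α μ} (h : IsSmooth α μ ℓ A)
    (h' : IsSmooth α μ ℓ A') : IsSmooth α μ ℓ (A * A') := fun n => (h n).mul (h' n)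

theorem IsSmooth.smul {A : L2 α μ →L[ℂ] L2 α μ} (h : IsSmooth α μ ℓ A) (c : ℂ) :
    IsSmooth α μ ℓ (c • A) := fun n => (h n).smul c

/-- A coherent sequence of commutators consists of smooth operators. -/
theorem IsSmooth.of_forall_isCommutator {T : ℕ → L2 α μ →L[ℂ] L2 α μ}
    (h : ∀ n, IsCommutator α μ ℓ (T n) (T (n + 1))) : IsSmooth α μ ℓ (T 0) := by
  have key : ∀ m n, BoundedD α μ ℓ m (T n) := by
    intro m
    induction m with
    | zero => exact fun _ => trivial
    | succ m ih => exact fun n => ⟨T (n + 1), h n, ih (n + 1)⟩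
  exact fun n => key n 0

section Linearity

variable (hℓ : Measurable ℓ) {A A' : L2 α μ →L[ℂ] L2 α μ}

include hℓ

theorem D_zero : D α μ ℓ (0 : L2 α μ →L[ℂ] L2 α μ) = 0 :=
  D_eq hℓ (by
    intro v w _
    convert (sigmaGraph α μ ℓ).zero_mem using 1
    simp)

theorem D_add (h : IsSmooth α μ ℓ A) (h' : IsSmooth α μ ℓ A') :
    D α μ ℓ (A + A') = D α μ ℓ A + D α μ ℓ A' :=
  D_eq hℓ ((h.isCommutator hℓ).add (h'.isCommutator hℓ))

theorem D_mul (h : IsSmooth α μ ℓ A) (h' : IsSmooth α μ ℓ A') :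
    D α μ ℓ (A * A') = A * D α μ ℓ A' + D α μ ℓ A * A' :=
  D_eq hℓ ((h.isCommutator hℓ).mul (h'.isCommutator hℓ))

theorem D_smul (h : IsSmooth α μ ℓ A) (c : ℂ) : D α μ ℓ (c • A) = c • D α μ ℓ A :=
  D_eq hℓ ((h.isCommutator hℓ).smul c)

theorem D_sub (h : IsSmooth α μ ℓ A) (h' : IsSmooth α μ ℓ A') :
    D α μ ℓ (A - A') = D α μ ℓ A - D α μ ℓ A' := by
  rw [sub_eq_add_neg, ← neg_one_smul ℂ A', D_add hℓ h (h'.smul _), D_smul hℓ h', neg_one_smul,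
    sub_eq_add_neg]

theorem D_iterate_sub (h : IsSmooth α μ ℓ A) (h' : IsSmooth α μ ℓ A') (n : ℕ) :
    (D α μ ℓ)^[n] (A - A') = (D α μ ℓ)^[n] A - (D α μ ℓ)^[n] A' := by
  induction n with
  | zero => rfl
  | succ n ih =>
    simp only [Function.iterate_succ_apply']
    rw [ih, D_sub hℓ (h.D_iterate hℓ n) (h'.D_iterate hℓ n)]

end Linearity

variable (α μ ℓ) in
/-- A submultiplicative norm on smooth operators that involves `‖A‖, …, ‖D^n(A)‖`, with weights
that make it close to `‖A‖` for small `t`. -/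
noncomputable def smoothNorm : ℕ → ℝ → (L2 α μ →L[ℂ] L2 α μ) → ℝ
  | 0, _, A => ‖A‖
  | n + 1, t, A => smoothNorm n t A + t * smoothNorm n t (D α μ ℓ A)

section SmoothNorm

variable {A A' : L2 α μ →L[ℂ] L2 α μ} {t : ℝ}

theorem smoothNorm_nonneg (ht : 0 ≤ t) (n : ℕ) (A : L2 α μ →L[ℂ] L2 α μ) :
    0 ≤ smoothNorm α μ ℓ n t A := by
  induction n generalizing A with
  | zero => exact norm_nonneg A
  | succ n ih => exact add_nonneg (ih A) (mul_nonneg ht (ih _))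

theorem smoothNorm_zero (hℓ : Measurable ℓ) (n : ℕ) : smoothNorm α μ ℓ n t 0 = 0 := by
  induction n with
  | zero => exact norm_zero
  | succ n ih => rw [smoothNorm, D_zero hℓ, ih, mul_zero, add_zero]

theorem smoothNorm_smul (hℓ : Measurable ℓ) (n : ℕ) (h : IsSmooth α μ ℓ A) (c : ℂ) :
    smoothNorm α μ ℓ n t (c • A) = ‖c‖ * smoothNorm α μ ℓ n t A := by
  induction n generalizing A with
  | zero => exact norm_smul c A
  | succ n ih =>
    rw [smoothNorm, smoothNorm, D_smul hℓ h, ih h, ih (h.D hℓ)]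
    ring

theorem smoothNorm_add_le (hℓ : Measurable ℓ) (ht : 0 ≤ t) (n : ℕ) (h : IsSmooth α μ ℓ A)
    (h' : IsSmooth α μ ℓ A') :
    smoothNorm α μ ℓ n t (A + A') ≤ smoothNorm α μ ℓ n t A + smoothNorm α μ ℓ n t A' := by
  induction n generalizing A A' with
  | zero => exact norm_add_le A A'
  | succ n ih =>
    simp only [smoothNorm]
    rw [D_add hℓ h h']
    have h1 := ih h h'
    have h2 := mul_le_mul_of_nonneg_left (ih (h.D hℓ) (h'.D hℓ)) ht
    linarith

/-- By the Leibniz rule, the inductive bound consists of three of the four terms of (N(A) +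
tN(DA))(N(A') + tN(DA')), where N is the norm of the previous degree; the missing term t²N(DA)N(DA')
is nonnegative. -/
theorem smoothNorm_mul_le (hℓ : Measurable ℓ) (ht : 0 ≤ t) (n : ℕ) (h : IsSmooth α μ ℓ A)
    (h' : IsSmooth α μ ℓ A') :
    smoothNorm α μ ℓ n t (A * A') ≤ smoothNorm α μ ℓ n t A * smoothNorm α μ ℓ n t A' := by
  induction n generalizing A A' with
  | zero => exact norm_mul_le A A'
  | succ n ih =>
    simp only [smoothNorm]
    rw [D_mul hℓ h h']
    have h1 := ih h h'
    have h2 := smoothNorm_add_le hℓ ht n (h.mul (h'.D hℓ)) ((h.D hℓ).mul h')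
    have h3 := ih h (h'.D hℓ)
    have h4 := ih (h.D hℓ) h'
    have h5 := mul_le_mul_of_nonneg_left (h2.trans (add_le_add h3 h4)) ht
    have h6 := mul_nonneg (mul_nonneg ht (smoothNorm_nonneg (ℓ := ℓ) ht n (D α μ ℓ A)))
      (mul_nonneg ht (smoothNorm_nonneg (ℓ := ℓ) ht n (D α μ ℓ A')))
    linarith

/-- For fixed t > 0 the norm of degree n thus controls D^n, which gives convergence of the
derivatives and continuity of paths in the smooth topology. -/
theorem pow_mul_norm_D_le (ht : 0 ≤ t) (n : ℕ) (A : L2 α μ →L[ℂ] L2 α μ) :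
    t ^ n * ‖(D α μ ℓ)^[n] A‖ ≤ smoothNorm α μ ℓ n t A := by
  induction n generalizing A with
  | zero => simp [smoothNorm]
  | succ n ih =>
    rw [Function.iterate_succ_apply, smoothNorm, pow_succ', mul_assoc]
    have h1 := mul_le_mul_of_nonneg_left (ih (D α μ ℓ A)) ht
    have h2 := smoothNorm_nonneg (ℓ := ℓ) ht n A
    linarith

theorem continuous_smoothNorm (n : ℕ) (A : L2 α μ →L[ℂ] L2 α μ) :
    Continuous fun t => smoothNorm α μ ℓ n t A := by
  induction n generalizing A with
  | zero => exact continuous_const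
  | succ n ih => exact (ih A).add (continuous_id.mul (ih _))

theorem smoothNorm_at_zero (n : ℕ) (A : L2 α μ →L[ℂ] L2 α μ) : smoothNorm α μ ℓ n 0 A = ‖A‖ := by
  induction n generalizing A with
  | zero => rfl
  | succ n ih => rw [smoothNorm, ih, zero_mul, add_zero]

end SmoothNorm

section Algebras

variable {S S' : NonUnitalSubalgebra ℂ (L2 α μ →L[ℂ] L2 α μ)}

/-- An element of a smooth algebra as an operator. -/
def Smooth.op (A : Smooth ℓ S) : L2 α μ →L[ℂ] L2 α μ := Subtype.val (show S from A)

/-- An element of an operator algebra as an operator. -/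
def OpAlg.op (A : OpAlg S) : L2 α μ →L[ℂ] L2 α μ := Subtype.val (show S from A)

/-- The norm on an operator algebra, as the only seminorm in each degree. -/
theorem OpAlg.isSmoothAlg (hS : IsClosed (S : Set (L2 α μ →L[ℂ] L2 α μ))) :
    IsSmoothAlg (A := OpAlg S) (fun A => ‖A.op‖) (fun _ => {fun A => ‖A.op‖}) := by
  have hR : IsRingSeminorm (fun A : OpAlg S => ‖A.op‖) :=
    { nonneg := fun _ => norm_nonneg _
      zero := norm_zero
      neg := fun A => norm_neg A.op
      add_le := fun A A' => norm_add_le A.op A'.op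
      mul_le := fun A A' => norm_mul_le A.op A'.op }
  have hsm : ∀ (c : ℂ) (A : OpAlg S), ‖(c • A).op‖ ≤ ‖c‖ * ‖A.op‖ := fun c A =>
    norm_smul_le c A.op
  refine
    { norm := hR
      norm_smul := hsm
      definite := fun A hA => Subtype.ext (norm_eq_zero.mp hA)
      seminorm := ?_
      seminorm_smul := ?_
      near := fun n s ε hε => ⟨_, rfl, fun a _ => by linarith⟩
      complete := fun a ha => ?_
      continuous_of := fun γ hγ => ?_ }
  · rintro n _ rfl
    exact hR
  · rintro n _ rfl
    exact hsm
  · obtain ⟨_, rfl, C, r, -, hr, h⟩ := ha 0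
    have hc : CauchySeq fun k => (a k).op :=
      cauchySeq_of_le_geometric r C hr fun k => by
        rw [dist_eq_norm, norm_sub_rev]
        exact h k
    obtain ⟨b, hb⟩ := cauchySeq_tendsto_of_complete hc
    have hbS : b ∈ S := hS.mem_of_tendsto hb (.of_forall fun k => Subtype.property (a k))
    exact ⟨⟨b, hbS⟩, tendsto_iff_norm_sub_tendsto_zero.mp hb⟩
  · obtain ⟨_, rfl, C, h⟩ := hγ 0
    have hl : LipschitzWith C.toNNReal fun s => (γ s).op := by
      refine LipschitzWith.of_dist_le_mul fun s t => ?_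
      rw [dist_eq_norm, Subtype.dist_eq, Real.dist_eq]
      exact (h s t).trans (mul_le_mul_of_nonneg_right (Real.le_coe_toNNReal C) (abs_nonneg _))
    exact Continuous.subtype_mk hl.continuous fun s => Subtype.property (γ s)

/-- The algebra of smooth elements of a closed operator algebra is complete. -/
theorem Smooth.isSmoothAlg (hℓ : Measurable ℓ) (hS' : IsClosed (S' : Set (L2 α μ →L[ℂ] L2 α μ)))
    (hS : ∀ A, A ∈ S ↔ A ∈ S' ∧ IsSmooth α μ ℓ A) :
    IsSmoothAlg (A := Smooth ℓ S) (fun A => ‖A.op‖)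
      (fun n => {q | ∃ t : ℝ, 0 < t ∧ q = fun A => smoothNorm α μ ℓ n t A.op}) := by
  have hsm : ∀ A : Smooth ℓ S, IsSmooth α μ ℓ A.op := fun A => ((hS _).mp (Subtype.property A)).2
  refine
    { norm :=
        { nonneg := fun _ => norm_nonneg _
          zero := norm_zero
          neg := fun A => norm_neg A.op
          add_le := fun A A' => norm_add_le A.op A'.op
          mul_le := fun A A' => norm_mul_le A.op A'.op }
      norm_smul := fun c A => norm_smul_le c A.op
      definite := fun A hA => Subtype.ext (norm_eq_zero.mp hA)
      seminorm := ?_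
      seminorm_smul := ?_
      near := fun n s ε hε => ?_
      complete := fun a ha => ?_
      continuous_of := fun γ hγ => ?_ }
  · rintro n _ ⟨t, ht, rfl⟩
    exact
      { nonneg := fun _ => smoothNorm_nonneg ht.le _ _
        zero := smoothNorm_zero hℓ n
        neg := fun A => by
          have h1 := smoothNorm_smul (t := t) hℓ n (hsm A) (-1)
          rw [neg_one_smul, norm_neg, norm_one, one_mul] at h1
          exact h1
        add_le := fun A A' => smoothNorm_add_le hℓ ht.le n (hsm A) (hsm A')
        mul_le := fun A A' => smoothNorm_mul_le hℓ ht.le n (hsm A) (hsm A') }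
  · rintro n _ ⟨t, ht, rfl⟩ c A
    exact (smoothNorm_smul hℓ n (hsm A) c).le
  -- The norms depend continuously on t and reduce to the operator norm at t = 0; a common small t >
  -- 0 exists for finitely many elements.
  · have h1 : ∀ A ∈ s, ∀ᶠ t in 𝓝[>] (0 : ℝ), smoothNorm α μ ℓ n t A.op < ‖A.op‖ + ε := by
      intro A _
      have h2 := (continuous_smoothNorm (ℓ := ℓ) n A.op).tendsto 0
      rw [smoothNorm_at_zero] at h2
      exact (h2.eventually_lt_const (by linarith)).filter_mono nhdsWithin_le_nhds
    obtain ⟨t, h2, h3⟩ := (((eventually_all_finset s).mpr h1).and self_mem_nhdsWithin).exists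
    exact ⟨_, ⟨t, h3, rfl⟩, h2⟩
  -- The parameter t may change with n. This is harmless, since each D^n is treated separately and
  -- the factor t^n is absorbed in the constant.
  · have hc : ∀ n, ∃ T, Tendsto (fun k => (D α μ ℓ)^[n] (a k).op) atTop (𝓝 T) := by
      intro n
      obtain ⟨_, ⟨t, ht, rfl⟩, C, r, -, hr, h⟩ := ha n
      refine cauchySeq_tendsto_of_complete (cauchySeq_of_le_geometric r (C / t ^ n) hr fun k => ?_)
      rw [dist_eq_norm, norm_sub_rev, ← D_iterate_sub hℓ (hsm _) (hsm _), div_mul_eq_mul_div,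
        le_div_iff₀ (by positivity), mul_comm]
      exact (pow_mul_norm_D_le ht.le n _).trans (h k)
    choose T hT using hc
    -- Closedness of D, applied in each degree, identifies the limit of the derivatives of degree n
    -- + 1 with D of the limit in degree n.
    have h1 : IsSmooth α μ ℓ (T 0) := IsSmooth.of_forall_isCommutator fun n => by
      refine IsCommutator.of_tendsto (fun k => ?_) (hT n) (hT (n + 1))
      rw [Function.iterate_succ_apply']
      exact ((hsm (a k)).D_iterate hℓ n).isCommutator hℓ
    have h2 : T 0 ∈ S' := hS'.mem_of_tendsto (hT 0)
      (.of_forall fun k => ((hS _).mp (Subtype.property (a k))).1)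
    exact ⟨⟨T 0, (hS _).mpr ⟨h2, h1⟩⟩, tendsto_iff_norm_sub_tendsto_zero.mp (hT 0)⟩
  · refine continuous_induced_rng.mpr (continuous_pi fun n => ?_)
    obtain ⟨_, ⟨t, ht, rfl⟩, C, h⟩ := hγ n
    have hl : LipschitzWith (C / t ^ n).toNNReal fun s => (D α μ ℓ)^[n] (γ s).op := by
      refine LipschitzWith.of_dist_le_mul fun s s' => ?_
      rw [dist_eq_norm, Subtype.dist_eq, Real.dist_eq]
      refine le_trans ?_ (mul_le_mul_of_nonneg_right (Real.le_coe_toNNReal _) (abs_nonneg _))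
      rw [← D_iterate_sub hℓ (hsm _) (hsm _), div_mul_eq_mul_div,
        le_div_iff₀ (by positivity), mul_comm]
      exact (pow_mul_norm_D_le ht.le n _).trans (h s s')
    exact hl.continuous

instance : IsTopologicalRing (OpAlg S) := inferInstanceAs (IsTopologicalRing S)
instance : ContinuousSMul ℂ (OpAlg S) := inferInstanceAs (ContinuousSMul ℂ S)

theorem Smooth.isDenseSmooth_incl (hℓ : Measurable ℓ) (h : S ≤ S')
    (hS' : IsClosed (S' : Set (L2 α μ →L[ℂ] L2 α μ)))
    (hS : ∀ A, A ∈ S ↔ A ∈ S' ∧ IsSmooth α μ ℓ A)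
    (hd : (S' : Set (L2 α μ →L[ℂ] L2 α μ)) ⊆ closure S) :
    IsDenseSmooth (Smooth.incl ℓ h) (fun A => ‖A.op‖)
      (fun n => {q | ∃ t : ℝ, 0 < t ∧ q = fun A => smoothNorm α μ ℓ n t A.op})
      (fun A => ‖A.op‖) (fun _ => {fun A => ‖A.op‖}) where
  smooth := Smooth.isSmoothAlg hℓ hS' hS
  smooth' := OpAlg.isSmoothAlg hS'
  isometry _ := rfl
  dense := by
    intro A
    refine closure_subtype.mpr ?_
    convert hd (Subtype.property A) using 2
    ext X
    constructor
    · rintro ⟨_, ⟨Y, rfl⟩, rfl⟩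
      exact Subtype.property Y
    · intro hX
      exact ⟨⟨X, h hX⟩, ⟨⟨X, hX⟩, rfl⟩, rfl⟩
  continuous_norm := continuous_subtype_val.norm
  continuous := Smooth.continuous_incl ℓ h

end Algebras
end Derivation
end CStarAction

/-! ### Continuous approximation of ℓ, smoothness of λ(a), and density -/

namespace CStarAction

open MeasureTheory Filter Topology
open scoped Pointwise ENNReal CompactlySupported

section Smoothing

variable {G : Type*} [Group G] [TopologicalSpace G] [IsTopologicalGroup G] [T2Space G]
  [MeasurableSpace G] [BorelSpace G] [LocallyCompactSpace G]

/-- A Borel measurable length function is at bounded distance from a continuous function. -/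
theorem exists_continuous_near (μ : Measure G) [μ.IsHaarMeasure] [μ.Regular] (ℓ : GroupSeminorm G)
    (hℓ : Measurable ℓ) : ∃ (ψ : C(G, ℝ)) (C : ℝ), ∀ g, |ℓ g - ψ g| ≤ C := by
  obtain ⟨φ, hφ1, -, hφc, hφ01⟩ := exists_continuous_one_zero_of_isCompact
    (isCompact_singleton (x := (1 : G))) isClosed_empty (Set.disjoint_empty _)
  have hφ0 : ∀ x, 0 ≤ φ x := fun x => (hφ01 x).1
  have hsc : HasCompactSupport fun y => φ y⁻¹ := hφc.comp_homeomorph (Homeomorph.inv G)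
  have hcont : Continuous fun y => φ y⁻¹ := φ.continuous.comp continuous_inv
  set c := ∫ y, φ y⁻¹ ∂μ with hc
  have hc0 : 0 < c := by
    refine hcont.integral_pos_of_hasCompactSupport_nonneg_nonzero hsc (fun y => hφ0 _) (x := 1) ?_
    rw [inv_one, hφ1 rfl]
    exact one_ne_zero
  have hi : Integrable (fun y => φ y⁻¹) μ := hcont.integrable_of_hasCompactSupport hsc
  -- Absorbing ℓ into a measure that is finite on compact sets leaves the continuous bump function φ
  -- as integrand, so the convolution is continuous although ℓ is not.
  let ν : Measure G := μ.withDensity fun g => ENNReal.ofReal (ℓ g)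
  have hν : IsFiniteMeasureOnCompacts ν := ⟨fun K hK => by
    obtain ⟨C, hC⟩ := exists_bound_of_isCompact μ ℓ hℓ hK
    rw [withDensity_apply _ hK.measurableSet]
    refine (setLIntegral_mono measurable_const fun g hg =>
      ENNReal.ofReal_le_ofReal (hC g hg)).trans_lt ?_
    rw [setLIntegral_const]
    exact ENNReal.mul_lt_top ENNReal.ofReal_lt_top hK.measure_lt_top⟩
  have hψ : Continuous fun x => ∫ y, φ (y⁻¹ * x) ∂ν :=
    continuous_integral_apply_inv_mul φ.continuous hφc
  -- The substitution y = xz turns the convolution into an average, of total mass c, of the values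
  -- ℓ(xz) with z in a fixed compact set. By the triangle inequality these differ from ℓ(x) by at
  -- most ℓ(z).
  have hψ' : ∀ x, ∫ y, φ (y⁻¹ * x) ∂ν = ∫ z, φ z⁻¹ * ℓ (x * z) ∂μ := by
    intro x
    rw [integral_withDensity_eq_integral_toReal_smul hℓ.ennreal_ofReal
      (.of_forall fun _ => ENNReal.ofReal_lt_top), ← integral_mul_left_eq_self _ x]
    congr 1
    ext z
    rw [ENNReal.toReal_ofReal (apply_nonneg ℓ _), smul_eq_mul, mul_comm, mul_inv_rev,
      inv_mul_cancel_right]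
  obtain ⟨C, hC⟩ := exists_bound_of_isCompact μ ℓ hℓ hsc.isCompact
  have hbd : ∀ x z, |φ z⁻¹ * (ℓ (x * z) - ℓ x)| ≤ φ z⁻¹ * C := by
    intro x z
    by_cases hz : z ∈ tsupport fun y => φ y⁻¹
    · rw [abs_mul, abs_of_nonneg (hφ0 _)]
      refine mul_le_mul_of_nonneg_left ?_ (hφ0 _)
      have h1 := map_mul_le_add ℓ x z
      have h2 := map_mul_le_add ℓ (x * z) z⁻¹
      rw [mul_inv_cancel_right, map_inv_eq_map] at h2
      have h3 := hC z hz
      exact abs_le.mpr ⟨by linarith, by linarith⟩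
    · have h0 : φ z⁻¹ = 0 := image_eq_zero_of_notMem_tsupport (f := fun y => φ y⁻¹) hz
      simp [h0]
  have hmeas : ∀ x, Measurable fun z => ℓ (x * z) := fun x =>
    hℓ.comp (continuous_const_mul x).measurable
  have hi2 : ∀ x, Integrable (fun z => φ z⁻¹ * (ℓ (x * z) - ℓ x)) μ := fun x =>
    (hi.mul_const C).mono' (hcont.measurable.mul
      ((hmeas x).sub measurable_const)).aestronglyMeasurable (.of_forall (hbd x))
  refine ⟨⟨fun x => c⁻¹ * ∫ y, φ (y⁻¹ * x) ∂ν, continuous_const.mul hψ⟩, C, fun x => ?_⟩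
  have h1 : ∫ z, φ z⁻¹ * ℓ (x * z) ∂μ = ∫ z, φ z⁻¹ * (ℓ (x * z) - ℓ x) ∂μ + c * ℓ x := by
    rw [hc, ← integral_mul_const, ← integral_add (hi2 x) (hi.mul_const _)]
    congr 1
    ext z
    ring
  have h2 : |∫ z, φ z⁻¹ * (ℓ (x * z) - ℓ x) ∂μ| ≤ c * C := by
    rw [hc, ← integral_mul_const]
    exact norm_integral_le_of_norm_le (f := fun z => φ z⁻¹ * (ℓ (x * z) - ℓ x)) (hi.mul_const C)
      (.of_forall (hbd x))
  change |ℓ x - c⁻¹ * ∫ y, φ (y⁻¹ * x) ∂ν| ≤ C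
  rw [hψ', h1]
  have h3 : ℓ x - c⁻¹ * (∫ z, φ z⁻¹ * (ℓ (x * z) - ℓ x) ∂μ + c * ℓ x) =
      -(c⁻¹ * ∫ z, φ z⁻¹ * (ℓ (x * z) - ℓ x) ∂μ) := by
    field_simp
    ring
  rw [h3, abs_neg, abs_mul, abs_of_pos (inv_pos.mpr hc0), inv_mul_le_iff₀ hc0]
  exact h2

end Smoothing

section TwistedConvolution

variable {G B : Type*} [Group G] [TopologicalSpace G] [IsTopologicalGroup G]
  [MeasurableSpace G] [BorelSpace G] [NonUnitalCStarAlgebra B]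
  (α : CStarAction G B) (μ : Measure G) [IsFiniteMeasureOnCompacts μ]

theorem continuous_weighted (a v : C_c(G, B)) (c : C(G × G, ℝ)) :
    Continuous fun p : G × G => c p • (a p.1 * α p.1 (v (p.1⁻¹ * p.2))) :=
  c.continuous.smul (continuous_kernel α (convKernel a) v)

theorem weighted_eq_zero (a v : C_c(G, B)) (c : C(G × G, ℝ)) (s t : G)
    (h : ¬ (s ∈ tsupport a ∧ t ∈ tsupport a * tsupport v)) :
    c (s, t) • (a s * α s (v (s⁻¹ * t))) = 0 := by
  by_cases hs : s ∈ tsupport a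
  · have : s⁻¹ * t ∉ tsupport v := fun hv => h ⟨hs, Set.mem_mul.mpr ⟨s, hs, _, hv, by group⟩⟩
    rw [image_eq_zero_of_notMem_tsupport this, map_zero, mul_zero, smul_zero]
  · rw [image_eq_zero_of_notMem_tsupport hs, zero_mul, smul_zero]

theorem integrable_weighted (a v : C_c(G, B)) (c : C(G × G, ℝ)) (t : G) :
    Integrable (fun s => c (s, t) • (a s * α s (v (s⁻¹ * t)))) μ := by
  apply Continuous.integrable_of_hasCompactSupport
  · exact (continuous_weighted α a v c).comp (continuous_id.prodMk continuous_const)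
  · exact HasCompactSupport.intro a.hasCompactSupport fun s hs =>
      weighted_eq_zero α a v c s t fun h => hs h.1

/-- Convolution by `a` with a scalar weight `c(s, t)` in the integrand. -/
noncomputable def weightedConv (a : C_c(G, B)) (c : C(G × G, ℝ)) (v : C_c(G, B)) : C_c(G, B) where
  toFun t := ∫ s, c (s, t) • (a s * α s (v (s⁻¹ * t))) ∂μ
  continuous_toFun := by
    rw [← continuousOn_univ]
    refine continuousOn_integral_of_compact_support (k := tsupport a) a.hasCompactSupport ?_ ?_
    · exact ((continuous_weighted α a v c).comp continuous_swap).continuousOn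
    · intro p x _ hx
      exact weighted_eq_zero α a v c x p fun h => hx h.1
  hasCompactSupport' := by
    refine HasCompactSupport.intro (K := tsupport a * tsupport v)
      (a.hasCompactSupport.isCompact.mul v.hasCompactSupport.isCompact) fun t ht => ?_
    simp only [weighted_eq_zero α a v c _ t (fun h => ht h.2), integral_zero]

theorem weightedConv_apply (a : C_c(G, B)) (c : C(G × G, ℝ)) (v : C_c(G, B)) (t : G) :
    weightedConv α μ a c v t = ∫ s, c (s, t) • (a s * α s (v (s⁻¹ * t))) ∂μ := rfl

/-- `weightedConv` as a linear map. -/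
noncomputable def weightedConvₗ (a : C_c(G, B)) (c : C(G × G, ℝ)) : C_c(G, B) →ₗ[ℂ] C_c(G, B) where
  toFun := weightedConv α μ a c
  map_add' v w := by
    ext t
    refine Eq.trans ?_ (integral_add (integrable_weighted α μ a v c t)
      (integrable_weighted α μ a w c t))
    rw [weightedConv_apply]
    simp [mul_add]
  map_smul' r v := by
    ext t
    refine Eq.trans ?_ (integral_smul r _)
    rw [weightedConv_apply]
    simp [mul_smul_comm, smul_comm _ r]

variable {c : C(G × G, ℝ)} {C : ℝ}

/-- The weight depends on t as well, so this is not an integral against a `Kernel`. The argument by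
Fubini and Cauchy-Schwarz is the same, with each slice multiplied by the function t ↦ c(s, t), which
is bounded by C for s in the support of a. -/
theorem norm_weightedConv_le [μ.IsMulLeftInvariant] (a : C_c(G, B))
    (hC : ∀ s ∈ tsupport a, ∀ t, |c (s, t)| ≤ C) (v : C_c(G, B)) :
    ‖toL2 α μ (weightedConv α μ a c v)‖ ≤ (∫ s, C * ‖a s‖ ∂μ) * ‖toL2 α μ v‖ := by
  set W := weightedConv α μ a c v with hW
  let cs : G → C(G, ℝ) := fun s => c.comp ⟨fun t => (s, t), by fun_prop⟩
  let slc : G → C_c(G, B) := fun s => ccMul (cs s) (slice α (convKernel a) v s)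
  have hslc : ∀ s t, slc s t = c (s, t) • (a s * α s (v (s⁻¹ * t))) := fun _ _ => rfl
  have hns : ∀ s, ‖toL2 α μ (slc s)‖ ≤ C * ‖a s‖ * ‖toL2 α μ v‖ := by
    intro s
    by_cases hs : s ∈ tsupport a
    · refine (norm_toL2_ccMul_le (hC s hs) _).trans ?_
      rw [mul_assoc]
      refine mul_le_mul_of_nonneg_left ?_ ((abs_nonneg _).trans (hC s hs 1))
      rw [norm_toL2, norm_toL2]
      have := norm_slice_le α μ (convKernel a) v s
      rwa [show |(convKernel a).bound s| = ‖a s‖ from abs_of_nonneg (norm_nonneg (a s))] at this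
    · have h0 : slc s = 0 := by
        ext t
        rw [hslc]
        exact weighted_eq_zero α a v c s t fun h => hs h.1
      rw [h0, map_zero, norm_zero, image_eq_zero_of_notMem_tsupport hs]
      simp
  have h1 : inner α μ W W = ∫ s, inner α μ W (slc s) ∂μ := by
    have : inner α μ W W =
        ∫ t, ∫ s, α t⁻¹ (star (W t) * (c (s, t) • (a s * α s (v (s⁻¹ * t))))) ∂μ ∂μ := by
      rw [inner]
      congr 1
      ext t
      exact (((α.clm t⁻¹).comp (ContinuousLinearMap.mul ℂ B (star (W t)))).integral_comp_comm
        (integrable_weighted α μ a v c t)).symm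
    rw [this]
    refine (integral_integral_swap_of_hasCompactSupport ?_ ?_)
    · exact α.continuous_uncurry.comp (continuous_fst.inv.prodMk
        (((map_continuous W).comp continuous_fst).star.mul
          ((continuous_weighted α a v c).comp continuous_swap)))
    · refine HasCompactSupport.intro (K := tsupport W ×ˢ tsupport a)
        (W.hasCompactSupport.isCompact.prod a.hasCompactSupport.isCompact) ?_
      rintro ⟨t, s⟩ h
      by_cases ht : t ∈ tsupport W
      · have hs : s ∉ tsupport a := fun hs => h ⟨ht, hs⟩
        simp [Function.uncurry, image_eq_zero_of_notMem_tsupport hs]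
      · simp [Function.uncurry, image_eq_zero_of_notMem_tsupport ht]
  have h2 : ‖inner α μ W W‖ ≤ ∫ s, ‖toL2 α μ W‖ * (C * ‖a s‖ * ‖toL2 α μ v‖) ∂μ := by
    rw [h1]
    refine norm_integral_le_of_norm_le ?_ (Filter.Eventually.of_forall fun s => ?_)
    · exact (((Continuous.integrable_of_hasCompactSupport (map_continuous a).norm
        a.hasCompactSupport.norm).const_mul C).mul_const _).const_mul _
    · refine (norm_inner_le_mul_sqrt α μ _ _).trans ?_
      rw [← norm_toL2, ← norm_toL2]
      gcongr
      exact hns s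
  rw [integral_const_mul, integral_mul_const, ← norm_toL2_sq, sq] at h2
  by_cases h3 : ‖toL2 α μ W‖ = 0
  · rw [h3]
    refine mul_nonneg (integral_nonneg fun s => ?_) (norm_nonneg _)
    by_cases hs : s ∈ tsupport a
    · exact mul_nonneg ((abs_nonneg _).trans (hC s hs 1)) (norm_nonneg _)
    · simp [image_eq_zero_of_notMem_tsupport hs]
  · exact le_of_mul_le_mul_left h2 (lt_of_le_of_ne (norm_nonneg _) (Ne.symm h3))

/-- The bounded operator on `L²(G, B)` extending `weightedConv`. -/
noncomputable def weightedOp (a : C_c(G, B)) (c : C(G × G, ℝ)) : L2 α μ →L[ℂ] L2 α μ :=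
  ((toL2 α μ).comp (weightedConvₗ α μ a c)).extendOfNorm (toL2 α μ)

theorem weightedOp_toL2 [μ.IsMulLeftInvariant] (a : C_c(G, B))
    (hC : ∀ s ∈ tsupport a, ∀ t, |c (s, t)| ≤ C) (v : C_c(G, B)) :
    weightedOp α μ a c (toL2 α μ v) = toL2 α μ (weightedConv α μ a c v) :=
  LinearMap.extendOfNorm_eq (denseRange_toL2 α μ) ⟨_, norm_weightedConv_le α μ a hC⟩ v

end TwistedConvolution

section Density

variable {G B : Type*} [Group G] [TopologicalSpace G] [IsTopologicalGroup G]
  [MeasurableSpace G] [BorelSpace G] [NonUnitalCStarAlgebra B] [LocallyCompactSpace G]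
  (α : CStarAction G B) (μ : Measure G) [IsFiniteMeasureOnCompacts μ] [μ.Regular]
  [μ.IsHaarMeasure] {ℓ : GroupSeminorm G}

theorem BoundedD.mulOp (hℓ : Measurable ℓ) {β : G → ℝ} (hβ : BoundedBorel β) (n : ℕ) :
    BoundedD α μ ℓ n (mulOp α μ hβ) := by
  cases n with
  | zero => trivial
  | succ n =>
    refine ⟨0, (isCommutator_iff hℓ).mpr ?_, BoundedD.zero n⟩
    rw [zero_mul, add_zero, mulOp_comm]

/-- The weight `(ψ(t) - ψ(s⁻¹ t))^k`. -/
def powWeight (ψ : C(G, ℝ)) (k : ℕ) : C(G × G, ℝ) :=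
  ⟨fun p => (ψ p.2 - ψ (p.1⁻¹ * p.2)) ^ k, by fun_prop⟩

variable {ψ : C(G, ℝ)} {C : ℝ}

/-- By the triangle inequality |ℓ(t) - ℓ(s⁻¹t)| ≤ ℓ(s), uniformly in t. Passing to ψ costs 2C, and
ℓ(s) is bounded on the compact support of a. -/
theorem exists_powWeight_bound (μ : Measure G) [μ.IsHaarMeasure] [μ.Regular]
    (hℓ : Measurable ℓ) (hψ : ∀ g, |ℓ g - ψ g| ≤ C)
    (a : C_c(G, B)) : ∃ M, ∀ k, ∀ s ∈ tsupport a, ∀ t, |powWeight ψ k (s, t)| ≤ M ^ k := by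
  obtain ⟨L, hL⟩ := exists_bound_of_isCompact μ ℓ hℓ a.hasCompactSupport.isCompact
  refine ⟨C + C + L, fun k s hs t => ?_⟩
  change |(ψ t - ψ (s⁻¹ * t)) ^ k| ≤ _
  rw [abs_pow]
  refine pow_le_pow_left₀ (abs_nonneg _) ?_ k
  obtain ⟨h1, h2⟩ := abs_le.mp (hψ t)
  obtain ⟨h3, h4⟩ := abs_le.mp (hψ (s⁻¹ * t))
  have h5 := map_mul_le_add ℓ s⁻¹ t
  have h6 := map_mul_le_add ℓ s (s⁻¹ * t)
  rw [mul_inv_cancel_left] at h6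
  rw [map_inv_eq_map] at h5
  have h7 := hL s hs
  exact abs_le.mpr ⟨by linarith, by linarith⟩

/-- Split σ = (1 + C + ψ) + β, where β = ℓ - ψ - C is bounded. The commutator with the continuous
part inserts one more factor ψ(t) - ψ(s⁻¹t), which raises k by one; the commutator with β is one of
bounded operators. To avoid unbounded operators, the computation uses the inverses S of σ and R of 1
+ C + ψ. -/
theorem isCommutator_weightedOp (hℓ : Measurable ℓ) (hψ : ∀ g, |ℓ g - ψ g| ≤ C)
    (a : C_c(G, B)) : ∃ (β : G → ℝ) (hβ : BoundedBorel β), ∀ k,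
      IsCommutator α μ ℓ (weightedOp α μ a (powWeight ψ k))
        (weightedOp α μ a (powWeight ψ (k + 1)) +
          (mulOp α μ hβ * weightedOp α μ a (powWeight ψ k) -
            weightedOp α μ a (powWeight ψ k) * mulOp α μ hβ)) := by
  obtain ⟨M, hM⟩ := exists_powWeight_bound μ hℓ hψ a
  -- The shift by C makes the continuous part at least 1, so that its inverse is continuous and
  -- bounded.
  have hσ1 : ∀ g, 1 ≤ 1 + C + ψ g := fun g => by
    have h1 := (abs_le.mp (hψ g)).2
    have h2 := apply_nonneg ℓ g
    linarith
  have hσ0 : ∀ g, 1 + C + ψ g ≠ 0 := fun g => (zero_lt_one.trans_le (hσ1 g)).ne'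
  have hρc : Continuous fun g => (1 + C + ψ g)⁻¹ :=
    (continuous_const.add ψ.continuous).inv₀ hσ0
  have hρ : BoundedBorel fun g => (1 + C + ψ g)⁻¹ := ⟨hρc.measurable, 1, fun g => by
    rw [abs_of_nonneg (inv_nonneg.mpr (zero_le_one.trans (hσ1 g)))]
    exact inv_le_one_of_one_le₀ (hσ1 g)⟩
  have hβ : BoundedBorel fun g => ℓ g - ψ g - C := by
    refine ⟨(hℓ.sub ψ.continuous.measurable).sub measurable_const, C + C, fun g => ?_⟩
    obtain ⟨h1, h2⟩ := abs_le.mp (hψ g)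
    exact abs_le.mpr ⟨by linarith, by linarith⟩
  refine ⟨_, hβ, fun k => ?_⟩
  rw [isCommutator_iff hℓ]
  set X := weightedOp α μ a (powWeight ψ k)
  set X' := weightedOp α μ a (powWeight ψ (k + 1))
  set S := mulOp α μ (boundedBorel_inv hℓ)
  set R := mulOp α μ hρ
  set b := mulOp α μ hβ
  -- This is [R⁻¹, X] = X', multiplied by R on both sides. All operators involved preserve C_c(G,
  -- B), so it reduces to an identity of integrands.
  have hXR : X * R = R * X + R * X' * R := by
    refine ext_toL2 fun v => ?_
    change X (R (toL2 α μ v)) = R (X (toL2 α μ v)) + R (X' (R (toL2 α μ v)))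
    rw [mulOp_toL2_of_continuous hρ hρc, weightedOp_toL2 α μ a (hM k),
      weightedOp_toL2 α μ a (hM k), weightedOp_toL2 α μ a (hM (k + 1)), ← map_add, ← map_add,
      mulOp_toL2_of_continuous hρ hρc]
    congr 1
    ext t
    rw [ccMul_apply, CompactlySupportedContinuousMap.add_apply, weightedConv_apply,
      weightedConv_apply, weightedConv_apply, ← integral_add (integrable_weighted α μ a _ _ t)
        (integrable_weighted α μ a _ _ t), ← integral_smul]
    congr 1
    ext s
    rw [ccMul_apply, map_real_smul, mul_smul_comm, smul_smul, smul_smul, ← add_smul, smul_smul]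
    congr 1
    change (ψ t - ψ (s⁻¹ * t)) ^ k * (1 + C + ψ (s⁻¹ * t))⁻¹ = (1 + C + ψ t)⁻¹ *
      ((ψ t - ψ (s⁻¹ * t)) ^ k + (ψ t - ψ (s⁻¹ * t)) ^ (k + 1) * (1 + C + ψ (s⁻¹ * t))⁻¹)
    have h1 := hσ0 t
    have h2 := hσ0 (s⁻¹ * t)
    field_simp
    ring
  have hs : ∀ g, (1 + C + ψ g)⁻¹ - (1 + ℓ g)⁻¹ * (ℓ g - ψ g - C) * (1 + C + ψ g)⁻¹ =
      (1 + ℓ g)⁻¹ := fun g => by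
    have h1 := hσ0 g
    have h2 := (one_add_pos ℓ g).ne'
    field_simp
    ring
  -- The resolvent identity for S⁻¹ = R⁻¹ + β; the next one is its mirror image. Together they
  -- convert the relation for R into the one for S.
  have hSbR : (1 - S * b) * R = S := by
    refine ext_toL2 fun v => ?_
    have h1 := (isClass_toL2 α μ v).mulOp hρ
    refine IsClass.unique (h1.sub ((h1.mulOp hβ).mulOp (boundedBorel_inv hℓ))) ?_
    convert (isClass_toL2 α μ v).mulOp (boundedBorel_inv hℓ) using 1
    ext g
    rw [Pi.sub_apply, smul_smul, smul_smul, ← sub_smul, hs g]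
  have hRbS : R * (1 - b * S) = S := by
    have h1 : R * (b * S) = S * b * R := by
      rw [mulOp_comm hβ (boundedBorel_inv hℓ), ← mul_assoc, mulOp_comm hρ, mul_assoc,
        mulOp_comm hρ hβ, mul_assoc]
    rw [mul_sub, mul_one, h1, ← one_sub_mul, hSbR]
  have h1 : X * S = R * X * (1 - b * S) + R * X' * S := by
    calc X * S = X * R * (1 - b * S) := by rw [mul_assoc, hRbS]
      _ = R * X * (1 - b * S) + R * X' * (R * (1 - b * S)) := by rw [hXR]; noncomm_ring
      _ = _ := by rw [hRbS]
  calc X * S = (1 - S * b) * (X * S) + S * b * X * S := by noncomm_ring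
    _ = (1 - S * b) * R * X * (1 - b * S) + (1 - S * b) * R * X' * S + S * b * X * S := by
        rw [h1]; noncomm_ring
    _ = S * (X + (X' + (b * X - X * b)) * S) := by rw [hSbR]; noncomm_ring

theorem lam_eq_weightedOp (a : C_c(G, B)) : lam α μ a = weightedOp α μ a (powWeight ψ 0) := by
  refine ext_toL2 fun v => ?_
  rw [lam_toL2, weightedOp_toL2 α μ a (C := 1) (by simp [powWeight])]
  congr 1
  ext t
  rw [conv_apply, weightedConv_apply]
  simp [powWeight]

/-- The operators `λ(a)` for `a ∈ C_c(G, B)` are smooth. -/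
theorem isSmooth_lam [T2Space G] (hℓ : Measurable ℓ) (a : C_c(G, B)) :
    IsSmooth α μ ℓ (lam α μ a) := by
  obtain ⟨ψ, C, hψ⟩ := exists_continuous_near μ ℓ hℓ
  obtain ⟨β, hβ, h⟩ := isCommutator_weightedOp α μ hℓ hψ a
  -- The induction on n is over all k at once, because each commutator leads from k to k + 1. The
  -- operator b commutes with σ and creates no further terms.
  have key : ∀ n k, BoundedD α μ ℓ n (weightedOp α μ a (powWeight ψ k)) := by
    intro n
    induction n with
    | zero => exact fun _ => trivial
    | succ n ih =>
      refine fun k => ⟨_, h k, (ih (k + 1)).add ?_⟩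
      have hb := BoundedD.mulOp α μ hℓ hβ n
      rw [sub_eq_add_neg, ← neg_one_smul ℂ]
      exact (hb.mul (ih k)).add (((ih k).mul hb).smul _)
  intro n
  rw [lam_eq_weightedOp α μ (ψ := ψ) a]
  exact key n 0

theorem isClosed_reducedCrossedProduct :
    IsClosed (reducedCrossedProduct α μ : Set (L2 α μ →L[ℂ] L2 α μ)) :=
  NonUnitalSubalgebra.isClosed_topologicalClosure _

/-- `V_ℓ^∞(G, B)` is dense in `C_r^*(G, B)`. -/
theorem reducedCrossedProduct_subset_closure [T2Space G] (hℓ : Measurable ℓ) :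
    (reducedCrossedProduct α μ : Set (L2 α μ →L[ℂ] L2 α μ)) ⊆ closure (vInf α μ ℓ) := by
  have h1 : NonUnitalAlgebra.adjoin ℂ (Set.range (lam α μ)) ≤ vInf α μ ℓ := by
    refine NonUnitalAlgebra.adjoin_le ?_
    rintro _ ⟨a, rfl⟩
    exact ⟨NonUnitalSubalgebra.le_topologicalClosure _
      (NonUnitalAlgebra.subset_adjoin ℂ ⟨a, rfl⟩), isSmooth_lam α μ hℓ a⟩
  exact closure_mono h1

end Density
end CStarAction

/-! ### The projection e_K and density in the corner -/

namespace CStarAction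

open MeasureTheory Filter Topology
open scoped Pointwise ENNReal CompactlySupported

section Corner

variable {G B : Type*} [Group G] [TopologicalSpace G] [IsTopologicalGroup G]
  [MeasurableSpace G] [BorelSpace G] [NonUnitalCStarAlgebra B] [LocallyCompactSpace G]
  (α : CStarAction G B) (μ : Measure G) [IsFiniteMeasureOnCompacts μ] [μ.Regular]
  [μ.IsHaarMeasure] {ℓ : GroupSeminorm G} (K : OpenSubgroup G) (hK : IsCompact (K : Set G))

/-- The density of the normalized Haar measure of a compact open subgroup. -/
noncomputable def density : C_c(G, ℝ) where
  toFun := (K : Set G).indicator fun _ => (μ K).toReal⁻¹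
  continuous_toFun := IsClopen.continuous_indicator ⟨K.isClosed, K.isOpen⟩ continuous_const
  hasCompactSupport' := HasCompactSupport.intro hK fun _ hs => Set.indicator_of_notMem hs _

theorem density_apply (k : G) :
    density μ K hK k = (K : Set G).indicator (fun _ => (μ K).toReal⁻¹) k := rfl

theorem density_eq_zero {k : G} (hk : k ∉ K) : density μ K hK k = 0 := by
  rw [density_apply, Set.indicator_of_notMem hk]

theorem density_mul {h : G} (hh : h ∈ K) (k : G) : density μ K hK (h * k) = density μ K hK k := by
  by_cases hk : k ∈ K
  · rw [density_apply, density_apply, Set.indicator_of_mem (SetLike.mem_coe.mpr hk),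
      Set.indicator_of_mem (SetLike.mem_coe.mpr (mul_mem hh hk))]
  · rw [density_eq_zero μ K hK hk,
      density_eq_zero μ K hK fun h' => hk ((mul_mem_cancel_left hh).mp h')]

theorem integral_density : ∫ k, density μ K hK k ∂μ = 1 := by
  have hpos : 0 < (μ K).toReal := ENNReal.toReal_pos
    (K.isOpen.measure_pos μ ⟨1, K.one_mem⟩).ne' hK.measure_lt_top.ne
  simp only [density_apply]
  rw [integral_indicator K.isOpen.measurableSet, setIntegral_const, smul_eq_mul]
  exact mul_inv_cancel₀ hpos.ne'

theorem avg_eq_integral_density (v : C_c(G, B)) (t : G) :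
    avg α μ K hK v t = ∫ k, density μ K hK k • α k (v (k⁻¹ * t)) ∂μ := rfl

theorem apply_real_smul (g : G) (r : ℝ) (b : B) : α g (r • b) = r • α g b := by
  rw [← Complex.coe_smul, map_smul, Complex.coe_smul]

theorem apply_integral (g : G) (f : G → B) : α g (∫ s, f s ∂μ) = ∫ s, α g (f s) ∂μ :=
  ((ContinuousLinearEquiv.equivOfInverse (α.clm g) (α.clm g⁻¹) (α.inv_apply_apply g)
    fun b => by simp only [clm_apply, ← mul_apply, mul_inv_cancel, one_apply]).integral_comp_comm
      f).symm

theorem apply_avg {h : G} (hh : h ∈ K) (v : C_c(G, B)) (t : G) :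
    α h (avg α μ K hK v (h⁻¹ * t)) = avg α μ K hK v t := by
  rw [avg_eq_integral_density, avg_eq_integral_density, apply_integral,
    ← integral_mul_left_eq_self (fun k => density μ K hK k • α k (v (k⁻¹ * t))) h]
  congr 1
  ext k
  rw [density_mul μ K hK hh, apply_real_smul, mul_apply, mul_inv_rev, mul_assoc]

theorem avg_eq_self {v : C_c(G, B)} (hv : ∀ k ∈ K, ∀ t, α k (v (k⁻¹ * t)) = v t) :
    avg α μ K hK v = v := by
  ext t
  have h : ∀ k, density μ K hK k • α k (v (k⁻¹ * t)) = density μ K hK k • v t := fun k => by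
    by_cases hk : k ∈ K
    · rw [hv k hk]
    · rw [density_eq_zero μ K hK hk, zero_smul, zero_smul]
  rw [avg_eq_integral_density]
  simp only [h]
  rw [integral_smul_const, integral_density, one_smul]

theorem isIdempotentElem_eK : IsIdempotentElem (eK α μ K hK) := by
  refine ext_toL2 fun v => ?_
  change eK α μ K hK (eK α μ K hK (toL2 α μ v)) = _
  rw [eK_toL2, eK_toL2, avg_eq_self α μ K hK fun k hk t => apply_avg α μ K hK hk v t]

/-- Such a function is constant on the open cosets Kg. Multiplication by it therefore preserves
C_c(G, B), where the commutation with e_K can be checked pointwise. -/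
theorem continuous_of_mul_left_eq {φ : G → ℝ} (h : ∀ k ∈ K, ∀ g, φ (k * g) = φ g) :
    Continuous φ := by
  rw [continuous_iff_continuousAt]
  intro g
  have h1 : {x : G | x * g⁻¹ ∈ K} ∈ 𝓝 g :=
    (K.isOpen.preimage (continuous_mul_const g⁻¹)).mem_nhds (by simp)
  refine (continuousAt_const (y := φ g)).congr ?_
  filter_upwards [h1] with x hx
  rw [← h _ hx g, inv_mul_cancel_right]

/-- `e_K` commutes with multiplication by a bounded function that is left invariant under `K`. -/
theorem eK_mul_mulOp {φ : G → ℝ} (hφ : BoundedBorel φ) (h : ∀ k ∈ K, ∀ g, φ (k * g) = φ g) :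
    eK α μ K hK * mulOp α μ hφ = mulOp α μ hφ * eK α μ K hK := by
  have hc := continuous_of_mul_left_eq K h
  refine ext_toL2 fun v => ?_
  change eK α μ K hK (mulOp α μ hφ (toL2 α μ v)) = mulOp α μ hφ (eK α μ K hK (toL2 α μ v))
  rw [mulOp_toL2_of_continuous hφ hc, eK_toL2, eK_toL2, mulOp_toL2_of_continuous hφ hc]
  congr 1
  ext t
  rw [ccMul_apply, avg_eq_integral_density, avg_eq_integral_density, ← integral_smul]
  congr 1
  ext k
  by_cases hk : k ∈ K
  · rw [ccMul_apply, apply_real_smul, smul_comm]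
    congr 1
    exact h _ (inv_mem hk) t
  · rw [density_eq_zero μ K hK hk, zero_smul, zero_smul, smul_zero]

/-- The projection e_K commutes with multiplication by (1 + ℓ)⁻¹, so its commutator with σ is 0. -/
theorem isSmooth_eK (hℓ : Measurable ℓ) (h : ∀ k ∈ K, ∀ g, ℓ (k * g) = ℓ g) :
    IsSmooth α μ ℓ (eK α μ K hK) := by
  intro n
  cases n with
  | zero => trivial
  | succ n =>
    refine ⟨0, (isCommutator_iff hℓ).mpr ?_, BoundedD.zero n⟩
    rw [zero_mul, add_zero]
    exact eK_mul_mulOp α μ K hK _ fun k hk g => by simp only [h k hk g]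

/-- `e_K λ(a) = λ(e_K a)`. -/
theorem eK_mul_lam (a : C_c(G, B)) :
    eK α μ K hK * lam α μ a = lam α μ (avg α μ K hK a) := by
  refine ext_toL2 fun v => ?_
  change eK α μ K hK (lam α μ a (toL2 α μ v)) = _
  rw [lam_toL2, eK_toL2, lam_toL2]
  congr 1
  ext t
  -- Left invariance, through s ↦ ks, moves the translation by k from v to a. Fubini then gives the
  -- average of a.
  have h1 : ∀ k, density μ K hK k • α k (conv α μ a v (k⁻¹ * t)) =
      ∫ s, density μ K hK k • (α k (a (k⁻¹ * s)) * α s (v (s⁻¹ * t))) ∂μ := by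
    intro k
    rw [integral_smul, conv_apply, apply_integral,
      ← integral_mul_left_eq_self (fun s => α k (a (k⁻¹ * s)) * α s (v (s⁻¹ * t))) k]
    congr 2
    ext s
    rw [map_mul, inv_mul_cancel_left, mul_apply, mul_inv_rev, mul_assoc]
  have h2 : ∀ s, avg α μ K hK a s * α s (v (s⁻¹ * t)) =
      ∫ k, density μ K hK k • (α k (a (k⁻¹ * s)) * α s (v (s⁻¹ * t))) ∂μ := by
    intro s
    simp only [← smul_mul_assoc]
    exact (((ContinuousLinearMap.mul ℂ B).flip (α s (v (s⁻¹ * t)))).integral_comp_comm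
      (integrable_kernel α μ (avgKernel μ K hK) a s)).symm
  rw [avg_eq_integral_density, conv_apply]
  simp only [h1, h2]
  refine integral_integral_swap_of_hasCompactSupport ?_ ?_
  · refine ((map_continuous (density μ K hK)).comp continuous_fst).smul (Continuous.mul ?_ ?_)
    · exact α.continuous_uncurry.comp (continuous_fst.prodMk
        ((map_continuous a).comp (continuous_fst.inv.mul continuous_snd)))
    · exact α.continuous_uncurry.comp (continuous_snd.prodMk
        ((map_continuous v).comp (continuous_snd.inv.mul continuous_const)))
  · refine HasCompactSupport.intro (K := (K : Set G) ×ˢ ((K : Set G) * tsupport a))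
      (hK.prod (hK.mul a.hasCompactSupport.isCompact)) ?_
    rintro ⟨k, s⟩ h
    change density μ K hK k • (α k (a (k⁻¹ * s)) * _) = 0
    by_cases hk : k ∈ K
    · have : k⁻¹ * s ∉ tsupport a := fun hv => h ⟨hk, Set.mem_mul.mpr ⟨k, hk, _, hv, by group⟩⟩
      rw [image_eq_zero_of_notMem_tsupport this, map_zero, zero_mul, smul_zero]
    · rw [density_eq_zero μ K hK hk, zero_smul]

include hK in
/-- The Haar measure is right invariant under compact open subgroups. -/
theorem map_mul_right_eq_self {k : G} (hk : k ∈ K) : μ.map (· * k) = μ := by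
  have : (μ.map (· * k)).Regular :=
    (Measure.Regular.map_iff (Homeomorph.mulRight k)).mpr inferInstance
  -- A right translate of μ is again left invariant, hence a multiple of μ. The factor is 1 because
  -- right translation by k preserves K, whose measure is finite and positive.
  have h := Measure.isMulLeftInvariant_eq_smul_of_regular (μ.map (· * k)) μ
  have h1 : μ.map (· * k) K = μ K := by
    rw [Measure.map_apply (measurable_mul_const k) K.isOpen.measurableSet]
    congr 1
    ext x
    exact mul_mem_cancel_right hk
  have h2 := congrArg (fun ν : Measure G => ν K) h
  have h3 : Measure.haarScalarFactor (μ.map (· * k)) μ = 1 := by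
    simp only [h1, Measure.smul_apply, ENNReal.smul_def, smul_eq_mul] at h2
    have h4 := (ENNReal.mul_eq_right (K.isOpen.measure_pos μ ⟨1, K.one_mem⟩).ne'
      hK.measure_lt_top.ne).mp h2.symm
    exact_mod_cast h4
  rw [h, h3, one_smul]

/-- Averaging over `K` from the right: `s ↦ μ(K)⁻¹ ∫_K a(s k⁻¹) dμ(k)`. -/
noncomputable def avgRight (a : C_c(G, B)) : C_c(G, B) where
  toFun s := ∫ k, density μ K hK k • a (s * k⁻¹) ∂μ
  continuous_toFun := by
    rw [← continuousOn_univ]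
    refine continuousOn_integral_of_compact_support (k := (K : Set G)) hK ?_ ?_
    · exact (((map_continuous (density μ K hK)).comp continuous_snd).smul
        ((map_continuous a).comp (continuous_fst.mul continuous_snd.inv))).continuousOn
    · intro p k _ hk
      rw [density_eq_zero μ K hK hk, zero_smul]
  hasCompactSupport' := by
    refine HasCompactSupport.intro (K := tsupport a * (K : Set G))
      (a.hasCompactSupport.isCompact.mul hK) fun s hs => ?_
    refine (integral_congr_ae (.of_forall fun k => ?_)).trans (integral_zero G B)
    by_cases hk : k ∈ K
    · have : s * k⁻¹ ∉ tsupport a := fun hv => hs (Set.mem_mul.mpr ⟨_, hv, k, hk, by group⟩)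
      simp [image_eq_zero_of_notMem_tsupport this]
    · simp [density_eq_zero μ K hK hk]

/-- The substitution s ↦ sk⁻¹ moves the average from v to a. It is legitimate although G need not be
unimodular, because μ is right invariant under K. -/
theorem lam_mul_eK (a : C_c(G, B)) :
    lam α μ a * eK α μ K hK = lam α μ (avgRight μ K hK a) := by
  refine ext_toL2 fun v => ?_
  change lam α μ a (eK α μ K hK (toL2 α μ v)) = _
  rw [eK_toL2, lam_toL2, lam_toL2]
  congr 1
  ext t
  have h1 : ∀ s, a s * α s (avg α μ K hK v (s⁻¹ * t)) =
      ∫ k, density μ K hK k • (a s * α (s * k) (v ((s * k)⁻¹ * t))) ∂μ := by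
    intro s
    have h := ((ContinuousLinearMap.mul ℂ B (a s)).comp (α.clm s)).integral_comp_comm
      (integrable_kernel α μ (avgKernel μ K hK) v (s⁻¹ * t))
    refine h.symm.trans (integral_congr_ae (.of_forall fun k => ?_))
    change a s * α s (density μ K hK k • α k (v (k⁻¹ * (s⁻¹ * t)))) = _
    simp only [apply_real_smul, mul_smul_comm, mul_apply, mul_inv_rev, mul_assoc]
  have h2 : ∀ s, avgRight μ K hK a s * α s (v (s⁻¹ * t)) =
      ∫ k, density μ K hK k • (a (s * k⁻¹) * α s (v (s⁻¹ * t))) ∂μ := by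
    intro s
    simp only [← smul_mul_assoc]
    refine (((ContinuousLinearMap.mul ℂ B).flip (α s (v (s⁻¹ * t)))).integral_comp_comm
      (φ := fun k => density μ K hK k • a (s * k⁻¹)) ?_).symm
    apply Continuous.integrable_of_hasCompactSupport
    · exact (map_continuous (density μ K hK)).smul
        ((map_continuous a).comp (continuous_const.mul continuous_inv))
    · exact (density μ K hK).hasCompactSupport.smul_right
  have h3 : ∀ k, ∫ s, density μ K hK k • (a s * α (s * k) (v ((s * k)⁻¹ * t))) ∂μ =
      ∫ s, density μ K hK k • (a (s * k⁻¹) * α s (v (s⁻¹ * t))) ∂μ := by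
    intro k
    by_cases hk : k ∈ K
    · have h := (Homeomorph.mulRight k).measurableEmbedding.integral_map (μ := μ)
        fun s => density μ K hK k • (a (s * k⁻¹) * α s (v (s⁻¹ * t)))
      rw [show μ.map (Homeomorph.mulRight k) = μ from map_mul_right_eq_self μ K hK hk] at h
      rw [h]
      simp
    · simp only [density_eq_zero μ K hK hk, zero_smul]
  rw [conv_apply, conv_apply]
  simp only [h1, h2]
  -- The integral over s is brought inside, so that the substitution can be made for each fixed k;
  -- then the order is restored.
  rw [integral_integral_swap_of_hasCompactSupport]
  · simp only [h3]
    refine integral_integral_swap_of_hasCompactSupport ?_ ?_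
    · refine ((map_continuous (density μ K hK)).comp continuous_fst).smul (Continuous.mul ?_ ?_)
      · exact (map_continuous a).comp (continuous_snd.mul continuous_fst.inv)
      · exact α.continuous_uncurry.comp (continuous_snd.prodMk
          ((map_continuous v).comp (continuous_snd.inv.mul continuous_const)))
    · refine HasCompactSupport.intro (K := (K : Set G) ×ˢ (tsupport a * (K : Set G)))
        (hK.prod (a.hasCompactSupport.isCompact.mul hK)) ?_
      rintro ⟨k, s⟩ h
      change density μ K hK k • (a (s * k⁻¹) * _) = 0
      by_cases hk : k ∈ K
      · have : s * k⁻¹ ∉ tsupport a := fun hv => h ⟨hk, Set.mem_mul.mpr ⟨_, hv, k, hk, by group⟩⟩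
        rw [image_eq_zero_of_notMem_tsupport this, zero_mul, smul_zero]
      · rw [density_eq_zero μ K hK hk, zero_smul]
  · refine ((map_continuous (density μ K hK)).comp continuous_snd).smul (Continuous.mul ?_ ?_)
    · exact (map_continuous a).comp continuous_fst
    · exact α.continuous_uncurry.comp ((continuous_fst.mul continuous_snd).prodMk
        ((map_continuous v).comp ((continuous_fst.mul continuous_snd).inv.mul continuous_const)))
  · refine HasCompactSupport.intro (K := tsupport a ×ˢ (K : Set G))
      (a.hasCompactSupport.isCompact.prod hK) ?_
    rintro ⟨s, k⟩ h
    change density μ K hK k • (a s * _) = 0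
    by_cases hk : k ∈ K
    · have : s ∉ tsupport a := fun hv => h ⟨hv, hk⟩
      rw [image_eq_zero_of_notMem_tsupport this, zero_mul, smul_zero]
    · rw [density_eq_zero μ K hK hk, zero_smul]

/-- That E multiplies the crossed product into itself can be tested on the generators: E(XY) = (EX)Y
handles products, and continuity handles the closure. -/
theorem mul_mem_reducedCrossedProduct {E : L2 α μ →L[ℂ] L2 α μ}
    (hE : ∀ a, E * lam α μ a ∈ reducedCrossedProduct α μ) {A : L2 α μ →L[ℂ] L2 α μ}
    (hA : A ∈ reducedCrossedProduct α μ) : E * A ∈ reducedCrossedProduct α μ := by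
  have hle : ∀ X ∈ NonUnitalAlgebra.adjoin ℂ (Set.range (lam α μ)),
      X ∈ reducedCrossedProduct α μ := NonUnitalSubalgebra.le_topologicalClosure _
  have h : Set.MapsTo (fun X => E * X) (NonUnitalAlgebra.adjoin ℂ (Set.range (lam α μ)))
      (reducedCrossedProduct α μ) := by
    intro X hX
    induction hX using NonUnitalAlgebra.adjoin_induction with
    | mem X hX =>
      obtain ⟨a, rfl⟩ := hX
      exact hE a
    | add X Y _ _ hX hY =>
      simp only [mul_add]
      exact add_mem hX hY
    | zero =>
      simp only [mul_zero]
      exact zero_mem _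
    | mul X Y _ hY' hX _ =>
      simp only [← mul_assoc]
      exact mul_mem hX (hle _ hY')
    | smul c X _ hX =>
      simp only [mul_smul_comm]
      exact SMulMemClass.smul_mem c hX
  have := h.closure (continuous_const_mul E) hA
  rwa [(isClosed_reducedCrossedProduct α μ).closure_eq] at this

theorem mul_mem_reducedCrossedProduct' {E : L2 α μ →L[ℂ] L2 α μ}
    (hE : ∀ a, lam α μ a * E ∈ reducedCrossedProduct α μ) {A : L2 α μ →L[ℂ] L2 α μ}
    (hA : A ∈ reducedCrossedProduct α μ) : A * E ∈ reducedCrossedProduct α μ := by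
  have hle : ∀ X ∈ NonUnitalAlgebra.adjoin ℂ (Set.range (lam α μ)),
      X ∈ reducedCrossedProduct α μ := NonUnitalSubalgebra.le_topologicalClosure _
  have h : Set.MapsTo (fun X => X * E) (NonUnitalAlgebra.adjoin ℂ (Set.range (lam α μ)))
      (reducedCrossedProduct α μ) := by
    intro X hX
    induction hX using NonUnitalAlgebra.adjoin_induction with
    | mem X hX =>
      obtain ⟨a, rfl⟩ := hX
      exact hE a
    | add X Y _ _ hX hY =>
      simp only [add_mul]
      exact add_mem hX hY
    | zero =>
      simp only [zero_mul]
      exact zero_mem _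
    | mul X Y hX' _ _ hY =>
      simp only [mul_assoc]
      exact mul_mem (hle _ hX') hY
    | smul c X _ hX =>
      simp only [smul_mul_assoc]
      exact SMulMemClass.smul_mem c hX
  have := h.closure (continuous_mul_const E) hA
  rwa [(isClosed_reducedCrossedProduct α μ).closure_eq] at this

theorem lam_mem_reducedCrossedProduct (a : C_c(G, B)) :
    lam α μ a ∈ reducedCrossedProduct α μ :=
  NonUnitalSubalgebra.le_topologicalClosure _ (NonUnitalAlgebra.subset_adjoin ℂ ⟨a, rfl⟩)

theorem eK_mul_mul_eK_mem {A : L2 α μ →L[ℂ] L2 α μ} (hA : A ∈ reducedCrossedProduct α μ) :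
    eK α μ K hK * A * eK α μ K hK ∈ reducedCrossedProduct α μ := by
  refine mul_mem_reducedCrossedProduct' α μ (fun a => ?_)
    (mul_mem_reducedCrossedProduct α μ (fun a => ?_) hA)
  · rw [lam_mul_eK]
    exact lam_mem_reducedCrossedProduct α μ _
  · rw [eK_mul_lam]
    exact lam_mem_reducedCrossedProduct α μ _

theorem isClosed_corner {e : L2 α μ →L[ℂ] L2 α μ}
    {S : NonUnitalSubalgebra ℂ (L2 α μ →L[ℂ] L2 α μ)}
    (hS : IsClosed (S : Set (L2 α μ →L[ℂ] L2 α μ))) :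
    IsClosed (corner e S : Set (L2 α μ →L[ℂ] L2 α μ)) :=
  hS.inter ((isClosed_eq (continuous_const_mul e) continuous_id).inter
    (isClosed_eq (continuous_mul_const e) continuous_id))

/-- `e_K V_ℓ^∞(G, B) e_K` is dense in `e_K C_r^*(G, B) e_K`. -/
theorem corner_reducedCrossedProduct_subset_closure [T2Space G] (hℓ : Measurable ℓ)
    (h : ∀ k ∈ K, ∀ g, ℓ (k * g) = ℓ g) :
    (corner (eK α μ K hK) (reducedCrossedProduct α μ) : Set (L2 α μ →L[ℂ] L2 α μ)) ⊆
      closure (corner (eK α μ K hK) (vInf α μ ℓ)) := by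
  rintro A ⟨hA, hA1, hA2⟩
  have hee : eK α μ K hK * eK α μ K hK = eK α μ K hK := isIdempotentElem_eK α μ K hK
  -- Compression by e_K is continuous, sends smooth elements to smooth elements of the corner and
  -- fixes A. Applied to approximants of A, it gives approximants inside the corner.
  have hm : Set.MapsTo (fun X => eK α μ K hK * X * eK α μ K hK) (vInf α μ ℓ)
      (corner (eK α μ K hK) (vInf α μ ℓ)) := by
    rintro X ⟨hX, hX'⟩
    have he := isSmooth_eK α μ K hK hℓ h
    refine ⟨⟨eK_mul_mul_eK_mem α μ K hK hX, (he.mul hX').mul he⟩, ?_, ?_⟩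
    · rw [← mul_assoc, ← mul_assoc, hee]
    · rw [mul_assoc, hee]
  have := hm.closure (by fun_prop) (reducedCrossedProduct_subset_closure α μ hℓ hA)
  simpa only [hA1, hA2] using this

end Corner

end CStarAction

theorem corollary3p1 {G B : Type*} [Group G] [TopologicalSpace G] [IsTopologicalGroup G]
    [LocallyCompactSpace G] [T2Space G] [MeasurableSpace G] [BorelSpace G]
    [NonUnitalCStarAlgebra B] (α : CStarAction G B)
    (μ : MeasureTheory.Measure G) [μ.IsHaarMeasure] [μ.Regular]
    (ℓ : GroupSeminorm G) (hℓ : Measurable ℓ) :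
    (Function.Bijective (KTheory.K0.map (CStarAction.vInfIncl α μ ℓ)) ∧
      Function.Bijective (KTheory.K1.map (CStarAction.vInfIncl α μ ℓ)
        (CStarAction.continuous_vInfIncl α μ ℓ))) ∧
    ∀ (K : OpenSubgroup G) (hK : IsCompact (K : Set G)),
      (∀ k ∈ K, ∀ g : G, ℓ (k * g) = ℓ g ∧ ℓ (g * k) = ℓ g) →
      Function.Bijective (KTheory.K0.map (CStarAction.cornerIncl α μ ℓ K hK)) ∧
      Function.Bijective (KTheory.K1.map (CStarAction.cornerIncl α μ ℓ K hK)
        (CStarAction.continuous_cornerIncl α μ ℓ K hK)) := by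
  constructor
  · have h := CStarAction.Smooth.isDenseSmooth_incl hℓ (CStarAction.vInf_le α μ ℓ)
      (CStarAction.isClosed_reducedCrossedProduct α μ) (fun _ => Iff.rfl)
      (CStarAction.reducedCrossedProduct_subset_closure α μ hℓ)
    exact ⟨h.K0_map_bijective, h.K1_map_bijective⟩
  · intro K hK hinv
    -- Smoothness and the corner conditions are independent requirements on an operator, so the
    -- corner of V consists of the smooth elements of the corner of C_r^*(G, B).
    have h := CStarAction.Smooth.isDenseSmooth_incl hℓ
      (CStarAction.corner_mono (CStarAction.eK α μ K hK) (CStarAction.vInf_le α μ ℓ))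
      (CStarAction.isClosed_corner α μ (CStarAction.isClosed_reducedCrossedProduct α μ))
      (fun _ => and_right_comm)
      (CStarAction.corner_reducedCrossedProduct_subset_closure α μ K hK hℓ
        fun k hk g => (hinv k hk g).1)
    exact ⟨h.K0_map_bijective, h.K1_map_bijective⟩
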